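/- Let $N>2$ be an integer, $0<a<\frac{N-2}{2}$, $a<b<a+1$, $d:=1+a-b$, $2^\sharp:=\frac{2N}{N-2d}$, $2<q<2^\sharp$, $\beta,\rho>0$, $m\in\mathbb R$, and $\delta_q:=\frac{(N-2a+2b)q-2N}{2q}$. Let $\mathcal D_a^{1,2}(\mathbb R^N)$ be the completion of $C_c^\infty(\mathbb R^N)$ for the norm $\||x|^{-a}\nabla u\|_2$ (regarded as a space of functions), and let $$\mathcal X:=\{u\in \mathcal D_a^{1,2}(\mathbb R^N): u \text{ radial},\ \||x|^{-a}u\|_2<\infty\},\qquad \|u\|_{\mathcal X}^2=\||x|^{-a}\nabla u\|_2^2+\||x|^{-a}u\|_2^2,$$ $$S_\rho:=\{u\in\mathcal X:\ \||x|^{-a}u\|_2^2=\rho^2\},\qquad \mathcal S(a,b):=\inf_{u\in\mathcal D_a^{1,2}(\mathbb R^N)\setminus\{0\}}\frac{\||x|^{-a}\nabla u\|_2^2}{\||x|^{-b}u\|_{2^\sharp}^2}.$$ For $u\in\mathcal X$ put $$\mathcal E_\beta(u)=\tfrac12\||x|^{-a}\nabla u\|_2^2-\tfrac{\beta}{q}\||x|^{-b}u\|_q^q-\tfrac1{2^\sharp}\||x|^{-b}u\|_{2^\sharp}^{2^\sharp},$$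 $$P_\beta(u)=\||x|^{-a}\nabla u\|_2^2-\beta\delta_q\||x|^{-b}u\|_q^q-\||x|^{-b}u\|_{2^\sharp}^{2^\sharp}.$$ Consider, for $\lambda\in\mathbb R$, the problem $$-\operatorname{div}(|x|^{-2a}\nabla u)=\lambda\frac{u}{|x|^{2a}}+\beta\frac{|u|^{q-2}u}{|x|^{bq}}+\frac{|u|^{2^\sharp-2}u}{|x|^{b2^\sharp}}\ \text{ in }\mathbb R^N,\qquad \int_{\mathbb R^N}\frac{|u|^2}{|x|^{2a}}\,dx=\rho^2,\tag{$\mathcal P$}$$ whose equation is understood weakly, tested against all (not necessarily radial) $\varphi\in\mathcal D_a^{1,2}(\mathbb R^N)$ with $\||x|^{-a}\varphi\|_2<\infty$. Let $(u_n)\subset S_\rho$ be a Palais–Smale sequence for $\mathcal E_\beta|_{S_\rho}$ at level $m$, that is, $\mathcal E_\beta(u_n)\to m$ and the norm of $\mathcal E_\beta'(u_n)$ restricted to the tangent space $\{\varphi\in\mathcal X:\int|x|^{-2a}u_n\varphi\,dx=0\}$ tends to $0$. Suppose that $m\neq0$, $m<\frac dN\mathcal S(a,b)^{N/(2d)}$,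 and $P_\beta(u_n)\to0$. Then at least one of the following alternatives holds. (I) There are a subsequence of $(u_n)$, a function $u\in\mathcal X\setminus\{0\}$ and $\lambda<0$ such that along the subsequence $u_n\rightharpoonup u$ weakly but not strongly in $\mathcal X$, $u$ solves $(\mathcal P)$ with this $\lambda$, and $\mathcal E_\beta(u)\le m-\frac dN\mathcal S(a,b)^{N/(2d)}$. (II) There are a subsequence of $(u_n)$, a function $u\in\mathcal X$ and $\lambda<0$ such that along the subsequence $u_n\to u$ strongly in $\mathcal X$, $u$ solves $(\mathcal P)$ with this $\lambda$, and $\mathcal E_\beta(u)=m$. -/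

import Mathlib

open MeasureTheory Filter Topology
open scoped ContDiff

noncomputable section

namespace CKN

/-- The weighted measure `|x|^{-2a} dx` on `ℝ^N`. For `N ≥ 1` it has the same null sets as
Lebesgue measure, since the weight vanishes at most at the origin. -/
def wMeasure (N : ℕ) (a : ℝ) : Measure (EuclideanSpace ℝ (Fin N)) :=
  volume.withDensity fun x => ENNReal.ofReal (‖x‖ ^ (-2 * a))

/-- `u` belongs to `D_a^{1,2}(ℝ^N)`, the completion of `C_c^∞(ℝ^N)` for the norm
`‖ |x|^{-a} ∇φ ‖_2`, and `g` is its gradient. The completion is realised as a space of functions: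
there is a sequence of test functions whose gradients converge to `g` in `L²(|x|^{-2a} dx)` and
which converges to `u` almost everywhere. -/
structure IsD {N : ℕ} (a : ℝ) (u : EuclideanSpace ℝ (Fin N) → ℝ)
    (g : EuclideanSpace ℝ (Fin N) → EuclideanSpace ℝ (Fin N)) : Prop where
  memLp_grad : MemLp g 2 (wMeasure N a)
  approx : ∃ φ : ℕ → EuclideanSpace ℝ (Fin N) → ℝ,
    (∀ n, ContDiff ℝ ∞ (φ n) ∧ HasCompactSupport (φ n)) ∧
    Tendsto (fun n => eLpNorm (fun x => gradient (φ n) x - g x) 2 (wMeasure N a)) atTop (𝓝 0) ∧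
    ∀ᵐ x ∂(wMeasure N a), Tendsto (fun n => φ n x) atTop (𝓝 (u x))

/-- `u` is (almost everywhere equal to) a radial function. -/
def IsRadial {N : ℕ} (a : ℝ) (u : EuclideanSpace ℝ (Fin N) → ℝ) : Prop :=
  ∃ f : ℝ → ℝ, Measurable f ∧ u =ᵐ[wMeasure N a] fun x => f ‖x‖

/-- The Hilbert space `L²(|x|^{-2a} dx; ℝ) × L²(|x|^{-2a} dx; ℝ^N)`, with
`‖(u, g)‖² = ‖ |x|^{-a} u ‖_2² + ‖ |x|^{-a} g ‖_2²`, in which `u` is recorded along with its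
gradient `g`. -/
abbrev Ambient (N : ℕ) (a : ℝ) : Type :=
  WithLp 2 (Lp ℝ 2 (wMeasure N a) × Lp (EuclideanSpace ℝ (Fin N)) 2 (wMeasure N a))

theorem IsD.congr {N : ℕ} {a : ℝ} {u v : EuclideanSpace ℝ (Fin N) → ℝ}
    {g h : EuclideanSpace ℝ (Fin N) → EuclideanSpace ℝ (Fin N)} (H : IsD a u g)
    (huv : u =ᵐ[wMeasure N a] v) (hgh : g =ᵐ[wMeasure N a] h) : IsD a v h := by
  obtain ⟨hg, φ, h1, h2, h3⟩ := H
  refine ⟨hg.ae_eq hgh, φ, h1, ?_, ?_⟩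
  · refine h2.congr fun n => eLpNorm_congr_ae ?_
    filter_upwards [hgh] with x hx
    rw [hx]
  · filter_upwards [h3, huv] with x hx hx'
    rwa [← hx']

theorem IsD.zero {N : ℕ} (a : ℝ) :
    IsD a (0 : EuclideanSpace ℝ (Fin N) → ℝ) 0 := by
  refine ⟨MemLp.zero, fun _ => 0, fun _ => ⟨contDiff_const, HasCompactSupport.zero⟩, ?_, ?_⟩
  · have : ∀ x : EuclideanSpace ℝ (Fin N),
        gradient (0 : EuclideanSpace ℝ (Fin N) → ℝ) x = 0 := by
      intro x
      simp [gradient]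
    simp [this]
  · exact Eventually.of_forall fun x => tendsto_const_nhds

theorem aestronglyMeasurable_gradient {N : ℕ} {a : ℝ} {φ : EuclideanSpace ℝ (Fin N) → ℝ}
    (h : ContDiff ℝ ∞ φ) : AEStronglyMeasurable (gradient φ) (wMeasure N a) := by
  have hc : Continuous (fderiv ℝ φ) := h.continuous_fderiv (by simp)
  exact ((InnerProductSpace.toDual ℝ (EuclideanSpace ℝ (Fin N))).symm.continuous.comp
    hc).aestronglyMeasurable

theorem IsD.add {N : ℕ} {a : ℝ} {u v : EuclideanSpace ℝ (Fin N) → ℝ}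
    {g h : EuclideanSpace ℝ (Fin N) → EuclideanSpace ℝ (Fin N)} (H : IsD a u g)
    (K : IsD a v h) : IsD a (u + v) (g + h) := by
  obtain ⟨hg, φ, h1, h2, h3⟩ := H
  obtain ⟨hh, ψ, k1, k2, k3⟩ := K
  refine ⟨hg.add hh, fun n => φ n + ψ n,
    fun n => ⟨(h1 n).1.add (k1 n).1, (h1 n).2.add (k1 n).2⟩, ?_, ?_⟩
  · have hs := h2.add k2
    rw [add_zero] at hs
    refine tendsto_of_tendsto_of_tendsto_of_le_of_le tendsto_const_nhds hs
      (fun _ => bot_le) fun n => ?_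
    have e : (fun x => gradient (φ n + ψ n) x - (g + h) x)
        = (fun x => gradient (φ n) x - g x) + fun x => gradient (ψ n) x - h x := by
      funext x
      have hd := ((h1 n).1.differentiable (by simp)) x
      have kd := ((k1 n).1.differentiable (by simp)) x
      simp only [gradient, Pi.add_apply, fderiv_add hd kd, map_add]
      abel
    rw [e]
    exact eLpNorm_add_le ((aestronglyMeasurable_gradient (h1 n).1).sub hg.1)
      ((aestronglyMeasurable_gradient (k1 n).1).sub hh.1) (by norm_num)
  · filter_upwards [h3, k3] with x hx kx
    exact hx.add kx

theorem IsD.smul {N : ℕ} {a : ℝ} {u : EuclideanSpace ℝ (Fin N) → ℝ}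
    {g : EuclideanSpace ℝ (Fin N) → EuclideanSpace ℝ (Fin N)} (c : ℝ) (H : IsD a u g) :
    IsD a (c • u) (c • g) := by
  obtain ⟨hg, φ, h1, h2, h3⟩ := H
  refine ⟨hg.const_smul c, fun n => c • φ n,
    fun n => ⟨(h1 n).1.const_smul c, (h1 n).2.smul_left (f := fun _ => c)⟩, ?_, ?_⟩
  · have hs := ENNReal.Tendsto.const_mul (a := ‖c‖ₑ) h2 (Or.inr (by simp))
    rw [mul_zero] at hs
    refine hs.congr fun n => ?_
    rw [← eLpNorm_const_smul]
    congr 1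
    funext x
    have hd := ((h1 n).1.differentiable (by simp)) x
    simp only [gradient, Pi.smul_apply, fderiv_const_smul hd, map_smul, smul_sub]
  · filter_upwards [h3] with x hx
    exact hx.const_smul c

/-- The energy space `D_a^{1,2}(ℝ^N) ∩ L²(ℝ^N; |x|^{-2a})` (no symmetry required), an element
being a pair `(u, ∇u)`. -/
def energySpace (N : ℕ) (a : ℝ) : Submodule ℝ (Ambient N a) where
  carrier := {w | IsD a w.fst w.snd}
  zero_mem' := (IsD.zero a).congr (Lp.coeFn_zero _ _ _).symm (Lp.coeFn_zero _ _ _).symm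
  add_mem' := fun hv hw =>
    (hv.add hw).congr (Lp.coeFn_add _ _).symm (Lp.coeFn_add _ _).symm
  smul_mem' := fun c _ hw =>
    (hw.smul c).congr (Lp.coeFn_smul c _).symm (Lp.coeFn_smul c _).symm

/-- Pairs `(u, g)` with `u` radial. -/
def radialSpace (N : ℕ) (a : ℝ) : Submodule ℝ (Ambient N a) where
  carrier := {w | IsRadial a w.fst}
  zero_mem' := ⟨0, measurable_const, Lp.coeFn_zero _ _ _⟩
  add_mem' := by
    rintro v w ⟨f, hf, hv⟩ ⟨k, hk, hw⟩
    refine ⟨f + k, hf.add hk, (Lp.coeFn_add v.fst w.fst).trans ?_⟩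
    filter_upwards [hv, hw] with x hx kx
    simp [hx, kx]
  smul_mem' := by
    rintro c w ⟨f, hf, hw⟩
    refine ⟨c • f, hf.const_smul c, (Lp.coeFn_smul c w.fst).trans ?_⟩
    filter_upwards [hw] with x hx
    simp [hx]

/-- The space `𝒳 = D_{a,r}^{1,2}(ℝ^N) ∩ L²_r(ℝ^N; |x|^{-2a})` of radial functions, with the norm
`(‖ |x|^{-a} u ‖_2² + ‖ |x|^{-a} ∇u ‖_2²)^{1/2}` inherited from the ambient Hilbert space. -/
abbrev X (N : ℕ) (a : ℝ) : Submodule ℝ (Ambient N a) := energySpace N a ⊓ radialSpace N a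

/-- The function underlying an element of the ambient space. -/
def Ambient.fn {N : ℕ} {a : ℝ} (w : Ambient N a) : EuclideanSpace ℝ (Fin N) → ℝ := w.fst

/-- The gradient of the function underlying an element of the energy space. -/
def Ambient.grad {N : ℕ} {a : ℝ} (w : Ambient N a) :
    EuclideanSpace ℝ (Fin N) → EuclideanSpace ℝ (Fin N) := w.snd

/-- `d = 1 + a - b`. -/
def dExp (a b : ℝ) : ℝ := 1 + a - b

/-- The critical exponent `2^♯ = 2N / (N - 2d)`. -/
def critExp (N : ℕ) (a b : ℝ) : ℝ := 2 * N / (N - 2 * dExp a b)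

/-- `δ_q = ((N - 2a + 2b) q - 2N) / (2q)`. -/
def deltaExp (N : ℕ) (a b q : ℝ) : ℝ := ((N - 2 * a + 2 * b) * q - 2 * N) / (2 * q)

/-- `‖ |x|^{-a} g ‖_2²`. -/
def gradSq {N : ℕ} (a : ℝ) (g : EuclideanSpace ℝ (Fin N) → EuclideanSpace ℝ (Fin N)) : ℝ :=
  ∫ x, ‖x‖ ^ (-2 * a) * ‖g x‖ ^ 2

/-- `‖ |x|^{-b} u ‖_p^p`. -/
def wPow {N : ℕ} (b p : ℝ) (u : EuclideanSpace ℝ (Fin N) → ℝ) : ℝ :=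
  ∫ x, ‖x‖ ^ (-b * p) * |u x| ^ p

/-- The best Caffarelli–Kohn–Nirenberg constant: the infimum of
`‖ |x|^{-a} ∇u ‖_2² / ‖ |x|^{-b} u ‖_{2^♯}²` over all nonzero `u ∈ D_a^{1,2}(ℝ^N)`. -/
def bestConst (N : ℕ) (a b : ℝ) : ℝ :=
  sInf {s : ℝ | ∃ (u : EuclideanSpace ℝ (Fin N) → ℝ)
    (g : EuclideanSpace ℝ (Fin N) → EuclideanSpace ℝ (Fin N)),
    IsD a u g ∧ ¬ u =ᵐ[volume] 0 ∧
    s = gradSq a g / (wPow b (critExp N a b) u) ^ (2 / critExp N a b)}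

/-- The energy `ℰ_β` on `𝒳`. -/
def energy {N : ℕ} {a : ℝ} (b q β : ℝ) (u : X N a) : ℝ :=
  1 / 2 * gradSq a u.1.grad - β / q * wPow b q u.1.fn
    - 1 / critExp N a b * wPow b (critExp N a b) u.1.fn

/-- The Pohozaev functional `P_β`. -/
def pohozaev {N : ℕ} {a : ℝ} (b q β : ℝ) (u : X N a) : ℝ :=
  gradSq a u.1.grad - β * deltaExp N a b q * wPow b q u.1.fn
    - wPow b (critExp N a b) u.1.fn

/-- The constraint `S_ρ = {u ∈ 𝒳 : ‖ |x|^{-a} u ‖_2² = ρ²}`. -/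
def sphere {N : ℕ} {a : ℝ} (ρ : ℝ) : Set (X N a) :=
  {u | ∫ x, ‖x‖ ^ (-2 * a) * u.1.fn x ^ 2 = ρ ^ 2}

/-- The tangent space of the constraint at `u`: all `φ ∈ 𝒳` with `∫ |x|^{-2a} u φ dx = 0`. The
inner product is that of `L²(|x|^{-2a} dx)`. -/
def tangentSpace {N : ℕ} {a : ℝ} (u : X N a) : Submodule ℝ (X N a) where
  carrier := {φ | inner ℝ u.1.fst φ.1.fst = 0}
  zero_mem' := by simp
  add_mem' := by
    intro φ ψ hφ hψ
    simp only [Set.mem_ofPred_eq] at hφ hψ ⊢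
    simp [inner_add_right, hφ, hψ]
  smul_mem' := by
    intro c φ hφ
    simp only [Set.mem_ofPred_eq] at hφ ⊢
    simp [inner_smul_right, hφ]

/-- `(u_n)` is a Palais–Smale sequence at level `m` for the restriction of `ℰ_β` to `S_ρ`: it lies
on `S_ρ`, `ℰ_β(u_n) → m`, and the norm of the differential of `ℰ_β` at `u_n`, restricted to the
tangent space of `S_ρ` at `u_n`, tends to zero. -/
structure IsPalaisSmale {N : ℕ} {a : ℝ} (b q β ρ m : ℝ) (u : ℕ → X N a) : Prop where
  mem_sphere : ∀ n, u n ∈ sphere ρ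
  energy_tendsto : Tendsto (fun n => energy b q β (u n)) atTop (𝓝 m)
  deriv_tendsto : Tendsto
    (fun n => ‖(fderiv ℝ (energy b q β) (u n)).comp (tangentSpace (u n)).subtypeL‖) atTop (𝓝 0)

/-- `u ∈ 𝒳` is a weak solution, with multiplier `l`, of
`-div(|x|^{-2a} ∇u) = l |x|^{-2a} u + β |x|^{-bq} |u|^{q-2} u + |x|^{-b 2^♯} |u|^{2^♯-2} u` in `ℝ^N`
with `∫ |x|^{-2a} u² dx = ρ²`. Test functions range over all of
`D_a^{1,2}(ℝ^N) ∩ L²(ℝ^N; |x|^{-2a})`, which contains `C_c^∞(ℝ^N)`; they need not be radial. -/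
structure IsSolution {N : ℕ} {a : ℝ} (b q β ρ l : ℝ) (u : X N a) : Prop where
  mass : u ∈ sphere ρ
  weak_eq : ∀ φ ∈ energySpace N a,
    ∫ x, ‖x‖ ^ (-2 * a) * inner ℝ (u.1.grad x) (φ.grad x) =
      l * (∫ x, ‖x‖ ^ (-2 * a) * (u.1.fn x * φ.fn x))
      + β * (∫ x, ‖x‖ ^ (-b * q) * (|u.1.fn x| ^ (q - 2) * u.1.fn x * φ.fn x))
      + ∫ x, ‖x‖ ^ (-b * critExp N a b) *
          (|u.1.fn x| ^ (critExp N a b - 2) * u.1.fn x * φ.fn x)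

/-- Weak convergence in `𝒳`. -/
def WeaklyTendsto {N : ℕ} {a : ℝ} (u : ℕ → X N a) (u₀ : X N a) : Prop :=
  ∀ l : X N a →L[ℝ] ℝ, Tendsto (fun n => l (u n)) atTop (𝓝 (l u₀))

end CKN

end

/-! The proof is a concentration–compactness argument in which radial symmetry turns every nonlinear
term, the critical one included, into a quadratic term governed by Hardy's inequality.

A radial element of `X` is the primitive, vanishing at infinity, of its radial derivative
(`IsD.exists_profile`), so Cauchy–Schwarz gives |u(r)| ≤ K r^(-σ) ‖|x|^(-a)∇u‖_2 with σ = (N-2-2a)/2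
(`exists_eval`). Spending p-2 powers of |u| on this bound dominates |x|^(-bp)|u|^p by a constant
times |x|^(-e) u², the constant depending only on the gradient norm. Here 2a < e ≤ 2a+2 for 2 < p ≤
2^♯, with e = 2a+2 exactly at p = 2^♯ (`Admissible.weightExp_critExp`). The weighted Hardy
inequality `IsD.hardy` controls |x|^(-2a-2) u², so all powers are treated in one L² space:
differentiability, weak continuity of the derivative and the Brezis–Lieb splitting hold up to and
including 2^♯ (namespace `IsSubcritical`), while for q < 2^♯ the strict inequality e < 2a+2 yields
compactness (`compactness_condition`).

The sequence is bounded because suitable combinations of ℰ_β and P_β are coercive on the sphere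
(`exists_bound`). Let w be a weak limit and Q the limit of the q-terms, which is the q-term of w.
Since ℰ_β'(u_n)u_n = P_β(u_n) - β(1-δ_q) times the q-term, the multipliers tend to λ =
-β(1-δ_q)Q/ρ², and w satisfies the equation against radial tests (`limit_equation`). The profile of
w then solves an ordinary differential equation (`exists_ode`). From it follow the Pohozaev identity
P_β(w) = 0 (`pohozaev_eq_zero`) and the equation against nonradial tests
(`inner_snd_eq_integral_source`).

Let s be the limit of ‖|x|^(-a)∇(u_n - w)‖_2². As P_β(u_n) → 0 and P_β(w) = 0, the critical terms of
u_n - w have the same limit s, and m = ℰ_β(w) + (d/N)s. The Caffarelli–Kohn–Nirenberg inequality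
gives S s^(2/2^♯) ≤ s, so s = 0 or s ≥ S^(N/(2d)). If w were 0 then m = (d/N)s, which both cases
forbid; hence w ≠ 0, Q > 0 and λ < 0. Testing the equation with w and using P_β(w) = 0 gives
λ‖|x|^(-a)w‖_2² = λρ², so no mass is lost. The case s = 0 is strong convergence, alternative (II);
the other is alternative (I). -/

namespace CKN

/-! ### Weighted L² spaces on ℝ^N. -/

section Weights

variable {N : ℕ}

theorem measurable_norm_rpow (s : ℝ) :
    Measurable fun x : EuclideanSpace ℝ (Fin N) => ‖x‖ ^ s :=
  measurable_norm.pow_const s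

theorem nontrivial_euclidean (hN : 2 < N) : Nontrivial (EuclideanSpace ℝ (Fin N)) := by
  have : Nonempty (Fin N) := ⟨⟨0, by omega⟩⟩
  infer_instance

theorem ae_ne_zero (hN : 2 < N) : ∀ᵐ x : EuclideanSpace ℝ (Fin N), x ≠ 0 := by
  have := nontrivial_euclidean hN
  have : ({0}ᶜ : Set (EuclideanSpace ℝ (Fin N))) ∈ ae volume := by
    rw [mem_ae_iff]; simp
  exact this

/-- The density is positive off the origin, which is a null set. Almost everywhere statements can
therefore pass freely between Lebesgue measure and the weights for a and a + 1. -/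
theorem ae_wMeasure (hN : 2 < N) (a : ℝ) : ae (wMeasure N a) = ae volume := by
  refine le_antisymm (withDensity_absolutelyContinuous _ _).ae_le ?_
  refine (withDensity_absolutelyContinuous' ?_ ?_).ae_le
  · exact (measurable_norm_rpow _).ennreal_ofReal.aemeasurable
  · filter_upwards [ae_ne_zero hN] with x hx
    have : 0 < ‖x‖ := norm_pos_iff.mpr hx
    simp only [ne_eq, ENNReal.ofReal_eq_zero, not_le]
    positivity

theorem aestronglyMeasurable_wMeasure (hN : 2 < N) {a : ℝ} {F : Type*} [TopologicalSpace F]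
    {f : EuclideanSpace ℝ (Fin N) → F} :
    AEStronglyMeasurable f (wMeasure N a) ↔ AEStronglyMeasurable f volume := by
  constructor
  · rintro ⟨g, hg, h⟩
    exact ⟨g, hg, by rwa [EventuallyEq, ae_wMeasure hN] at h⟩
  · rintro ⟨g, hg, h⟩
    exact ⟨g, hg, by rwa [EventuallyEq, ae_wMeasure hN]⟩

theorem integral_wMeasure (a : ℝ) {F : Type*} [NormedAddCommGroup F] [NormedSpace ℝ F]
    (f : EuclideanSpace ℝ (Fin N) → F) :
    ∫ x, f x ∂(wMeasure N a) = ∫ x, ‖x‖ ^ (-2 * a) • f x := by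
  rw [wMeasure, integral_withDensity_eq_integral_toReal_smul
    (measurable_norm_rpow _).ennreal_ofReal (by simp)]
  refine integral_congr_ae (Eventually.of_forall fun x => ?_)
  simp only
  rw [ENNReal.toReal_ofReal (by positivity)]

theorem integrable_wMeasure (a : ℝ) {F : Type*} [NormedAddCommGroup F] [NormedSpace ℝ F]
    (f : EuclideanSpace ℝ (Fin N) → F) :
    Integrable f (wMeasure N a) ↔ Integrable (fun x => ‖x‖ ^ (-2 * a) • f x) := by
  rw [wMeasure, integrable_withDensity_iff_integrable_smul'
    (measurable_norm_rpow _).ennreal_ofReal (by simp)]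
  refine integrable_congr (Eventually.of_forall fun x => ?_)
  simp only
  rw [ENNReal.toReal_ofReal (by positivity)]

theorem memLp_two_wMeasure (hN : 2 < N) (a : ℝ) {F : Type*} [NormedAddCommGroup F]
    {f : EuclideanSpace ℝ (Fin N) → F} :
    MemLp f 2 (wMeasure N a) ↔
      AEStronglyMeasurable f volume ∧ Integrable (fun x => ‖x‖ ^ (-2 * a) * ‖f x‖ ^ 2) := by
  constructor
  · intro h
    refine ⟨(aestronglyMeasurable_wMeasure hN).1 h.1, ?_⟩
    simpa using (integrable_wMeasure a _).1 ((memLp_two_iff_integrable_sq_norm h.1).1 h)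
  · rintro ⟨h, h'⟩
    exact (memLp_two_iff_integrable_sq_norm ((aestronglyMeasurable_wMeasure hN).2 h)).2
      ((integrable_wMeasure a _).2 (by simpa using h'))

theorem eLpNorm_two_wMeasure (hN : 2 < N) (a : ℝ) {F : Type*} [NormedAddCommGroup F]
    [NormedSpace ℝ F] {f : EuclideanSpace ℝ (Fin N) → F} (hf : AEStronglyMeasurable f volume) :
    eLpNorm f 2 (wMeasure N a) = eLpNorm (fun x => ‖x‖ ^ (-a) • f x) 2 volume := by
  rw [eLpNorm_eq_lintegral_rpow_enorm_toReal (by norm_num) (by norm_num),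
    eLpNorm_eq_lintegral_rpow_enorm_toReal (by norm_num) (by norm_num), wMeasure,
    lintegral_withDensity_eq_lintegral_mul₀ (measurable_norm_rpow _).ennreal_ofReal.aemeasurable]
  · congr 1
    refine lintegral_congr_ae ?_
    filter_upwards [ae_ne_zero hN] with x hx
    have hx' : 0 < ‖x‖ := norm_pos_iff.mpr hx
    simp only [Pi.mul_apply, enorm_smul, ENNReal.toReal_ofNat, ENNReal.rpow_ofNat, mul_pow]
    congr 1
    rw [Real.enorm_of_nonneg (by positivity), ← ENNReal.ofReal_pow (by positivity),
      ← Real.rpow_natCast, ← Real.rpow_mul hx'.le]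
    congr 2
    push_cast; ring
  · exact (hf.enorm.pow_const _)

/-- `L²` pairing is continuous in its first argument. -/
theorem tendsto_integral_inner {α F : Type*} [MeasurableSpace α] {ν : Measure α}
    [NormedAddCommGroup F] [InnerProductSpace ℝ F] {f : ℕ → α → F} {g h : α → F}
    (hf : ∀ n, MemLp (f n) 2 ν) (hg : MemLp g 2 ν) (hh : MemLp h 2 ν)
    (H : Tendsto (fun n => eLpNorm (f n - g) 2 ν) atTop (𝓝 0)) :
    Tendsto (fun n => ∫ x, inner ℝ (f n x) (h x) ∂ν) atTop (𝓝 (∫ x, inner ℝ (g x) (h x) ∂ν)) := by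
  have h1 := (Lp.tendsto_Lp_iff_tendsto_eLpNorm'' f hf g hg).2 H
  have h2 : Tendsto (fun n => inner ℝ ((hf n).toLp (f n)) (hh.toLp h)) atTop
      (𝓝 (inner ℝ (hg.toLp g) (hh.toLp h))) := h1.inner tendsto_const_nhds
  have key : ∀ {k : α → F} (hk : MemLp k 2 ν),
      inner ℝ (hk.toLp k) (hh.toLp h) = ∫ x, inner ℝ (k x) (h x) ∂ν := by
    intro k hk
    rw [L2.inner_def]
    refine integral_congr_ae ?_
    filter_upwards [hk.coeFn_toLp, hh.coeFn_toLp] with x h1 h2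
    rw [h1, h2]
  simpa only [key] using h2

theorem continuous_mul_norm_rpow {η : EuclideanSpace ℝ (Fin N) → ℝ} (hη : Continuous η)
    (h0 : (0 : EuclideanSpace ℝ (Fin N)) ∉ tsupport η) (s : ℝ) :
    Continuous fun x => ‖x‖ ^ s * η x := by
  rw [continuous_iff_continuousAt]
  intro x
  by_cases hx : x = 0
  · subst hx
    have h1 : (fun x => ‖x‖ ^ s * η x) =ᶠ[𝓝 0] fun _ => 0 := by
      filter_upwards [notMem_tsupport_iff_eventuallyEq.1 h0] with y hy
      rw [hy]; simp
    exact (continuousAt_congr h1).2 continuousAt_const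
  · exact (continuous_norm.continuousAt.rpow_const (Or.inl (norm_ne_zero_iff.2 hx))).mul
      hη.continuousAt

theorem memLp_two_wMeasure_of_compact (hN : 2 < N) (a : ℝ) {η : EuclideanSpace ℝ (Fin N) → ℝ}
    (hη : Continuous η) (h0 : (0 : EuclideanSpace ℝ (Fin N)) ∉ tsupport η)
    (hc : HasCompactSupport η) : MemLp η 2 (wMeasure N a) := by
  refine (memLp_two_wMeasure hN a).2 ⟨hη.aestronglyMeasurable, ?_⟩
  have h1 := (continuous_mul_norm_rpow hη h0 (-2 * a)).mul hη
  have h2 : Integrable (fun x => ‖x‖ ^ (-2 * a) * η x * η x) :=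
    h1.integrable_of_hasCompactSupport hc.mul_left
  refine h2.congr (Eventually.of_forall fun x => ?_)
  simp only [Real.norm_eq_abs, sq_abs]; ring

end Weights

/-! ### The Euler identity and a regularised Hardy inequality for test functions. -/

section IntegrationByParts

variable {N : ℕ}

/-- The Euler operator `x · ∇` has adjoint `-N - x · ∇`. -/
theorem integral_fderiv_self {P : EuclideanSpace ℝ (Fin N) → ℝ} (hP : ContDiff ℝ 1 P)
    (hc : HasCompactSupport P) : ∫ x, fderiv ℝ P x x = -(N * ∫ x, P x) := by
  have hf : Continuous (fderiv ℝ P) := hP.continuous_fderiv one_ne_zero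
  have hint : ∀ i : Fin N, Integrable fun x : EuclideanSpace ℝ (Fin N) =>
      fderiv ℝ P x (EuclideanSpace.single i 1) * x i := fun i => by
    refine Continuous.integrable_of_hasCompactSupport (by fun_prop) ?_
    refine HasCompactSupport.mul_right ?_
    exact (hc.fderiv ℝ).comp_left (g := fun L : _ →L[ℝ] ℝ => L (EuclideanSpace.single i 1)) rfl
  have key : ∀ i : Fin N, ∫ x : EuclideanSpace ℝ (Fin N),
      fderiv ℝ P x (EuclideanSpace.single i 1) * x i = -∫ x, P x := by
    intro i
    have hd : ∀ x : EuclideanSpace ℝ (Fin N),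
        fderiv ℝ (fun y : EuclideanSpace ℝ (Fin N) => y i) x (EuclideanSpace.single i 1) = 1 := by
      intro x
      have : HasFDerivAt (fun y : EuclideanSpace ℝ (Fin N) => y i)
          (EuclideanSpace.proj i : EuclideanSpace ℝ (Fin N) →L[ℝ] ℝ) x :=
        (EuclideanSpace.proj i : EuclideanSpace ℝ (Fin N) →L[ℝ] ℝ).hasFDerivAt
      rw [this.fderiv]; simp
    have hPi : Integrable P := hP.continuous.integrable_of_hasCompactSupport hc
    have := integral_mul_fderiv_eq_neg_fderiv_mul_of_integrable (μ := volume) (f := P)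
      (g := fun x : EuclideanSpace ℝ (Fin N) => x i) (v := EuclideanSpace.single i 1) (hint i)
      (by simpa [hd] using hPi)
      (Continuous.integrable_of_hasCompactSupport
        (hP.continuous.mul (by fun_prop)) hc.mul_right)
      (fun x _ => hP.differentiable one_ne_zero x)
      (fun x _ => (EuclideanSpace.proj i : EuclideanSpace ℝ (Fin N) →L[ℝ] ℝ).differentiableAt)
    simp only [hd, mul_one] at this
    linarith
  have hsum : ∀ x : EuclideanSpace ℝ (Fin N), fderiv ℝ P x x =
      ∑ i : Fin N, fderiv ℝ P x (EuclideanSpace.single i 1) * x i := by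
    intro x
    have h := congrArg (fderiv ℝ P x) ((EuclideanSpace.basisFun (Fin N) ℝ).sum_repr x)
    simp only [map_sum, map_smul, smul_eq_mul, EuclideanSpace.basisFun_repr,
      EuclideanSpace.basisFun_apply] at h
    rw [← h]
    exact Finset.sum_congr rfl fun i _ => mul_comm _ _
  simp_rw [hsum]
  rw [integral_finsetSum _ fun i _ => hint i]
  simp [key]

theorem inner_gradient (φ : EuclideanSpace ℝ (Fin N) → ℝ) (x v : EuclideanSpace ℝ (Fin N)) :
    inner ℝ (gradient φ x) v = fderiv ℝ φ x v := by
  simp [gradient]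

theorem norm_gradient (φ : EuclideanSpace ℝ (Fin N) → ℝ) (x : EuclideanSpace ℝ (Fin N)) :
    ‖gradient φ x‖ = ‖fderiv ℝ φ x‖ := by
  simp [gradient]

theorem hasFDerivAt_sq_add_rpow (ε : ℝ) (hε : 0 < ε) (s : ℝ) (x : EuclideanSpace ℝ (Fin N)) :
    fderiv ℝ (fun y : EuclideanSpace ℝ (Fin N) => (‖y‖ ^ 2 + ε) ^ s) x x =
      2 * s * ‖x‖ ^ 2 * (‖x‖ ^ 2 + ε) ^ (s - 1) := by
  have h1 : HasFDerivAt (fun y : EuclideanSpace ℝ (Fin N) => ‖y‖ ^ 2 + ε) (2 • innerSL ℝ x) x :=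
    (hasStrictFDerivAt_norm_sq x).hasFDerivAt.add_const ε
  have h2 := h1.rpow_const (p := s) (Or.inl (by positivity))
  rw [h2.fderiv]
  simp
  ring

/-- Apply the Euler identity to φ² (|x|² + ε)^(-a-1). Differentiating the weight costs at most
2(a+1) times this function, which leaves the factor c = N - 2a - 2 out of N. Young's inequality
absorbs the cross term 2φ x·∇φ at the price of half of c. The ε keeps the weight smooth at the
origin and is removed later by Fatou's lemma. -/
theorem lintegral_sq_mul_regularised_le {φ : EuclideanSpace ℝ (Fin N) → ℝ} {a c : ℝ}
    (hN : 2 < N) (ha : 0 < a)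
    (hc : c = N - 2 * a - 2) (hc0 : 0 < c) (hφ : ContDiff ℝ ∞ φ) (hs : HasCompactSupport φ)
    (hg : MemLp (gradient φ) 2 (wMeasure N a)) {ε : ℝ} (hε : 0 < ε) :
    ∫ x, φ x ^ 2 * (‖x‖ ^ 2 + ε) ^ (-a - 1) ≤
      (2 / c) ^ 2 * ∫ x, ‖x‖ ^ (-2 * a) * ‖gradient φ x‖ ^ 2 := by
  set A : EuclideanSpace ℝ (Fin N) → ℝ := fun x => (‖x‖ ^ 2 + ε) ^ (-a - 1) with hA
  have hA1 : ContDiff ℝ 1 A := by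
    refine ContDiff.rpow_const_of_ne ((contDiff_norm_sq ℝ).add contDiff_const) fun x => by positivity
  have hφ1 : ContDiff ℝ 1 φ := hφ.of_le (by norm_cast)
  set P : EuclideanSpace ℝ (Fin N) → ℝ := fun x => φ x ^ 2 * A x with hP
  have hP1 : ContDiff ℝ 1 P := (hφ1.pow 2).mul hA1
  have hPs : HasCompactSupport P := by
    refine HasCompactSupport.mul_right ?_
    exact hs.comp_left (g := fun t : ℝ => t ^ 2) (by simp)
  have hPi : Integrable P := hP1.continuous.integrable_of_hasCompactSupport hPs
  have hP' : Integrable fun x => fderiv ℝ P x x := by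
    refine Continuous.integrable_of_hasCompactSupport
      ((hP1.continuous_fderiv one_ne_zero).clm_apply continuous_id) ?_
    refine (hPs.fderiv ℝ).mono fun x hx => ?_
    simp only [Function.mem_support] at hx ⊢
    intro h0; apply hx; rw [h0]; simp
  have hgi := ((memLp_two_wMeasure hN a).1 hg).2
  have hE := integral_fderiv_self hP1 hPs
  have hpt : ∀ x, x ≠ 0 → c / 2 * P x - 2 / c * (‖x‖ ^ (-2 * a) * ‖gradient φ x‖ ^ 2) ≤
      N * P x + fderiv ℝ P x x := by
    intro x hx
    have hx0 : 0 < ‖x‖ := norm_pos_iff.2 hx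
    have hd : fderiv ℝ P x x = 2 * φ x * fderiv ℝ φ x x * A x +
        φ x ^ 2 * (2 * (-a - 1) * ‖x‖ ^ 2 * (‖x‖ ^ 2 + ε) ^ (-a - 1 - 1)) := by
      have h1 := (hφ1.differentiable one_ne_zero x).hasFDerivAt.pow 2
      have h2 := (hA1.differentiable one_ne_zero x).hasFDerivAt
      have h3 := (h1.mul h2).fderiv
      have h4 : fderiv ℝ P x = _ := h3
      rw [h4]
      have := hasFDerivAt_sq_add_rpow ε hε (-a - 1) x
      simp only [add_apply, smul_apply, smul_eq_mul]
      rw [this]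
      simp
      ring
    have hApos : 0 < A x := by simp only [hA]; positivity
    set T := ‖gradient φ x‖ with hT
    have hfd : |fderiv ℝ φ x x| ≤ T * ‖x‖ := by
      rw [hT, norm_gradient]; exact (fderiv ℝ φ x).le_opNorm x
    have hA2 : ‖x‖ ^ 2 * (‖x‖ ^ 2 + ε) ^ (-a - 1 - 1) ≤ A x := by
      have : A x = (‖x‖ ^ 2 + ε) * (‖x‖ ^ 2 + ε) ^ (-a - 1 - 1) := by
        simp only [hA]
        nth_rewrite 2 [← Real.rpow_one (‖x‖ ^ 2 + ε)]
        rw [← Real.rpow_add (by positivity)]; congr 1; ring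
      rw [this]
      gcongr
      linarith
    have hA3 : ‖x‖ ^ 2 * A x ≤ ‖x‖ ^ (-2 * a) := by
      have h1 : A x ≤ (‖x‖ ^ 2) ^ (-a - 1) :=
        Real.rpow_le_rpow_of_nonpos (by positivity) (by linarith) (by linarith)
      calc ‖x‖ ^ 2 * A x ≤ ‖x‖ ^ 2 * (‖x‖ ^ 2) ^ (-a - 1) := by gcongr
        _ = ‖x‖ ^ (-2 * a) := by
          rw [← Real.rpow_natCast, ← Real.rpow_mul hx0.le, ← Real.rpow_add hx0]
          congr 1; push_cast; ring
    have h5 : -(2 * |φ x| * (T * ‖x‖) * A x) ≤ 2 * φ x * fderiv ℝ φ x x * A x := by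
      have : |2 * φ x * fderiv ℝ φ x x * A x| ≤ 2 * |φ x| * (T * ‖x‖) * A x := by
        rw [abs_mul, abs_mul, abs_mul, abs_of_pos hApos, abs_two]
        gcongr
      linarith [neg_abs_le (2 * φ x * fderiv ℝ φ x x * A x)]
    have h6 : 2 * |φ x| * (T * ‖x‖) ≤ c / 2 * φ x ^ 2 + 2 / c * (T ^ 2 * ‖x‖ ^ 2) := by
      have : 0 ≤ c / 2 * (|φ x| - 2 / c * (T * ‖x‖)) ^ 2 := by positivity
      have e : c / 2 * (|φ x| - 2 / c * (T * ‖x‖)) ^ 2 =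
          c / 2 * |φ x| ^ 2 - 2 * |φ x| * (T * ‖x‖) + 2 / c * (T ^ 2 * ‖x‖ ^ 2) := by
        field_simp
        ring
      rw [e, sq_abs] at this
      linarith
    have h7 : 2 * |φ x| * (T * ‖x‖) * A x ≤
        c / 2 * P x + 2 / c * (‖x‖ ^ (-2 * a) * T ^ 2) := by
      calc 2 * |φ x| * (T * ‖x‖) * A x ≤ (c / 2 * φ x ^ 2 + 2 / c * (T ^ 2 * ‖x‖ ^ 2)) * A x := by
            gcongr
        _ = c / 2 * P x + 2 / c * (‖x‖ ^ 2 * A x * T ^ 2) := by simp only [hP]; ring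
        _ ≤ _ := by gcongr
    have h8 : φ x ^ 2 * (2 * (-a - 1) * ‖x‖ ^ 2 * (‖x‖ ^ 2 + ε) ^ (-a - 1 - 1)) ≥
        -(2 * (a + 1)) * P x := by
      have := mul_le_mul_of_nonneg_left hA2 (by positivity : 0 ≤ 2 * (a + 1) * φ x ^ 2)
      simp only [hP]
      nlinarith
    rw [hd]
    have : (N : ℝ) * P x = c * P x + 2 * (a + 1) * P x := by rw [hc]; ring
    linarith
  have hint := integral_mono_ae ((hPi.const_mul (c / 2)).sub (hgi.const_mul (2 / c)))
    ((hPi.const_mul (N : ℝ)).add hP') (by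
      filter_upwards [ae_ne_zero hN] with x hx
      exact hpt x hx)
  simp only [Pi.sub_apply, Pi.add_apply] at hint
  rw [integral_sub (hPi.const_mul _) (hgi.const_mul _), integral_add (hPi.const_mul _) hP', hE,
    integral_const_mul, integral_const_mul, integral_const_mul] at hint
  have h9 : c / 2 * ∫ x, P x ≤ 2 / c * ∫ x, ‖x‖ ^ (-2 * a) * ‖gradient φ x‖ ^ 2 := by linarith
  calc ∫ x, P x = 2 / c * (c / 2 * ∫ x, P x) := by field_simp
    _ ≤ 2 / c * (2 / c * ∫ x, ‖x‖ ^ (-2 * a) * ‖gradient φ x‖ ^ 2) := by gcongr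
    _ = _ := by ring

end IntegrationByParts

/-! ### The weighted Hardy inequality in the completion. -/

section Hardy

variable {N : ℕ}

theorem eLpNorm_two_eq_sqrt {α F : Type*} [MeasurableSpace α] {ν : Measure α}
    [NormedAddCommGroup F] {f : α → F} (hf : MemLp f 2 ν) :
    eLpNorm f 2 ν = ENNReal.ofReal (√(∫ x, ‖f x‖ ^ 2 ∂ν)) := by
  rw [hf.eLpNorm_eq_integral_rpow_norm (by norm_num) (by norm_num), Real.sqrt_eq_rpow]
  simp

theorem gradSq_eq_integral (a : ℝ) (g : EuclideanSpace ℝ (Fin N) → EuclideanSpace ℝ (Fin N)) :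
    gradSq a g = ∫ x, ‖g x‖ ^ 2 ∂(wMeasure N a) := by
  rw [integral_wMeasure]; rfl

theorem eLpNorm_regularised_le {φ : EuclideanSpace ℝ (Fin N) → ℝ} {a c : ℝ}
    (hN : 2 < N) (ha : 0 < a)
    (hc : c = N - 2 * a - 2) (hc0 : 0 < c) (hφ : ContDiff ℝ ∞ φ) (hs : HasCompactSupport φ)
    {ε : ℝ} (hε : 0 < ε) :
    eLpNorm (fun x => (‖x‖ ^ 2 + ε) ^ ((-a - 1) / 2) * φ x) 2 volume ≤
      ENNReal.ofReal (2 / c) * eLpNorm (gradient φ) 2 (wMeasure N a) := by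
  by_cases hg : MemLp (gradient φ) 2 (wMeasure N a)
  swap
  -- Integrability of the weight at the origin is not needed here: an infinite right-hand side makes
  -- the bound trivial.
  · have : eLpNorm (gradient φ) 2 (wMeasure N a) = ⊤ := by
      by_contra h
      exact hg ⟨aestronglyMeasurable_gradient hφ, lt_top_iff_ne_top.2 h⟩
    rw [this, ENNReal.mul_top (by simpa using by positivity)]
    exact le_top
  have hF : Continuous fun x : EuclideanSpace ℝ (Fin N) =>
      (‖x‖ ^ 2 + ε) ^ ((-a - 1) / 2) * φ x := by
    refine Continuous.mul ?_ hφ.continuous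
    exact Continuous.rpow_const (by fun_prop) fun x => Or.inl (by positivity)
  have hFL : MemLp (fun x : EuclideanSpace ℝ (Fin N) =>
      (‖x‖ ^ 2 + ε) ^ ((-a - 1) / 2) * φ x) 2 volume :=
    hF.memLp_of_hasCompactSupport hs.mul_left
  have h := lintegral_sq_mul_regularised_le hN ha hc hc0 hφ hs hg hε
  rw [eLpNorm_two_eq_sqrt hFL, eLpNorm_two_eq_sqrt hg, ← ENNReal.ofReal_mul (by positivity)]
  refine ENNReal.ofReal_le_ofReal ?_
  have e1 : ∀ x : EuclideanSpace ℝ (Fin N), ‖(‖x‖ ^ 2 + ε) ^ ((-a - 1) / 2) * φ x‖ ^ 2 =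
      φ x ^ 2 * (‖x‖ ^ 2 + ε) ^ (-a - 1) := by
    intro x
    rw [norm_mul, mul_pow, Real.norm_eq_abs, sq_abs, Real.norm_eq_abs, sq_abs,
      ← Real.rpow_natCast, ← Real.rpow_mul (by positivity)]
    rw [mul_comm]; congr 2; push_cast; ring
  rw [← gradSq_eq_integral]
  simp_rw [e1]
  calc √(∫ x, φ x ^ 2 * (‖x‖ ^ 2 + ε) ^ (-a - 1)) ≤ √((2 / c) ^ 2 * gradSq a (gradient φ)) :=
        Real.sqrt_le_sqrt h
    _ = _ := by rw [Real.sqrt_mul (by positivity), Real.sqrt_sq (by positivity)]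

theorem IsD.aestronglyMeasurable {a : ℝ} {u : EuclideanSpace ℝ (Fin N) → ℝ}
    {g : EuclideanSpace ℝ (Fin N) → EuclideanSpace ℝ (Fin N)} (hN : 2 < N) (H : IsD a u g) :
    AEStronglyMeasurable u volume := by
  obtain ⟨hg, φ, h1, h2, h3⟩ := H
  rw [ae_wMeasure hN] at h3
  exact aestronglyMeasurable_of_tendsto_ae atTop
    (fun n => (h1 n).1.continuous.aestronglyMeasurable) h3

/-- The weighted Hardy inequality. -/
theorem IsD.hardy {a c : ℝ} {u : EuclideanSpace ℝ (Fin N) → ℝ}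
    {g : EuclideanSpace ℝ (Fin N) → EuclideanSpace ℝ (Fin N)} (hN : 2 < N) (ha : 0 < a)
    (hc : c = N - 2 * a - 2) (hc0 : 0 < c) (H : IsD a u g) :
    eLpNorm u 2 (wMeasure N (a + 1)) ≤ ENNReal.ofReal (2 / c) * eLpNorm g 2 (wMeasure N a) := by
  have hu := H.aestronglyMeasurable hN
  obtain ⟨hg, φ, h1, h2, h3⟩ := H
  rw [ae_wMeasure hN] at h3
  rw [eLpNorm_two_wMeasure hN _ hu]
  set ε : ℕ → ℝ := fun n => 1 / ((n : ℝ) + 1) with hε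
  have hεp : ∀ n, 0 < ε n := fun n => by simp only [hε]; positivity
  have hε0 : Tendsto ε atTop (𝓝 0) := tendsto_one_div_add_atTop_nhds_zero_nat
  have hlim : ∀ᵐ x : EuclideanSpace ℝ (Fin N), Tendsto
      (fun n => (‖x‖ ^ 2 + ε n) ^ ((-a - 1) / 2) * φ n x) atTop
      (𝓝 (‖x‖ ^ (-(a + 1)) • u x)) := by
    filter_upwards [h3, ae_ne_zero hN] with x hx hx0
    have hx' : 0 < ‖x‖ := norm_pos_iff.2 hx0
    have h4 : Tendsto (fun n => ‖x‖ ^ 2 + ε n) atTop (𝓝 (‖x‖ ^ 2)) := by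
      simpa using hε0.const_add (‖x‖ ^ 2)
    have h5 := h4.rpow_const (p := (-a - 1) / 2) (Or.inl (by positivity))
    have e : (‖x‖ ^ 2) ^ ((-a - 1) / 2) = ‖x‖ ^ (-(a + 1)) := by
      rw [← Real.rpow_natCast, ← Real.rpow_mul hx'.le]; congr 1; push_cast; ring
    rw [e] at h5
    exact h5.mul hx
  have hm : ∀ n, AEStronglyMeasurable (fun x : EuclideanSpace ℝ (Fin N) =>
      (‖x‖ ^ 2 + ε n) ^ ((-a - 1) / 2) * φ n x) volume := fun n => by
    refine AEStronglyMeasurable.mul (Continuous.aestronglyMeasurable ?_)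
      (h1 n).1.continuous.aestronglyMeasurable
    exact Continuous.rpow_const (by fun_prop) fun x => Or.inl (by have := hεp n; positivity)
  -- Fatou's lemma, with ε_n → 0 and φ_n → u along the same index.
  refine (Lp.eLpNorm_lim_le_liminf_eLpNorm hm _ hlim).trans ?_
  have hb : ∀ n, eLpNorm (fun x => (‖x‖ ^ 2 + ε n) ^ ((-a - 1) / 2) * φ n x) 2 volume ≤
      ENNReal.ofReal (2 / c) * (eLpNorm (fun x => gradient (φ n) x - g x) 2 (wMeasure N a) +
        eLpNorm g 2 (wMeasure N a)) := by
    intro n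
    refine (eLpNorm_regularised_le hN ha hc hc0 (h1 n).1 (h1 n).2 (hεp n)).trans ?_
    gcongr
    have e : gradient (φ n) = (fun x => gradient (φ n) x - g x) + g := by funext x; simp
    conv_lhs => rw [e]
    exact eLpNorm_add_le ((aestronglyMeasurable_gradient (h1 n).1).sub hg.1) hg.1 (by norm_num)
  have ht : Tendsto (fun n => ENNReal.ofReal (2 / c) *
      (eLpNorm (fun x => gradient (φ n) x - g x) 2 (wMeasure N a) +
        eLpNorm g 2 (wMeasure N a))) atTop
      (𝓝 (ENNReal.ofReal (2 / c) * eLpNorm g 2 (wMeasure N a))) := by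
    refine ENNReal.Tendsto.const_mul ?_ (Or.inr (by simp))
    simpa using h2.add (tendsto_const_nhds (x := eLpNorm g 2 (wMeasure N a)))
  exact (liminf_le_liminf (Eventually.of_forall hb)).trans ht.liminf_eq.le

theorem IsD.memLp_hardy {a : ℝ} {u : EuclideanSpace ℝ (Fin N) → ℝ}
    {g : EuclideanSpace ℝ (Fin N) → EuclideanSpace ℝ (Fin N)} (hN : 2 < N) (ha : 0 < a)
    (ha' : a < ((N : ℝ) - 2) / 2) (H : IsD a u g) :
    MemLp u 2 (wMeasure N (a + 1)) := by
  refine ⟨(aestronglyMeasurable_wMeasure hN).2 (H.aestronglyMeasurable hN), ?_⟩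
  refine (H.hardy hN ha rfl (by linarith)).trans_lt ?_
  exact ENNReal.mul_lt_top (by simp) H.memLp_grad.2

theorem isD_of_smooth {a : ℝ} {φ : EuclideanSpace ℝ (Fin N) → ℝ} (hφ : ContDiff ℝ ∞ φ)
    (hs : HasCompactSupport φ) (hg : MemLp (gradient φ) 2 (wMeasure N a)) :
    IsD a φ (gradient φ) :=
  ⟨hg, fun _ => φ, fun _ => ⟨hφ, hs⟩, by simp, Eventually.of_forall fun _ => tendsto_const_nhds⟩

theorem IsD.sub {a : ℝ} {u v : EuclideanSpace ℝ (Fin N) → ℝ}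
    {g h : EuclideanSpace ℝ (Fin N) → EuclideanSpace ℝ (Fin N)} (H : IsD a u g)
    (K : IsD a v h) : IsD a (u - v) (g - h) := by
  have := H.add (K.smul (-1))
  simpa [sub_eq_add_neg] using this

/-- The approximating test functions can be taken with gradient in `L²`, and they then converge
in the Hardy norm as well. -/
theorem IsD.exists_approx {a : ℝ} {u : EuclideanSpace ℝ (Fin N) → ℝ}
    {g : EuclideanSpace ℝ (Fin N) → EuclideanSpace ℝ (Fin N)} (hN : 2 < N) (ha : 0 < a)
    (ha' : a < ((N : ℝ) - 2) / 2) (H : IsD a u g) :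
    ∃ φ : ℕ → EuclideanSpace ℝ (Fin N) → ℝ,
      (∀ n, ContDiff ℝ ∞ (φ n) ∧ HasCompactSupport (φ n)) ∧ (∀ n, IsD a (φ n) (gradient (φ n))) ∧
      Tendsto (fun n => eLpNorm (gradient (φ n) - g) 2 (wMeasure N a)) atTop (𝓝 0) ∧
      Tendsto (fun n => eLpNorm (φ n - u) 2 (wMeasure N (a + 1))) atTop (𝓝 0) := by
  have H' := H
  obtain ⟨hg, φ, h1, h2, h3⟩ := H
  -- Only gradients at finite distance from g are known to lie in L², so the sequence is shifted
  -- past the point where this distance stays below 1.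
  obtain ⟨n₀, hn₀⟩ := (h2.eventually_lt_const (zero_lt_one)).exists_forall_of_atTop
  have hD : ∀ n, IsD a (φ (n + n₀)) (gradient (φ (n + n₀))) := fun n => by
    refine isD_of_smooth (h1 _).1 (h1 _).2 ?_
    have : MemLp (fun x => gradient (φ (n + n₀)) x - g x) 2 (wMeasure N a) :=
      ⟨(aestronglyMeasurable_gradient (h1 _).1).sub hg.1,
        (hn₀ _ (by omega)).trans ENNReal.one_lt_top⟩
    have := this.add hg
    refine this.ae_eq (Eventually.of_forall fun x => ?_)
    simp
  have h2' : Tendsto (fun n => eLpNorm (gradient (φ (n + n₀)) - g) 2 (wMeasure N a)) atTop (𝓝 0) :=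
    (tendsto_add_atTop_iff_nat n₀).2 h2
  refine ⟨fun n => φ (n + n₀), fun n => h1 _, hD, h2', ?_⟩
  have h4 := ENNReal.Tendsto.const_mul (a := ENNReal.ofReal (2 / (N - 2 * a - 2))) h2'
    (Or.inr (by simp))
  rw [mul_zero] at h4
  exact tendsto_of_tendsto_of_tendsto_of_le_of_le tendsto_const_nhds h4 (fun _ => bot_le)
    fun n => ((hD n).sub H').hardy hN ha rfl (by linarith)

end Hardy

/-! ### Distributional gradients and their uniqueness. -/

section WeakGradient

variable {N : ℕ}

/-- The factor |x|^(2α) cancels the density. Unweighted pairings thereby become inner products of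
weighted L² spaces, continuous under the convergences at hand: gradients with α = a, functions with
α = a + 1. -/
theorem integral_mul_eq_wMeasure (hN : 2 < N) (α : ℝ) (f h : EuclideanSpace ℝ (Fin N) → ℝ) :
    ∫ x, f x * h x = ∫ x, inner ℝ (f x) (‖x‖ ^ (2 * α) * h x) ∂(wMeasure N α) := by
  rw [integral_wMeasure]
  refine integral_congr_ae ?_
  filter_upwards [ae_ne_zero hN] with x hx
  have hx' : 0 < ‖x‖ := norm_pos_iff.2 hx
  have : ‖x‖ ^ (-2 * α) * ‖x‖ ^ (2 * α) = 1 := by rw [← Real.rpow_add hx']; simp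
  simp only [RCLike.inner_apply, conj_trivial, smul_eq_mul]
  linear_combination -(f x * h x) * this

theorem integral_inner_eq_wMeasure (hN : 2 < N) (α : ℝ)
    (f h : EuclideanSpace ℝ (Fin N) → EuclideanSpace ℝ (Fin N)) :
    ∫ x, inner ℝ (f x) (h x) = ∫ x, inner ℝ (f x) (‖x‖ ^ (2 * α) • h x) ∂(wMeasure N α) := by
  rw [integral_wMeasure]
  refine integral_congr_ae ?_
  filter_upwards [ae_ne_zero hN] with x hx
  have hx' : 0 < ‖x‖ := norm_pos_iff.2 hx
  have : ‖x‖ ^ (-2 * α) * ‖x‖ ^ (2 * α) = 1 := by rw [← Real.rpow_add hx']; simp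
  simp only [inner_smul_right, smul_eq_mul]
  rw [← mul_assoc, this, one_mul]

/-- An identity `∫ ∇φ · V = ∫ φ k` valid for test functions extends to `D_a^{1,2}`. -/
theorem IsD.integral_eq_of_smooth {a : ℝ} {u : EuclideanSpace ℝ (Fin N) → ℝ}
    {g : EuclideanSpace ℝ (Fin N) → EuclideanSpace ℝ (Fin N)} (hN : 2 < N) (ha : 0 < a)
    (ha' : a < ((N : ℝ) - 2) / 2) (H : IsD a u g)
    {V : EuclideanSpace ℝ (Fin N) → EuclideanSpace ℝ (Fin N)} {k : EuclideanSpace ℝ (Fin N) → ℝ}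
    (hV : MemLp (fun x => ‖x‖ ^ (2 * a) • V x) 2 (wMeasure N a))
    (hk : MemLp (fun x => ‖x‖ ^ (2 * (a + 1)) * k x) 2 (wMeasure N (a + 1)))
    (h : ∀ φ : EuclideanSpace ℝ (Fin N) → ℝ, ContDiff ℝ ∞ φ → HasCompactSupport φ →
      ∫ x, fderiv ℝ φ x (V x) = ∫ x, φ x * k x) :
    ∫ x, inner ℝ (g x) (V x) = ∫ x, u x * k x := by
  obtain ⟨φ, h1, h2, h3, h4⟩ := H.exists_approx hN ha ha'
  have l1 := tendsto_integral_inner (fun n => (h2 n).memLp_grad) H.memLp_grad hV h3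
  have l2 := tendsto_integral_inner (fun n => (h2 n).memLp_hardy hN ha ha')
    (H.memLp_hardy hN ha ha') hk h4
  rw [← integral_inner_eq_wMeasure hN] at l1
  rw [← integral_mul_eq_wMeasure hN] at l2
  refine tendsto_nhds_unique (l1.congr fun n => ?_) l2
  rw [← integral_inner_eq_wMeasure hN, ← integral_mul_eq_wMeasure hN,
    ← h (φ n) (h1 n).1 (h1 n).2]
  simp only [inner_gradient]

/-- The gradient of `u` is its distributional gradient away from the origin. -/
theorem IsD.weak_gradient {a : ℝ} {u : EuclideanSpace ℝ (Fin N) → ℝ}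
    {g : EuclideanSpace ℝ (Fin N) → EuclideanSpace ℝ (Fin N)} (hN : 2 < N) (ha : 0 < a)
    (ha' : a < ((N : ℝ) - 2) / 2) (H : IsD a u g) {η : EuclideanSpace ℝ (Fin N) → ℝ}
    (hη : ContDiff ℝ 1 η) (hs : HasCompactSupport η)
    (h0 : (0 : EuclideanSpace ℝ (Fin N)) ∉ tsupport η) (v : EuclideanSpace ℝ (Fin N)) :
    ∫ x, inner ℝ (g x) (η x • v) = ∫ x, u x * -(fderiv ℝ η x v) := by
  have hd : Continuous fun x => fderiv ℝ η x v :=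
    (hη.continuous_fderiv one_ne_zero).clm_apply continuous_const
  have hsub : tsupport (fun x => fderiv ℝ η x v) ⊆ tsupport η := by
    refine (closure_mono fun x hx => ?_).trans (tsupport_fderiv_subset ℝ (f := η))
    simp only [Function.mem_support] at hx ⊢
    intro h; apply hx; rw [h]; simp
  have hds : HasCompactSupport fun x => fderiv ℝ η x v := hs.of_isClosed_subset
    (isClosed_tsupport _) hsub
  refine H.integral_eq_of_smooth hN ha ha' ?_ ?_ fun φ hφ hφs => ?_
  · have h1 : MemLp (fun x => ‖x‖ ^ (2 * a) * η x) 2 (wMeasure N a) :=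
      memLp_two_wMeasure_of_compact hN a (continuous_mul_norm_rpow hη.continuous h0 _)
        (fun h => h0 (tsupport_mul_subset_right h)) hs.mul_left
    have h2 := (ContinuousLinearMap.toSpanSingleton ℝ v).comp_memLp' h1
    refine h2.ae_eq (Eventually.of_forall fun x => ?_)
    simp [ContinuousLinearMap.toSpanSingleton_apply, smul_smul]
  · have h1 : MemLp (fun x => ‖x‖ ^ (2 * (a + 1)) * fderiv ℝ η x v) 2 (wMeasure N (a + 1)) :=
      memLp_two_wMeasure_of_compact hN _ (continuous_mul_norm_rpow hd (fun h => h0 (hsub h)) _)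
        (fun h => h0 (hsub (tsupport_mul_subset_right h))) hds.mul_left
    refine h1.neg.ae_eq (Eventually.of_forall fun x => ?_)
    simp
  · have hφ' : Continuous fun x => fderiv ℝ φ x v :=
      (hφ.continuous_fderiv (by simp)).clm_apply continuous_const
    have := integral_mul_fderiv_eq_neg_fderiv_mul_of_integrable (μ := volume) (f := φ) (g := η)
      (v := v)
      ((hφ'.mul hη.continuous).integrable_of_hasCompactSupport hs.mul_left)
      ((hφ.continuous.mul hd).integrable_of_hasCompactSupport hφs.mul_right)
      ((hφ.continuous.mul hη.continuous).integrable_of_hasCompactSupport hs.mul_left)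
      (fun x _ => hφ.differentiable (by simp) x) (fun x _ => hη.differentiable one_ne_zero x)
    simp only [map_smul, smul_eq_mul, mul_neg, integral_neg, this, neg_neg]
    exact integral_congr_ae (Eventually.of_forall fun x => mul_comm _ _)

/-- By AM–GM, |f| ≤ |x|^(2a) + |x|^(-2a) |f|², and off the origin both terms are integrable on K. -/
theorem integrableOn_of_memLp {a : ℝ} (hN : 2 < N) {f : EuclideanSpace ℝ (Fin N) → ℝ}
    (hf : MemLp f 2 (wMeasure N a)) {K : Set (EuclideanSpace ℝ (Fin N))} (hK : IsCompact K)
    (h0 : (0 : EuclideanSpace ℝ (Fin N)) ∉ K) : IntegrableOn f K := by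
  obtain ⟨hm, hi⟩ := (memLp_two_wMeasure hN a).1 hf
  have hcont : ContinuousOn (fun x : EuclideanSpace ℝ (Fin N) => ‖x‖ ^ (2 * a)) K := by
    intro x hx
    exact (continuous_norm.continuousAt.rpow_const
      (Or.inl (norm_ne_zero_iff.2 fun h => h0 (h ▸ hx)))).continuousWithinAt
  have h1 : IntegrableOn (fun x : EuclideanSpace ℝ (Fin N) => ‖x‖ ^ (2 * a)) K :=
    hcont.integrableOn_compact hK
  refine Integrable.mono' (h1.add hi.integrableOn) hm.restrict ?_
  have : ∀ᵐ x ∂(volume.restrict K), x ∈ K := ae_restrict_mem hK.measurableSet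
  filter_upwards [this] with x hx
  have hx' : 0 < ‖x‖ := norm_pos_iff.2 fun h => h0 (h ▸ hx)
  simp only [Pi.add_apply]
  have e : ‖x‖ ^ (2 * a) * ‖x‖ ^ (-2 * a) = 1 := by rw [← Real.rpow_add hx']; simp
  have p1 : 0 < ‖x‖ ^ (2 * a) := by positivity
  have p2 : 0 < ‖x‖ ^ (-2 * a) := by positivity
  set s := ‖x‖ ^ (2 * a)
  set t := ‖x‖ ^ (-2 * a)
  have : 0 ≤ t * (‖f x‖ - s) ^ 2 := by positivity
  have e2 : t * (‖f x‖ - s) ^ 2 = t * ‖f x‖ ^ 2 - 2 * ‖f x‖ * (s * t) + s * (s * t) := by ring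
  rw [e2, e] at this
  nlinarith [norm_nonneg (f x)]

/-- By `IsD.weak_gradient` with u = 0, each component of g annihilates the test functions supported
off the origin, so the fundamental lemma applies on the punctured space. This is what makes the
gradient of an element of the completion well defined. -/
theorem IsD.grad_eq_zero {a : ℝ}
    {g : EuclideanSpace ℝ (Fin N) → EuclideanSpace ℝ (Fin N)} (hN : 2 < N) (ha : 0 < a)
    (ha' : a < ((N : ℝ) - 2) / 2) (H : IsD a 0 g) : g =ᵐ[volume] 0 := by
  have key : ∀ i : Fin N, ∀ᵐ x : EuclideanSpace ℝ (Fin N), g x i = 0 := by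
    intro i
    have hm : MemLp (fun x => g x i) 2 (wMeasure N a) :=
      (EuclideanSpace.proj i : EuclideanSpace ℝ (Fin N) →L[ℝ] ℝ).comp_memLp' H.memLp_grad
    have hopen : IsOpen ({0}ᶜ : Set (EuclideanSpace ℝ (Fin N))) := isOpen_compl_singleton
    have := hopen.ae_eq_zero_of_integral_contDiff_smul_eq_zero (μ := volume)
      (f := fun x => g x i) ?_ ?_
    · filter_upwards [this, ae_ne_zero hN] with x hx hx0
      exact hx hx0
    · refine (locallyIntegrableOn_iff hopen.isLocallyClosed).2 fun K hK hKc => ?_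
      exact integrableOn_of_memLp hN hm hKc fun h => hK h rfl
    · intro η hη hηs hη0
      have := H.weak_gradient hN ha ha' (hη.of_le (by norm_cast)) hηs (fun h => hη0 h rfl)
        (EuclideanSpace.single i 1)
      simp only [Pi.zero_apply, zero_mul, integral_zero, inner_smul_right,
        EuclideanSpace.inner_single_right] at this
      simpa using this
  have : ∀ᵐ x : EuclideanSpace ℝ (Fin N), ∀ i, g x i = 0 := ae_all_iff.2 key
  filter_upwards [this] with x hx
  ext i
  simp [hx i]

theorem IsD.grad_unique {a : ℝ} {u v : EuclideanSpace ℝ (Fin N) → ℝ}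
    {g h : EuclideanSpace ℝ (Fin N) → EuclideanSpace ℝ (Fin N)} (hN : 2 < N) (ha : 0 < a)
    (ha' : a < ((N : ℝ) - 2) / 2) (H : IsD a u g) (K : IsD a v h) (huv : u =ᵐ[volume] v) :
    g =ᵐ[volume] h := by
  have h1 : IsD a 0 (g - h) := by
    refine (H.sub K).congr ?_ (ae_eq_refl _)
    rw [EventuallyEq, ae_wMeasure hN]
    filter_upwards [huv] with x hx
    simp [hx]
  filter_upwards [h1.grad_eq_zero hN ha ha'] with x hx
  simpa [sub_eq_zero] using hx

/-- Integration by parts against the vector field `H(x) x`. -/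
theorem IsD.integral_inner_self {a : ℝ} {u : EuclideanSpace ℝ (Fin N) → ℝ}
    {g : EuclideanSpace ℝ (Fin N) → EuclideanSpace ℝ (Fin N)} (hN : 2 < N) (ha : 0 < a)
    (ha' : a < ((N : ℝ) - 2) / 2) (K : IsD a u g) {H : EuclideanSpace ℝ (Fin N) → ℝ}
    (hH : ContDiff ℝ 1 H)
    (hV : MemLp (fun x => ‖x‖ ^ (2 * a) • H x • x) 2 (wMeasure N a))
    (hk : MemLp (fun x => ‖x‖ ^ (2 * (a + 1)) * -(N * H x + fderiv ℝ H x x)) 2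
      (wMeasure N (a + 1))) :
    ∫ x, inner ℝ (g x) (H x • x) = ∫ x, u x * -(N * H x + fderiv ℝ H x x) := by
  refine K.integral_eq_of_smooth hN ha ha' hV hk fun φ hφ hs => ?_
  have hφ1 : ContDiff ℝ 1 φ := hφ.of_le (by norm_cast)
  have hP : ContDiff ℝ 1 (fun x => φ x * H x) := hφ1.mul hH
  have h1 := integral_fderiv_self hP hs.mul_right
  have hd : ∀ x, fderiv ℝ (fun x => φ x * H x) x x = φ x * fderiv ℝ H x x + fderiv ℝ φ x (H x • x) := by
    intro x
    have h2 := ((hφ1.differentiable one_ne_zero x).hasFDerivAt.mul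
      (hH.differentiable one_ne_zero x).hasFDerivAt).fderiv
    have h3 : fderiv ℝ (fun x => φ x * H x) x = _ := h2
    rw [h3]; simp
  have i1 : Integrable fun x => φ x * fderiv ℝ H x x :=
    (hφ.continuous.mul ((hH.continuous_fderiv one_ne_zero).clm_apply
      continuous_id)).integrable_of_hasCompactSupport hs.mul_right
  have i2 : Integrable fun x => fderiv ℝ φ x (H x • x) := by
    refine Continuous.integrable_of_hasCompactSupport
      ((hφ1.continuous_fderiv one_ne_zero).clm_apply (hH.continuous.smul continuous_id)) ?_
    refine (hs.fderiv ℝ).mono fun x hx => ?_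
    simp only [Function.mem_support] at hx ⊢
    intro h0; apply hx; rw [h0]; simp
  have i3 : Integrable fun x => φ x * H x :=
    (hP.continuous).integrable_of_hasCompactSupport hs.mul_right
  simp_rw [hd] at h1
  rw [integral_add i1 i2] at h1
  have e : ∀ x, φ x * -(N * H x + fderiv ℝ H x x) =
      -(N * (φ x * H x)) - φ x * fderiv ℝ H x x := fun x => by ring
  simp_rw [e]
  have i4 : Integrable fun x => -((N : ℝ) * (φ x * H x)) := (i3.const_mul _).neg
  rw [integral_sub i4 i1, integral_neg, integral_const_mul]
  linarith

end WeakGradient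

/-! ### Polar coordinates and radial primitives. -/

section Radial

variable {N : ℕ}

/-- The surface measure of the unit sphere of `ℝ^N`. -/
noncomputable def sphereConst (N : ℕ) : ℝ :=
  N * volume.real (Metric.ball (0 : EuclideanSpace ℝ (Fin N)) 1)

/-- The primitive of `κ` vanishing at infinity. -/
noncomputable def tailInt (κ : ℝ → ℝ) (r : ℝ) : ℝ := -∫ s in Set.Ioi r, κ s

/-- The radial vector field `κ(|x|) x / |x|`. -/
noncomputable def radField (κ : ℝ → ℝ) (x : EuclideanSpace ℝ (Fin N)) :
    EuclideanSpace ℝ (Fin N) := κ ‖x‖ • (‖x‖⁻¹ • x)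

/-- The image of `|x|^{-2a} dx` under `x ↦ |x|`. -/
noncomputable def radMeasure (N : ℕ) (a : ℝ) : Measure ℝ := (wMeasure N a).map norm

theorem sphereConst_pos (hN : 2 < N) : 0 < sphereConst N := by
  have := nontrivial_euclidean hN
  have h1 : 0 < volume.real (Metric.ball (0 : EuclideanSpace ℝ (Fin N)) 1) := by
    refine ENNReal.toReal_pos (Metric.measure_ball_pos _ _ one_pos).ne' measure_ball_lt_top.ne
  have h2 : (0 : ℝ) < N := by exact_mod_cast (by omega : 0 < N)
  exact mul_pos h2 h1

theorem integral_radial (hN : 2 < N) (f : ℝ → ℝ) :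
    ∫ x : EuclideanSpace ℝ (Fin N), f ‖x‖ =
      sphereConst N * ∫ r in Set.Ioi (0 : ℝ), r ^ ((N : ℝ) - 1) * f r := by
  have := nontrivial_euclidean hN
  rw [integral_fun_norm_addHaar volume f, finrank_euclideanSpace, Fintype.card_fin, sphereConst,
    nsmul_eq_mul, smul_eq_mul, mul_assoc]
  congr 2
  refine setIntegral_congr_fun measurableSet_Ioi fun r hr => ?_
  simp only [smul_eq_mul]
  rw [← Real.rpow_natCast, Nat.cast_sub (by omega)]; simp

theorem integrable_radial (hN : 2 < N) (f : ℝ → ℝ) :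
    Integrable (fun x : EuclideanSpace ℝ (Fin N) => f ‖x‖) ↔
      IntegrableOn (fun r : ℝ => r ^ ((N : ℝ) - 1) * f r) (Set.Ioi 0) := by
  have := nontrivial_euclidean hN
  rw [integrable_fun_norm_addHaar volume (f := f), finrank_euclideanSpace, Fintype.card_fin]
  refine integrableOn_congr_fun (fun r hr => ?_) measurableSet_Ioi
  simp only [smul_eq_mul]
  rw [← Real.rpow_natCast, Nat.cast_sub (by omega)]; simp

theorem integral_radial_wMeasure (hN : 2 < N) (a : ℝ) (f : ℝ → ℝ) :
    ∫ x, f ‖x‖ ∂(wMeasure N a) =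
      sphereConst N * ∫ r in Set.Ioi (0 : ℝ), r ^ ((N : ℝ) - 1 - 2 * a) * f r := by
  rw [integral_wMeasure]
  have := integral_radial hN (fun r => r ^ (-2 * a) * f r)
  simp only [smul_eq_mul]
  rw [this]
  congr 1
  refine setIntegral_congr_fun measurableSet_Ioi fun r (hr : 0 < r) => ?_
  rw [← mul_assoc, ← Real.rpow_add hr]; congr 2; ring

theorem integrable_radial_wMeasure (hN : 2 < N) (a : ℝ) (f : ℝ → ℝ) :
    Integrable (fun x => f ‖x‖) (wMeasure N a) ↔
      IntegrableOn (fun r : ℝ => r ^ ((N : ℝ) - 1 - 2 * a) * f r) (Set.Ioi 0) := by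
  rw [integrable_wMeasure]
  have := integrable_radial hN (fun r => r ^ (-2 * a) * f r)
  simp only [smul_eq_mul]
  rw [this]
  refine integrableOn_congr_fun (fun r (hr : 0 < r) => ?_) measurableSet_Ioi
  rw [← mul_assoc, ← Real.rpow_add hr]; congr 2; ring

/-- Polar coordinates for the 0–1 function marking where p fails: its integral vanishes on one side
exactly when it does on the other. Measurability of p is not required, since integrability transfers
in both directions. -/
theorem ae_norm_iff (hN : 2 < N) {p : ℝ → Prop} :
    (∀ᵐ x : EuclideanSpace ℝ (Fin N), p ‖x‖) ↔ ∀ᵐ r ∂(volume.restrict (Set.Ioi (0 : ℝ))), p r := by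
  classical
  set f : ℝ → ℝ := fun r => if p r then 0 else 1 with hf
  have hf0 : ∀ r, f r = 0 ↔ p r := fun r => by simp [hf]
  have hfp : ∀ r, 0 ≤ f r := fun r => by simp only [hf]; split_ifs <;> norm_num
  have hgp : 0 ≤ᵐ[volume.restrict (Set.Ioi (0 : ℝ))] fun r : ℝ => r ^ ((N : ℝ) - 1) * f r := by
    filter_upwards [ae_restrict_mem measurableSet_Ioi] with r (hr : 0 < r)
    exact mul_nonneg (by positivity) (hfp r)
  constructor
  · intro h
    have h1 : (fun x : EuclideanSpace ℝ (Fin N) => f ‖x‖) =ᵐ[volume] 0 := by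
      filter_upwards [h] with x hx
      exact (hf0 _).2 hx
    have h2 : Integrable fun x : EuclideanSpace ℝ (Fin N) => f ‖x‖ :=
      (integrable_zero _ _ _).congr h1.symm
    have h3 := integral_radial hN f
    rw [integral_congr_ae h1] at h3
    have h4 : ∫ r in Set.Ioi (0 : ℝ), r ^ ((N : ℝ) - 1) * f r = 0 := by
      have := sphereConst_pos hN
      simpa [this.ne'] using h3.symm
    have h5 := (integral_eq_zero_iff_of_nonneg_ae hgp ((integrable_radial hN f).1 h2)).1 h4
    filter_upwards [h5, ae_restrict_mem measurableSet_Ioi] with r hr (hr0 : 0 < r)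
    simp only [Pi.zero_apply, mul_eq_zero] at hr
    rcases hr with hr | hr
    · exact absurd hr (by positivity)
    · exact (hf0 r).1 hr
  · intro h
    have h1 : (fun r : ℝ => r ^ ((N : ℝ) - 1) * f r) =ᵐ[volume.restrict (Set.Ioi (0 : ℝ))] 0 := by
      filter_upwards [h] with r hr
      simp [(hf0 r).2 hr]
    have h2 : Integrable fun x : EuclideanSpace ℝ (Fin N) => f ‖x‖ :=
      (integrable_radial hN f).2 ((integrable_zero _ _ _).congr h1.symm)
    have h3 := integral_radial hN f
    rw [integral_congr_ae h1] at h3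
    simp only [Pi.zero_apply, integral_zero, mul_zero] at h3
    have h5 := (integral_eq_zero_iff_of_nonneg (fun x => hfp _) h2).1 h3
    filter_upwards [h5] with x hx
    exact (hf0 _).1 hx

theorem ae_radMeasure (hN : 2 < N) (a : ℝ) :
    ae (radMeasure N a) = ae (volume.restrict (Set.Ioi (0 : ℝ))) := by
  ext s
  change (∀ᵐ r ∂(radMeasure N a), r ∈ s) ↔ ∀ᵐ r ∂(volume.restrict (Set.Ioi (0 : ℝ))), r ∈ s
  constructor
  · intro h
    rw [← ae_norm_iff hN, ← ae_wMeasure hN a]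
    exact ae_of_ae_map measurable_norm.aemeasurable h
  · intro h
    -- A set with null preimage is known to be null for the image measure only if it is measurable,
    -- hence the measurable superset of the exceptional set.
    obtain ⟨t, hst, mt, ht⟩ := exists_measurable_superset_of_null (ae_iff.1 h)
    have h1 : ∀ᵐ r ∂(volume.restrict (Set.Ioi (0 : ℝ))), r ∈ tᶜ := by
      rw [ae_iff]; simpa using ht
    rw [← ae_norm_iff hN, ← ae_wMeasure hN a] at h1
    have h2 : ∀ᵐ r ∂(radMeasure N a), r ∈ tᶜ :=
      (ae_map_iff measurable_norm.aemeasurable mt.compl).2 h1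
    filter_upwards [h2] with r hr
    by_contra h0
    exact hr (hst h0)

theorem measurePreserving_norm (N : ℕ) (a : ℝ) :
    MeasurePreserving (norm : EuclideanSpace ℝ (Fin N) → ℝ) (wMeasure N a) (radMeasure N a) :=
  ⟨measurable_norm, rfl⟩

theorem memLp_radMeasure (hN : 2 < N) {a : ℝ} {κ : ℝ → ℝ} (hκ : MemLp κ 2 (radMeasure N a)) :
    AEStronglyMeasurable κ (volume.restrict (Set.Ioi 0)) ∧
      IntegrableOn (fun r : ℝ => r ^ ((N : ℝ) - 1 - 2 * a) * κ r ^ 2) (Set.Ioi 0) := by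
  constructor
  · obtain ⟨g, hg, h⟩ := hκ.1
    exact ⟨g, hg, by rwa [EventuallyEq, ae_radMeasure hN] at h⟩
  · have h := hκ.comp_measurePreserving (measurePreserving_norm N a)
    have h1 := (memLp_two_iff_integrable_sq h.1).1 h
    exact (integrable_radial_wMeasure hN a fun r => κ r ^ 2).1 h1

theorem memLp_radMeasure_iff (hN : 2 < N) {a : ℝ} {κ : ℝ → ℝ} :
    MemLp κ 2 (radMeasure N a) ↔ AEStronglyMeasurable κ (volume.restrict (Set.Ioi 0)) ∧
      IntegrableOn (fun r : ℝ => r ^ ((N : ℝ) - 1 - 2 * a) * κ r ^ 2) (Set.Ioi 0) := by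
  refine ⟨memLp_radMeasure hN, fun ⟨h1, h2⟩ => ?_⟩
  have hm : AEStronglyMeasurable κ (radMeasure N a) := by
    obtain ⟨g, hg, h⟩ := h1
    exact ⟨g, hg, by rwa [EventuallyEq, ae_radMeasure hN]⟩
  have h3 := (integrable_radial_wMeasure hN a fun r => κ r ^ 2).2 h2
  rw [memLp_two_iff_integrable_sq hm]
  refine (measurePreserving_norm N a).integrable_comp (hm.pow 2) |>.1 h3

theorem norm_radField_le (κ : ℝ → ℝ) (x : EuclideanSpace ℝ (Fin N)) :
    ‖radField κ x‖ ≤ |κ ‖x‖| := by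
  rw [radField, norm_smul, Real.norm_eq_abs]
  by_cases hx : x = 0
  · subst hx; simp
  · rw [norm_smul, norm_inv, norm_norm, inv_mul_cancel₀ (norm_ne_zero_iff.2 hx), mul_one]

theorem norm_radField (κ : ℝ → ℝ) {x : EuclideanSpace ℝ (Fin N)} (hx : x ≠ 0) :
    ‖radField κ x‖ = |κ ‖x‖| := by
  rw [radField, norm_smul, Real.norm_eq_abs, norm_smul, norm_inv, norm_norm,
    inv_mul_cancel₀ (norm_ne_zero_iff.2 hx), mul_one]

theorem memLp_radField {a : ℝ} {κ : ℝ → ℝ} (hκ : MemLp κ 2 (radMeasure N a)) :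
    MemLp (radField κ) 2 (wMeasure N a) := by
  have h := hκ.comp_measurePreserving (measurePreserving_norm N a)
  refine MemLp.of_le h (h.1.smul ?_) (Eventually.of_forall fun x => norm_radField_le κ x)
  exact (measurable_norm.inv.smul measurable_id).aestronglyMeasurable

theorem inner_radField_self (κ : ℝ → ℝ) {x : EuclideanSpace ℝ (Fin N)} :
    inner ℝ (radField κ x) x = κ ‖x‖ * ‖x‖ := by
  by_cases hx : x = 0
  · subst hx; simp [radField]
  · rw [radField, real_inner_smul_left, real_inner_smul_left, real_inner_self_eq_norm_sq]
    have := norm_ne_zero_iff.2 hx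
    field_simp

theorem tailInt_eq {κ : ℝ → ℝ} {r s : ℝ} (h : IntegrableOn κ (Set.Ioi r))
    (h' : IntegrableOn κ (Set.Ioi s)) : tailInt κ s = tailInt κ r + ∫ t in r..s, κ t := by
  rw [tailInt, tailInt, ← intervalIntegral.integral_Ioi_sub_Ioi' h h']; ring

theorem hasDerivAt_tailInt {κ : ℝ → ℝ} (hc : ContinuousOn κ (Set.Ioi 0))
    (hi : ∀ r, 0 < r → IntegrableOn κ (Set.Ioi r)) {r : ℝ} (hr : 0 < r) :
    HasDerivAt (tailInt κ) (κ r) r := by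
  have hr2 : 0 < r / 2 := by positivity
  have h1 : HasDerivAt (fun s => tailInt κ (r / 2) + ∫ t in (r / 2)..s, κ t) (κ r) r := by
    refine HasDerivAt.const_add _ ?_
    refine intervalIntegral.integral_hasDerivAt_right ?_ ?_ (hc.continuousAt (Ioi_mem_nhds hr))
    · rw [intervalIntegrable_iff_integrableOn_Ioc_of_le (by linarith)]
      exact (hi _ hr2).mono_set fun x hx => hx.1
    · exact hc.stronglyMeasurableAtFilter isOpen_Ioi r hr
  refine h1.congr_of_eventuallyEq ?_
  filter_upwards [Ioi_mem_nhds hr] with s hs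
  exact tailInt_eq (hi _ hr2) (hi _ hs)

theorem contDiff_tailInt {χ : ℝ → ℝ} (hχ : ContDiff ℝ ∞ χ) (hs : HasCompactSupport χ) :
    ContDiff ℝ ∞ (tailInt χ) ∧ ∀ r, HasDerivAt (tailInt χ) (χ r) r := by
  have hi : Integrable χ := hχ.continuous.integrable_of_hasCompactSupport hs
  have hd : ∀ r, HasDerivAt (tailInt χ) (χ r) r := fun r => by
    have h1 : HasDerivAt (fun s => tailInt χ 0 + ∫ t in (0 : ℝ)..s, χ t) (χ r) r :=
      (intervalIntegral.integral_hasDerivAt_right (hi.intervalIntegrable)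
        (hχ.continuous.stronglyMeasurableAtFilter _ _) hχ.continuous.continuousAt).const_add _
    refine h1.congr_of_eventuallyEq (Eventually.of_forall fun s => ?_)
    exact tailInt_eq hi.integrableOn hi.integrableOn
  refine ⟨contDiff_infty_iff_deriv.2 ⟨fun r => (hd r).differentiableAt, ?_⟩, hd⟩
  have : deriv (tailInt χ) = χ := funext fun r => (hd r).deriv
  rwa [this]

theorem hasFDerivAt_norm {x : EuclideanSpace ℝ (Fin N)} (hx : x ≠ 0) :
    HasFDerivAt (fun y : EuclideanSpace ℝ (Fin N) => ‖y‖) (‖x‖⁻¹ • innerSL ℝ x) x := by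
  have h1 := ((hasStrictFDerivAt_norm_sq x).hasFDerivAt).sqrt (by simpa using hx)
  have e : (fun y : EuclideanSpace ℝ (Fin N) => √(‖y‖ ^ 2)) = fun y => ‖y‖ := by
    funext y; rw [Real.sqrt_sq (norm_nonneg _)]
  rw [e, Real.sqrt_sq (norm_nonneg _)] at h1
  refine h1.congr_fderiv ?_
  ext v
  simp
  field_simp

/-- If `χ` is a test function on `(0, ∞)`, then `x ↦ -∫_{|x|}^∞ χ` is a test function whose
gradient is `χ(|x|) x / |x|`. -/
theorem smooth_radial_profile {χ : ℝ → ℝ} (hχ : ContDiff ℝ ∞ χ) (hs : HasCompactSupport χ)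
    (h0 : tsupport χ ⊆ Set.Ioi 0) :
    ContDiff ℝ ∞ (fun x : EuclideanSpace ℝ (Fin N) => tailInt χ ‖x‖) ∧
    HasCompactSupport (fun x : EuclideanSpace ℝ (Fin N) => tailInt χ ‖x‖) ∧
    gradient (fun x : EuclideanSpace ℝ (Fin N) => tailInt χ ‖x‖) = radField χ := by
  obtain ⟨hk, hd⟩ := contDiff_tailInt hχ hs
  have h00 : (0 : ℝ) ∉ tsupport χ := fun h => (lt_irrefl (0 : ℝ)) (h0 h)
  obtain ⟨ε, hε, hball⟩ := Metric.eventually_nhds_iff_ball.1 (notMem_tsupport_iff_eventuallyEq.1 h00)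
  -- χ vanishes near 0, so its primitive is constant there; this removes the singularity of |x| at
  -- the origin.
  have hconst : ∀ r, r ∈ Metric.ball (0 : ℝ) ε → tailInt χ r = tailInt χ 0 := by
    intro r hr
    have hi : Integrable χ := hχ.continuous.integrable_of_hasCompactSupport hs
    rw [tailInt_eq (r := 0) hi.integrableOn hi.integrableOn]
    have : ∫ t in (0 : ℝ)..r, χ t = ∫ t in (0 : ℝ)..r, (0 : ℝ) := by
      refine intervalIntegral.integral_congr fun t ht => ?_
      refine hball t ?_
      have := (convex_ball (0 : ℝ) ε).ordConnected.uIcc_subset (Metric.mem_ball_self hε) hr ht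
      exact this
    rw [this]; simp
  have hnear : (fun x : EuclideanSpace ℝ (Fin N) => tailInt χ ‖x‖) =ᶠ[𝓝 0]
      fun _ => tailInt χ 0 := by
    filter_upwards [Metric.ball_mem_nhds (0 : EuclideanSpace ℝ (Fin N)) hε] with x hx
    refine hconst _ ?_
    simpa using hx
  refine ⟨?_, ?_, ?_⟩
  · rw [contDiff_iff_contDiffAt]
    intro x
    by_cases hx : x = 0
    · subst hx
      exact contDiffAt_const.congr_of_eventuallyEq hnear
    · exact hk.contDiffAt.comp x (contDiffAt_norm ℝ hx)
  · obtain ⟨R, hR⟩ := hs.isCompact.isBounded.subset_closedBall 0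
    refine HasCompactSupport.of_support_subset_isCompact (isCompact_closedBall 0 R) ?_
    intro x hx
    by_contra hx'
    simp only [Metric.mem_closedBall, dist_zero_right, not_le] at hx'
    apply hx
    simp only [tailInt, neg_eq_zero]
    rw [setIntegral_congr_fun (g := fun _ => (0 : ℝ)) measurableSet_Ioi fun t ht => ?_]
    · simp
    · by_contra h1
      have := hR (subset_tsupport χ h1)
      simp only [Metric.mem_closedBall, dist_zero_right, Real.norm_eq_abs] at this
      have h3 : ‖x‖ < t := ht
      linarith [le_abs_self t]
  · funext x
    by_cases hx : x = 0
    · subst hx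
      have hz : fderiv ℝ (fun x : EuclideanSpace ℝ (Fin N) => tailInt χ ‖x‖) 0 = 0 := by
        rw [hnear.fderiv_eq]; simp
      simp [gradient, radField, hz]
    · refine ext_inner_right ℝ fun v => ?_
      rw [inner_gradient]
      have := (hd ‖x‖).comp_hasFDerivAt x (hasFDerivAt_norm hx)
      have e : fderiv ℝ (fun x : EuclideanSpace ℝ (Fin N) => tailInt χ ‖x‖) x = _ := this.fderiv
      rw [e]
      simp [radField, real_inner_smul_left]

end Radial

/-! ### Square integrable profiles generate radial elements of the completion. -/

section Structure

variable {N : ℕ} {a : ℝ}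

/-- The kernel representing evaluation of `tailInt` at `r`. -/
noncomputable def tailKernel (N : ℕ) (a r : ℝ) : ℝ → ℝ :=
  (Set.Ioi r).indicator fun s => s ^ (-((N : ℝ) - 1 - 2 * a))

theorem rpow_mul_tailKernel_sq (r : ℝ) :
    Set.EqOn (fun s : ℝ => s ^ ((N : ℝ) - 1 - 2 * a) * tailKernel N a r s ^ 2)
      ((Set.Ioi r).indicator fun s => s ^ (-((N : ℝ) - 1 - 2 * a))) (Set.Ioi 0) := by
  intro s (hs : 0 < s)
  by_cases h : s ∈ Set.Ioi r
  · simp only [tailKernel, Set.indicator_of_mem h]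
    rw [sq, ← mul_assoc, ← Real.rpow_add hs]; simp
  · simp [tailKernel, Set.indicator_of_notMem h]

theorem memLp_tailKernel (hN : 2 < N) (ha' : a < ((N : ℝ) - 2) / 2) {r : ℝ} (hr : 0 < r) :
    MemLp (tailKernel N a r) 2 (radMeasure N a) := by
  refine (memLp_radMeasure_iff hN).2 ⟨?_, ?_⟩
  · refine (Measurable.indicator ?_ measurableSet_Ioi).aestronglyMeasurable
    exact measurable_id.pow_const _
  · rw [integrableOn_congr_fun (rpow_mul_tailKernel_sq r) measurableSet_Ioi]
    refine Integrable.integrableOn ?_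
    rw [integrable_indicator_iff measurableSet_Ioi]
    exact integrableOn_Ioi_rpow_of_lt (by linarith) hr

/-- The integrand reduces to s^(-(N-1-2a)) on (r, ∞), integrable because a < (N-2)/2. Up to a
constant, the square root of this value is the decay rate r^(-(N-2-2a)/2) of radial functions. -/
theorem integral_tailKernel_sq (hN : 2 < N) (ha' : a < ((N : ℝ) - 2) / 2) {r : ℝ} (hr : 0 < r) :
    ∫ x, tailKernel N a r ‖x‖ ^ 2 ∂(wMeasure N a) =
      sphereConst N * (r ^ (-((N : ℝ) - 2 - 2 * a)) / ((N : ℝ) - 2 - 2 * a)) := by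
  rw [integral_radial_wMeasure hN a fun s => tailKernel N a r s ^ 2,
    setIntegral_congr_fun measurableSet_Ioi (rpow_mul_tailKernel_sq r),
    setIntegral_indicator measurableSet_Ioi]
  have : Set.Ioi 0 ∩ Set.Ioi r = Set.Ioi r := Set.inter_eq_right.2 (Set.Ioi_subset_Ioi hr.le)
  rw [this, integral_Ioi_rpow_of_lt (by linarith) hr]
  congr 1
  rw [show -((N : ℝ) - 1 - 2 * a) + 1 = -((N : ℝ) - 2 - 2 * a) by ring, div_neg, neg_div, neg_neg]

/-- The polar weight cancels against the kernel. As an L² pairing with a fixed function, the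
primitive at r depends continuously on κ. -/
theorem tailInt_eq_integral (hN : 2 < N) {r : ℝ} (hr : 0 < r) (κ : ℝ → ℝ) :
    tailInt κ r = -((sphereConst N)⁻¹ *
      ∫ x, inner ℝ (κ ‖x‖) (tailKernel N a r ‖x‖) ∂(wMeasure N a)) := by
  have h := integral_radial_wMeasure hN a fun s => inner ℝ (κ s) (tailKernel N a r s)
  rw [h, ← mul_assoc, inv_mul_cancel₀ (sphereConst_pos hN).ne', one_mul, tailInt]
  congr 1
  have e : Set.EqOn (fun s : ℝ => s ^ ((N : ℝ) - 1 - 2 * a) * inner ℝ (κ s) (tailKernel N a r s))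
      ((Set.Ioi r).indicator κ) (Set.Ioi 0) := by
    intro s (hs : 0 < s)
    by_cases h : s ∈ Set.Ioi r
    · simp only [tailKernel, Set.indicator_of_mem h, RCLike.inner_apply, conj_trivial]
      rw [← mul_assoc, ← Real.rpow_add hs]; simp
    · simp [tailKernel, Set.indicator_of_notMem h]
  rw [setIntegral_congr_fun measurableSet_Ioi e, setIntegral_indicator measurableSet_Ioi]
  congr 2
  exact (Set.inter_eq_right.2 (Set.Ioi_subset_Ioi hr.le)).symm

theorem integrableOn_Ioi_of_memLp (hN : 2 < N) (ha' : a < ((N : ℝ) - 2) / 2) {κ : ℝ → ℝ}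
    (hκ : MemLp κ 2 (radMeasure N a)) {r : ℝ} (hr : 0 < r) : IntegrableOn κ (Set.Ioi r) := by
  have h1 : MemLp (fun x : EuclideanSpace ℝ (Fin N) => κ ‖x‖) 2 (wMeasure N a) :=
    hκ.comp_measurePreserving (measurePreserving_norm N a)
  have h2 : MemLp (fun x : EuclideanSpace ℝ (Fin N) => tailKernel N a r ‖x‖) 2 (wMeasure N a) :=
    (memLp_tailKernel hN ha' hr).comp_measurePreserving (measurePreserving_norm N a)
  have h3 := (integrable_radial_wMeasure hN a fun s => κ s * tailKernel N a r s).1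
    (h1.integrable_mul h2)
  refine (h3.mono_set (Set.Ioi_subset_Ioi hr.le)).congr_fun (fun s (hs : r < s) => ?_)
    measurableSet_Ioi
  have hs0 : 0 < s := hr.trans hs
  simp only [tailKernel, Set.indicator_of_mem (show s ∈ Set.Ioi r from hs)]
  rw [mul_left_comm, ← Real.rpow_add hs0]; simp

theorem locallyIntegrableOn_of_memLp (hN : 2 < N) {κ : ℝ → ℝ} (hκ : MemLp κ 2 (radMeasure N a)) :
    LocallyIntegrableOn κ (Set.Ioi 0) := by
  obtain ⟨hm, hi⟩ := memLp_radMeasure hN hκ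
  refine (locallyIntegrableOn_iff isOpen_Ioi.isLocallyClosed).2 fun K hK hKc => ?_
  set γ := (N : ℝ) - 1 - 2 * a
  have hcont : ContinuousOn (fun r : ℝ => r ^ (-γ)) K := fun r hr =>
    (continuousAt_id.rpow_const (Or.inl (hK hr : 0 < r).ne')).continuousWithinAt
  refine Integrable.mono' ((hcont.integrableOn_compact hKc).add (hi.mono_set hK))
    (hm.mono_measure (Measure.restrict_mono hK le_rfl)) ?_
  filter_upwards [ae_restrict_mem hKc.measurableSet] with r hr
  have hr0 : 0 < r := hK hr
  simp only [Pi.add_apply, Real.norm_eq_abs]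
  have e : r ^ (-γ) * r ^ γ = 1 := by rw [← Real.rpow_add hr0]; simp
  have p1 : 0 < r ^ (-γ) := by positivity
  have p2 : 0 < r ^ γ := by positivity
  have : 0 ≤ r ^ γ * (|κ r| - r ^ (-γ)) ^ 2 := by positivity
  have e2 : r ^ γ * (|κ r| - r ^ (-γ)) ^ 2 =
      r ^ γ * |κ r| ^ 2 - 2 * |κ r| * (r ^ (-γ) * r ^ γ) + r ^ (-γ) * (r ^ (-γ) * r ^ γ) := by ring
  rw [e2, e, sq_abs] at this
  linarith [abs_nonneg (κ r)]

theorem continuousOn_tailInt (hN : 2 < N) (ha' : a < ((N : ℝ) - 2) / 2) {κ : ℝ → ℝ}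
    (hκ : MemLp κ 2 (radMeasure N a)) : ContinuousOn (tailInt κ) (Set.Ioi 0) := by
  intro r (hr : 0 < r)
  refine ContinuousAt.continuousWithinAt ?_
  have hr2 : 0 < r / 2 := by positivity
  have hi := integrableOn_Ioi_of_memLp hN ha' hκ hr2
  have h1 : ContinuousOn (fun s => ∫ t in (r / 2)..s, κ t) (Set.Icc (r / 2) (2 * r)) :=
    intervalIntegral.continuousOn_primitive_interval' (b₁ := r / 2) (b₂ := 2 * r)
      (by rw [intervalIntegrable_iff_integrableOn_Ioc_of_le (by linarith)]
          exact hi.mono_set fun x hx => hx.1) (by simp) |>.mono (by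
            rw [Set.uIcc_of_le (by linarith)])
  have h2 := h1.continuousAt (Icc_mem_nhds (by linarith : r / 2 < r) (by linarith : r < 2 * r))
  refine ((continuousAt_const (y := tailInt κ (r / 2))).add h2).congr ?_
  filter_upwards [Ioi_mem_nhds hr] with s hs
  exact (tailInt_eq hi (integrableOn_Ioi_of_memLp hN ha' hκ hs)).symm

/-- The test functions on `(0, ∞)`. -/
def IsTest (χ : ℝ → ℝ) : Prop :=
  ContDiff ℝ ∞ χ ∧ HasCompactSupport χ ∧ tsupport χ ⊆ Set.Ioi 0

theorem continuous_rpow_mul {χ : ℝ → ℝ} (hc : Continuous χ) (h0 : (0 : ℝ) ∉ tsupport χ) (s : ℝ) :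
    Continuous fun r => r ^ s * χ r := by
  rw [continuous_iff_continuousAt]
  intro x
  by_cases hx : x = 0
  · subst hx
    have h1 : (fun r => r ^ s * χ r) =ᶠ[𝓝 0] fun _ => 0 := by
      filter_upwards [notMem_tsupport_iff_eventuallyEq.1 h0] with y hy
      rw [hy]; simp
    exact (continuousAt_congr h1).2 continuousAt_const
  · exact (continuousAt_id.rpow_const (Or.inl hx)).mul hc.continuousAt

theorem memLp_radMeasure_of_compact (hN : 2 < N) (a : ℝ) {χ : ℝ → ℝ} (hc : Continuous χ)
    (hs : HasCompactSupport χ) (h0 : tsupport χ ⊆ Set.Ioi 0) : MemLp χ 2 (radMeasure N a) := by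
  refine (memLp_radMeasure_iff hN).2 ⟨hc.aestronglyMeasurable, ?_⟩
  have h1 := (continuous_rpow_mul hc (fun h => lt_irrefl (0 : ℝ) (h0 h))
    ((N : ℝ) - 1 - 2 * a)).mul hc
  refine ((h1.integrable_of_hasCompactSupport hs.mul_left).integrableOn).congr_fun
    (fun r _ => ?_) measurableSet_Ioi
  simp only [Pi.mul_apply]; ring

theorem IsTest.memLp (hN : 2 < N) (a : ℝ) {χ : ℝ → ℝ} (h : IsTest χ) :
    MemLp χ 2 (radMeasure N a) :=
  memLp_radMeasure_of_compact hN a h.1.continuous h.2.1 h.2.2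

/-- Test functions on `(0, ∞)` are dense in `L²(radMeasure)`. -/
theorem exists_test_approx (hN : 2 < N) {κ : ℝ → ℝ} (hκ : MemLp κ 2 (radMeasure N a)) :
    ∃ χ : ℕ → ℝ → ℝ, (∀ n, IsTest (χ n)) ∧
      Tendsto (fun n => eLpNorm (χ n - κ) 2 (radMeasure N a)) atTop (𝓝 0) := by
  let S : Submodule ℝ (Lp ℝ 2 (radMeasure N a)) :=
    { carrier := {f | ∃ χ, IsTest χ ∧ f =ᵐ[radMeasure N a] χ}
      zero_mem' := ⟨0, ⟨contDiff_const, HasCompactSupport.zero, by simp [tsupport]⟩,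
        Lp.coeFn_zero _ _ _⟩
      add_mem' := by
        rintro f g ⟨χ, h1, h2⟩ ⟨ψ, k1, k2⟩
        refine ⟨χ + ψ, ⟨h1.1.add k1.1, h1.2.1.add k1.2.1, ?_⟩,
          (Lp.coeFn_add f g).trans (h2.add k2)⟩
        exact (tsupport_add χ ψ).trans (Set.union_subset h1.2.2 k1.2.2)
      smul_mem' := by
        rintro c f ⟨χ, h1, h2⟩
        refine ⟨c • χ, ⟨h1.1.const_smul c, h1.2.1.smul_left (f := fun _ => c), ?_⟩,
          (Lp.coeFn_smul c f).trans (h2.const_smul c)⟩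
        exact (tsupport_smul_subset_right (fun _ => c) χ).trans h1.2.2 }
  have hS : S.topologicalClosure = ⊤ := by
    -- Density amounts to a trivial orthogonal complement. In polar coordinates, orthogonality to
    -- all test functions is the hypothesis of the fundamental lemma for r^(N-1-2a) h(r).
    rw [Submodule.topologicalClosure_eq_top_iff, Submodule.eq_bot_iff]
    intro h hh
    have hL := Lp.memLp h
    have hm : MemLp (fun r => h r) 2 (radMeasure N a) := hL
    have hz := isOpen_Ioi.ae_eq_zero_of_integral_contDiff_smul_eq_zero (μ := volume)
      (f := fun r => r ^ ((N : ℝ) - 1 - 2 * a) * h r) (U := Set.Ioi (0 : ℝ)) ?_ ?_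
    · refine Lp.eq_zero_iff_ae_eq_zero.2 ?_
      rw [EventuallyEq, ae_radMeasure hN, ae_restrict_iff' measurableSet_Ioi]
      filter_upwards [hz] with r hr hr0
      have := hr hr0
      have h0 : 0 < r := hr0
      have p : 0 < r ^ ((N : ℝ) - 1 - 2 * a) := by positivity
      simpa [p.ne'] using this
    · refine LocallyIntegrableOn.continuousOn_mul (locallyIntegrableOn_of_memLp hN hm) ?_
        isOpen_Ioi.isLocallyClosed
      exact fun r (hr : 0 < r) => (continuousAt_id.rpow_const (Or.inl hr.ne')).continuousWithinAt
    · intro χ hχ hs h0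
      have ht : IsTest χ := ⟨hχ, hs, h0⟩
      have h1 := (Submodule.mem_orthogonal S h).1 hh ((ht.memLp hN a).toLp χ)
        ⟨χ, ht, MemLp.coeFn_toLp _⟩
      rw [L2.inner_def] at h1
      have h2 : ∫ r, inner ℝ (((ht.memLp hN a).toLp χ : Lp ℝ 2 (radMeasure N a)) r) (h r)
          ∂(radMeasure N a) = ∫ r, χ r * h r ∂(radMeasure N a) := by
        refine integral_congr_ae ?_
        filter_upwards [(ht.memLp hN a).coeFn_toLp] with r hr
        rw [hr]; simp [mul_comm]
      have h4 : ∫ r, χ r * h r ∂(radMeasure N a) = ∫ x, χ ‖x‖ * h ‖x‖ ∂(wMeasure N a) :=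
        integral_map measurable_norm.aemeasurable (hχ.continuous.aestronglyMeasurable.mul hL.1)
      rw [h2, h4, integral_radial_wMeasure hN a fun r => χ r * h r] at h1
      have h3 := (mul_eq_zero.1 h1).resolve_left (sphereConst_pos hN).ne'
      rw [← integral_indicator measurableSet_Ioi] at h3
      rw [← h3]
      refine integral_congr_ae (Eventually.of_forall fun r => ?_)
      by_cases hr : r ∈ Set.Ioi (0 : ℝ)
      · simp only [Set.indicator_of_mem hr, smul_eq_mul]; ring
      · have : χ r = 0 := by
          by_contra hc; exact hr (h0 (subset_tsupport χ hc))
        simp [Set.indicator_of_notMem hr, this]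
  have hmem : hκ.toLp κ ∈ closure (S : Set (Lp ℝ 2 (radMeasure N a))) := by
    rw [← Submodule.topologicalClosure_coe, hS]; trivial
  obtain ⟨f, hf, hlim⟩ := mem_closure_iff_seq_limit.1 hmem
  choose χ hχ hfχ using hf
  refine ⟨χ, hχ, ?_⟩
  have h1 : Tendsto (fun n => ((hχ n).memLp hN a).toLp (χ n)) atTop (𝓝 (hκ.toLp κ)) := by
    refine hlim.congr fun n => ?_
    exact Lp.ext ((hfχ n).trans ((hχ n).memLp hN a).coeFn_toLp.symm)
  exact (Lp.tendsto_Lp_iff_tendsto_eLpNorm'' χ (fun n => (hχ n).memLp hN a) κ hκ).1 h1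

/-- Every square integrable profile is the radial derivative of an element of `D_a^{1,2}`. -/
theorem isD_tailInt (hN : 2 < N) (ha' : a < ((N : ℝ) - 2) / 2) {κ : ℝ → ℝ}
    (hκ : MemLp κ 2 (radMeasure N a)) :
    IsD (N := N) a (fun x => tailInt κ ‖x‖) (radField κ) := by
  obtain ⟨χ, hχ, hlim⟩ := exists_test_approx hN hκ
  have hp := fun n => smooth_radial_profile (N := N) (hχ n).1 (hχ n).2.1 (hχ n).2.2
  have hcomp : ∀ n, eLpNorm (fun x : EuclideanSpace ℝ (Fin N) => (χ n - κ) ‖x‖) 2 (wMeasure N a) =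
      eLpNorm (χ n - κ) 2 (radMeasure N a) := fun n =>
    eLpNorm_comp_measurePreserving (((hχ n).memLp hN a).sub hκ).1 (measurePreserving_norm N a)
  refine ⟨memLp_radField hκ, fun n x => tailInt (χ n) ‖x‖, fun n => ⟨(hp n).1, (hp n).2.1⟩, ?_, ?_⟩
  · refine tendsto_of_tendsto_of_tendsto_of_le_of_le tendsto_const_nhds hlim
      (fun _ => bot_le) fun n => ?_
    simp only
    rw [← hcomp]
    refine eLpNorm_mono fun x => ?_
    rw [(hp n).2.2]
    have : radField (χ n) x - radField κ x = radField (χ n - κ) x := by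
      simp [radField, sub_smul]
    rw [this]
    exact norm_radField_le _ _
  · rw [ae_wMeasure hN]
    filter_upwards [ae_ne_zero hN] with x hx
    have hx' : 0 < ‖x‖ := norm_pos_iff.2 hx
    -- L² convergence of the profiles, paired with `tailKernel`, gives convergence of the primitives
    -- at every x ≠ 0.
    simp only [tailInt_eq_integral (a := a) hN hx']
    refine ((tendsto_integral_inner (fun n => ((hχ n).memLp hN a).comp_measurePreserving
      (measurePreserving_norm N a)) (hκ.comp_measurePreserving (measurePreserving_norm N a))
      ((memLp_tailKernel hN ha' hx').comp_measurePreserving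
      (measurePreserving_norm N a)) ?_).const_mul _).neg
    refine hlim.congr fun n => ?_
    rw [← hcomp]; rfl

end Structure

/-! ### Radial elements are primitives of their radial derivative. -/

section Profile

variable {N : ℕ} {a : ℝ}

theorem tsupport_deriv_subset' (M : ℝ → ℝ) : tsupport (deriv M) ⊆ tsupport M :=
  closure_minimal (support_deriv_subset) (isClosed_tsupport M)

/-- M vanishes near 0 and is bounded, so only infinity matters, where the square has density
s^(-(N-1-2a)) with N-1-2a > 1. Compact support of M is not asked for: the primitives used later are
merely constant near infinity. -/
theorem memLp_divergence_kernel (hN : 2 < N) (ha' : a < ((N : ℝ) - 2) / 2) {M : ℝ → ℝ}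
    (hM : Continuous M) (h0 : tsupport M ⊆ Set.Ioi 0) {C : ℝ} (hC : ∀ r, |M r| ≤ C) :
    MemLp (fun s : ℝ => s ^ (2 * a + 1 - N) * M s) 2 (radMeasure N a) := by
  have h00 : (0 : ℝ) ∉ tsupport M := fun h => lt_irrefl (0 : ℝ) (h0 h)
  have hcont := continuous_rpow_mul hM h00 (2 * a + 1 - N)
  refine (memLp_radMeasure_iff hN).2 ⟨hcont.aestronglyMeasurable, ?_⟩
  obtain ⟨ε, hε, hball⟩ := Metric.eventually_nhds_iff_ball.1 (notMem_tsupport_iff_eventuallyEq.1 h00)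
  set γ := (N : ℝ) - 1 - 2 * a with hγ
  have hdom : IntegrableOn ((Set.Ioi (ε / 2)).indicator fun s : ℝ => C ^ 2 * s ^ (-γ))
      (Set.Ioi 0) := by
    refine Integrable.integrableOn ?_
    rw [integrable_indicator_iff measurableSet_Ioi]
    exact (integrableOn_Ioi_rpow_of_lt (by rw [hγ]; linarith) (by positivity)).const_mul _
  refine Integrable.mono' hdom ?_ ?_
  · exact ((measurable_id.pow_const _).aestronglyMeasurable).mul
      (hcont.aestronglyMeasurable.pow 2)
  · filter_upwards [ae_restrict_mem measurableSet_Ioi] with s (hs : 0 < s)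
    by_cases h : s ∈ Set.Ioi (ε / 2)
    · rw [Set.indicator_of_mem h, Real.norm_of_nonneg (by positivity)]
      have e : s ^ γ * (s ^ (2 * a + 1 - N) * M s) ^ 2 = s ^ (-γ) * |M s| ^ 2 := by
        rw [sq_abs, mul_pow, ← mul_assoc, ← Real.rpow_natCast, ← Real.rpow_mul hs.le,
          ← Real.rpow_add hs]
        congr 2; rw [hγ]; push_cast; ring
      rw [e, mul_comm]
      gcongr
      exact hC s
    · have h1 : M s = 0 := by
        refine hball s ?_
        have : s ≤ ε / 2 := not_lt.1 h
        rw [Metric.mem_ball, dist_zero_right, Real.norm_of_nonneg hs.le]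
        linarith
      rw [h1, Set.indicator_of_notMem h]; simp

/-- Integration by parts against the radial field `|x|^{-N} M(|x|) x`. -/
theorem IsD.radial_divergence {u : EuclideanSpace ℝ (Fin N) → ℝ}
    {g : EuclideanSpace ℝ (Fin N) → EuclideanSpace ℝ (Fin N)} (hN : 2 < N) (ha : 0 < a)
    (ha' : a < ((N : ℝ) - 2) / 2) (K : IsD a u g) {M : ℝ → ℝ} (hM : ContDiff ℝ 1 M)
    (h0 : tsupport M ⊆ Set.Ioi 0) {C : ℝ} (hC : ∀ r, |M r| ≤ C)
    (hs : HasCompactSupport (deriv M)) :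
    ∫ x, inner ℝ (g x) (‖x‖⁻¹ • x) * (‖x‖ ^ (2 * a + 1 - N) * M ‖x‖) ∂(wMeasure N a) =
      -∫ x, u x * (‖x‖ ^ (1 - (N : ℝ)) * deriv M ‖x‖) := by
  have h00 : (0 : ℝ) ∉ tsupport M := fun h => lt_irrefl (0 : ℝ) (h0 h)
  -- The power |x|^(-N) makes the undifferentiated M drop out: off the origin H(x) x has divergence
  -- N H + x·∇H = |x|^(1-N) M'(|x|).
  set H : EuclideanSpace ℝ (Fin N) → ℝ := fun x => ‖x‖ ^ (-(N : ℝ)) * M ‖x‖ with hH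
  have hH1 : ContDiff ℝ 1 H := by
    rw [contDiff_iff_contDiffAt]
    intro x
    by_cases hx : x = 0
    · subst hx
      have h1 : ∀ᶠ x : EuclideanSpace ℝ (Fin N) in 𝓝 0, M ‖x‖ = 0 := by
        have : Tendsto (fun x : EuclideanSpace ℝ (Fin N) => ‖x‖) (𝓝 0) (𝓝 0) := tendsto_norm_zero
        exact this.eventually (notMem_tsupport_iff_eventuallyEq.1 h00)
      refine (contDiffAt_const (c := (0 : ℝ))).congr_of_eventuallyEq ?_
      filter_upwards [h1] with y hy
      simp [hH, hy]
    · exact ((contDiffAt_norm ℝ hx).rpow_const_of_ne (norm_ne_zero_iff.2 hx)).mul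
        (hM.contDiffAt.comp x (contDiffAt_norm ℝ hx))
  have hdiv : ∀ x : EuclideanSpace ℝ (Fin N), x ≠ 0 →
      -(N * H x + fderiv ℝ H x x) = -(‖x‖ ^ (1 - (N : ℝ)) * deriv M ‖x‖) := by
    intro x hx
    have hx' : 0 < ‖x‖ := norm_pos_iff.2 hx
    have h1 := (Real.hasDerivAt_rpow_const (x := ‖x‖) (p := -(N : ℝ)) (Or.inl hx'.ne')).mul
      (hM.differentiable one_ne_zero ‖x‖).hasDerivAt
    have h2 : fderiv ℝ H x = _ := (h1.comp_hasFDerivAt x (hasFDerivAt_norm hx)).fderiv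
    have h3 : ‖x‖⁻¹ * ‖x‖ ^ 2 = ‖x‖ := by field_simp
    have h4 : fderiv ℝ H x x = (-(N : ℝ) * ‖x‖ ^ (-(N : ℝ) - 1) * M ‖x‖ +
        ‖x‖ ^ (-(N : ℝ)) * deriv M ‖x‖) * ‖x‖ := by
      rw [h2]; simp [h3]
    have e1 : ‖x‖ ^ (-(N : ℝ)) = ‖x‖ ^ (-(N : ℝ) - 1) * ‖x‖ := by
      nth_rewrite 3 [← Real.rpow_one ‖x‖]
      rw [← Real.rpow_add hx']; congr 1; ring
    have e2 : ‖x‖ ^ (1 - (N : ℝ)) = ‖x‖ ^ (-(N : ℝ) - 1) * ‖x‖ * ‖x‖ := by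
      rw [← e1]
      nth_rewrite 3 [← Real.rpow_one ‖x‖]
      rw [← Real.rpow_add hx']; congr 1; ring
    rw [h4, e2, hH]
    simp only
    rw [e1]; ring
  have hk := K.integral_inner_self hN ha ha' hH1 ?_ ?_
  · rw [integral_wMeasure, ← integral_neg]
    calc _ = ∫ x, inner ℝ (g x) (H x • x) := by
          refine integral_congr_ae ?_
          filter_upwards [ae_ne_zero hN] with x hx
          have hx' : 0 < ‖x‖ := norm_pos_iff.2 hx
          have e1 : ‖x‖ ^ (-2 * a) * (‖x‖ ^ (2 * a + 1 - N) * ‖x‖⁻¹) = ‖x‖ ^ (-(N : ℝ)) := by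
            rw [← Real.rpow_neg_one, ← Real.rpow_add hx', ← Real.rpow_add hx']; congr 1; ring
          simp only [inner_smul_right, smul_eq_mul, hH]
          rw [← e1]; ring
      _ = _ := hk
      _ = _ := by
          refine integral_congr_ae ?_
          filter_upwards [ae_ne_zero hN] with x hx
          rw [hdiv x hx]; ring
  · refine (memLp_radField (memLp_divergence_kernel hN ha' hM.continuous h0 hC)).ae_eq ?_
    rw [EventuallyEq, ae_wMeasure hN]
    filter_upwards [ae_ne_zero hN] with x hx
    have hx' : 0 < ‖x‖ := norm_pos_iff.2 hx
    simp only [radField, smul_smul, hH]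
    congr 1
    have e1 : ‖x‖ ^ (2 * a + 1 - N) * ‖x‖⁻¹ = ‖x‖ ^ (2 * a) * ‖x‖ ^ (-(N : ℝ)) := by
      rw [← Real.rpow_neg_one, ← Real.rpow_add hx', ← Real.rpow_add hx']; congr 1; ring
    rw [mul_right_comm, e1]; ring
  · have hc : Continuous (deriv M) := hM.continuous_deriv le_rfl
    have hsub := tsupport_deriv_subset' M
    have h1 : MemLp (fun s : ℝ => s ^ (2 * (a + 1) + 1 - N) * deriv M s) 2
        (radMeasure N (a + 1)) :=
      memLp_radMeasure_of_compact hN (a + 1)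
        (continuous_rpow_mul hc (fun h => h00 (hsub h)) _) hs.mul_left
        ((tsupport_mul_subset_right).trans (hsub.trans h0))
    refine ((h1.comp_measurePreserving (measurePreserving_norm N (a + 1))).neg).ae_eq ?_
    rw [EventuallyEq, ae_wMeasure hN]
    filter_upwards [ae_ne_zero hN] with x hx
    have hx' : 0 < ‖x‖ := norm_pos_iff.2 hx
    rw [hdiv x hx]
    simp only [Pi.neg_apply, Function.comp_apply, mul_neg]
    rw [← mul_assoc, ← Real.rpow_add hx']
    congr 3; ring

/-- The radial component of a square integrable field has a radial projection. -/
theorem exists_radial_projection {g : EuclideanSpace ℝ (Fin N) → EuclideanSpace ℝ (Fin N)}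
    (hg : MemLp g 2 (wMeasure N a)) :
    ∃ κ : ℝ → ℝ, Measurable κ ∧ MemLp κ 2 (radMeasure N a) ∧
      ∀ χ : ℝ → ℝ, MemLp χ 2 (radMeasure N a) →
        ∫ x, inner ℝ (g x) (‖x‖⁻¹ • x) * χ ‖x‖ ∂(wMeasure N a) =
          ∫ x, κ ‖x‖ * χ ‖x‖ ∂(wMeasure N a) := by
  have hG : MemLp (fun x => inner ℝ (g x) (‖x‖⁻¹ • x)) 2 (wMeasure N a) := by
    refine hg.of_le (hg.1.inner
      (measurable_norm.inv.smul measurable_id).aestronglyMeasurable) ?_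
    refine Eventually.of_forall fun x => (norm_inner_le_norm _ _).trans ?_
    have : ‖‖x‖⁻¹ • x‖ ≤ 1 := by
      rw [norm_smul, norm_inv, norm_norm]
      exact inv_mul_le_one
    nlinarith [norm_nonneg (g x)]
  set T := Lp.compMeasurePreservingₗᵢ ℝ (E := ℝ) (p := 2) norm (measurePreserving_norm N a) with hT
  -- The adjoint of composition with the norm plays the role of averaging the radial component of g
  -- over spheres.
  set κ := (ContinuousLinearMap.adjoint T.toContinuousLinearMap) (hG.toLp _) with hκ
  refine ⟨κ, (Lp.stronglyMeasurable κ).measurable, Lp.memLp κ, fun χ hχ => ?_⟩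
  have h1 : inner ℝ κ (hχ.toLp χ) = inner ℝ (hG.toLp _) (T (hχ.toLp χ)) :=
    ContinuousLinearMap.adjoint_inner_left _ _ _
  rw [← T.inner_map_map, L2.inner_def, L2.inner_def] at h1
  have hTf : ∀ f : Lp ℝ 2 (radMeasure N a), T f =ᵐ[wMeasure N a] fun x => f ‖x‖ := fun f =>
    Lp.coeFn_compMeasurePreserving f (measurePreserving_norm N a)
  have hχ' : ∀ᵐ x ∂(wMeasure N a), (hχ.toLp χ : Lp ℝ 2 (radMeasure N a)) ‖x‖ = χ ‖x‖ :=
    (measurePreserving_norm N a).quasiMeasurePreserving.ae hχ.coeFn_toLp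
  calc _ = ∫ x, inner ℝ ((hG.toLp _ : Lp ℝ 2 (wMeasure N a)) x) (T (hχ.toLp χ) x)
        ∂(wMeasure N a) := by
        refine integral_congr_ae ?_
        filter_upwards [hG.coeFn_toLp, hTf (hχ.toLp χ), hχ'] with x h2 h3 h4
        rw [h2, h3, h4]; simp [mul_comm]
    _ = _ := h1.symm
    _ = _ := by
        refine integral_congr_ae ?_
        filter_upwards [hTf κ, hTf (hχ.toLp χ), hχ'] with x h2 h3 h4
        rw [h2, h3, h4]; simp [mul_comm]

/-- A radial element of `D_a^{1,2}` is the primitive of its radial derivative. -/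
theorem IsD.exists_profile {u : EuclideanSpace ℝ (Fin N) → ℝ}
    {g : EuclideanSpace ℝ (Fin N) → EuclideanSpace ℝ (Fin N)} (hN : 2 < N) (ha : 0 < a)
    (ha' : a < ((N : ℝ) - 2) / 2) (K : IsD a u g) (hr : IsRadial a u) :
    ∃ κ : ℝ → ℝ, Measurable κ ∧ MemLp κ 2 (radMeasure N a) ∧
      u =ᵐ[volume] (fun x => tailInt κ ‖x‖) ∧ g =ᵐ[volume] radField κ := by
  obtain ⟨f, hf, huf⟩ := hr
  obtain ⟨κ, hκm, hκ, hproj⟩ := exists_radial_projection K.memLp_grad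
  have hD := isD_tailInt (N := N) hN ha' hκ
  have huf' := huf
  rw [EventuallyEq, ae_wMeasure hN] at huf
  have hfL : MemLp f 2 (radMeasure N (a + 1)) := by
    have h1 := (K.memLp_hardy hN ha ha').ae_eq
      (show u =ᵐ[wMeasure N (a + 1)] fun x => f ‖x‖ by rwa [EventuallyEq, ae_wMeasure hN])
    refine (memLp_radMeasure_iff hN).2 ⟨hf.aestronglyMeasurable, ?_⟩
    exact (integrable_radial_wMeasure hN (a + 1) fun r => f r ^ 2).1
      ((memLp_two_iff_integrable_sq h1.1).1 h1)
  have hcont := continuousOn_tailInt hN ha' hκ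
  have hloc : LocallyIntegrableOn (fun r => f r - tailInt κ r) (Set.Ioi 0) :=
    (locallyIntegrableOn_of_memLp hN hfL).sub (hcont.locallyIntegrableOn measurableSet_Ioi)
  have hz := isOpen_Ioi.ae_eq_zero_of_integral_contDiff_smul_eq_zero (μ := volume)
    hloc ?_
  · have hu : u =ᵐ[volume] fun x => tailInt κ ‖x‖ := by
      have h1 : ∀ᵐ r ∂(volume.restrict (Set.Ioi (0 : ℝ))), f r = tailInt κ r := by
        rw [ae_restrict_iff' measurableSet_Ioi]
        filter_upwards [hz] with r hr hr0
        linarith [hr hr0]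
      filter_upwards [(ae_norm_iff hN).2 h1, huf] with x h2 h3
      rw [h3, h2]
    exact ⟨κ, hκm, hκ, hu, K.grad_unique hN ha ha' hD hu⟩
  · intro F hF hFs hF0
    obtain ⟨hk, hd⟩ := contDiff_tailInt hF hFs
    -- M is the primitive of F vanishing near 0. With this M the divergence identity tests the
    -- functions themselves against M' = F, for arbitrary F, so f and the primitive of κ are
    -- identified with no additive constant left over.
    set M : ℝ → ℝ := fun r => tailInt F r - tailInt F 0 with hMdef
    have hFi : Integrable F := hF.continuous.integrable_of_hasCompactSupport hFs
    have hM : ContDiff ℝ 1 M := (hk.of_le (by norm_cast)).sub contDiff_const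
    have hMd : deriv M = F := funext fun r => ((hd r).sub_const _).deriv
    have hM0 : tsupport M ⊆ Set.Ioi 0 := by
      have h00 : (0 : ℝ) ∉ tsupport F := fun h => lt_irrefl (0 : ℝ) (hF0 h)
      obtain ⟨ε, hε, hball⟩ :=
        Metric.eventually_nhds_iff_ball.1 (notMem_tsupport_iff_eventuallyEq.1 h00)
      have hFz : ∀ t, t < ε → F t = 0 := by
        intro t ht
        by_cases h : 0 < t
        · refine hball t ?_
          rw [Metric.mem_ball, dist_zero_right, Real.norm_of_nonneg h.le]; exact ht
        · by_contra hc
          exact h (hF0 (subset_tsupport F hc))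
      have hMz : ∀ r, r < ε → M r = 0 := by
        intro r hr
        have h1 : M r = ∫ t in (0 : ℝ)..r, F t := by
          simp only [hMdef]
          rw [tailInt_eq (r := 0) hFi.integrableOn hFi.integrableOn]; ring
        rw [h1, intervalIntegral.integral_congr (g := fun _ => (0 : ℝ)) fun t ht => ?_]
        · simp
        · refine hFz t ?_
          rcases Set.mem_uIcc.1 ht with h | h <;> linarith [h.1, h.2]
      have : tsupport M ⊆ Set.Ici ε := by
        refine closure_minimal (fun r hr => ?_) isClosed_Ici
        by_contra hc
        exact hr (hMz r (not_le.1 hc))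
      exact this.trans fun r (hr : ε ≤ r) => lt_of_lt_of_le hε hr
    have hMb : ∀ r, |M r| ≤ (∫ t, |F t|) + ∫ t, |F t| := by
      have h1 : ∀ r, |tailInt F r| ≤ ∫ t, |F t| := fun r => by
        rw [tailInt, abs_neg]
        exact (norm_integral_le_integral_norm _).trans
          (setIntegral_le_integral hFi.norm (Eventually.of_forall fun _ => norm_nonneg _))
      intro r
      exact (abs_sub _ _).trans (add_le_add (h1 r) (h1 0))
    have d1 := K.radial_divergence hN ha ha' hM hM0 hMb (by rwa [hMd])
    have d2 := hD.radial_divergence hN ha ha' hM hM0 hMb (by rwa [hMd])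
    -- Against a radial weight the radial component of g may be replaced by its projection κ, so
    -- both divergence identities have the same left-hand side.
    rw [hproj _ (memLp_divergence_kernel hN ha' hM.continuous hM0 hMb)] at d1
    have e1 : ∫ x, inner ℝ (radField κ x) (‖x‖⁻¹ • x) * (‖x‖ ^ (2 * a + 1 - N) * M ‖x‖)
        ∂(wMeasure N a) = ∫ x, κ ‖x‖ * (‖x‖ ^ (2 * a + 1 - N) * M ‖x‖) ∂(wMeasure N a) := by
      refine integral_congr_ae ?_
      rw [EventuallyEq, ae_wMeasure hN]
      filter_upwards [ae_ne_zero hN] with x hx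
      have hx' := norm_ne_zero_iff.2 hx
      rw [inner_smul_right, inner_radField_self]
      field_simp
    rw [e1, d1, neg_inj, hMd] at d2
    have e2 : ∫ x, u x * (‖x‖ ^ (1 - (N : ℝ)) * F ‖x‖) =
        ∫ x : EuclideanSpace ℝ (Fin N), f ‖x‖ * (‖x‖ ^ (1 - (N : ℝ)) * F ‖x‖) := by
      refine integral_congr_ae ?_
      filter_upwards [huf] with x hx
      rw [hx]
    have e3 : ∀ h : ℝ → ℝ, ∫ x : EuclideanSpace ℝ (Fin N), h ‖x‖ * (‖x‖ ^ (1 - (N : ℝ)) * F ‖x‖) =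
        sphereConst N * ∫ r in Set.Ioi (0 : ℝ), F r * h r := by
      intro h
      rw [integral_radial hN fun r => h r * (r ^ (1 - (N : ℝ)) * F r)]
      congr 1
      refine setIntegral_congr_fun measurableSet_Ioi fun r (hr : 0 < r) => ?_
      have : r ^ ((N : ℝ) - 1) * r ^ (1 - (N : ℝ)) = 1 := by rw [← Real.rpow_add hr]; simp
      linear_combination h r * F r * this
    rw [e2, e3, e3 (tailInt κ)] at d2
    have d3 := mul_left_cancel₀ (sphereConst_pos hN).ne' d2
    have hi : ∀ h : ℝ → ℝ, LocallyIntegrableOn h (Set.Ioi 0) → Integrable (fun r => F r * h r) := by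
      intro h hh
      have h1 := (hh.integrableOn_compact_subset hF0 hFs).continuousOn_mul
        hF.continuous.continuousOn hFs
      refine (integrableOn_iff_integrable_of_support_subset fun r hr => ?_).1 h1
      exact subset_tsupport F fun hc => hr (by simp [hc])
    have hz : ∀ h : ℝ → ℝ, ∫ r in Set.Ioi (0 : ℝ), F r * h r = ∫ r, F r * h r := by
      intro h
      refine setIntegral_eq_integral_of_forall_compl_eq_zero fun r hr => ?_
      have : F r = 0 := by
        by_contra hc
        exact hr (hF0 (subset_tsupport F hc))
      simp [this]
    rw [hz, hz] at d3
    simp only [smul_eq_mul, mul_sub]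
    rw [integral_sub (hi _ (locallyIntegrableOn_of_memLp hN hfL))
      (hi _ (hcont.locallyIntegrableOn measurableSet_Ioi)), d3, sub_self]

end Profile

/-! ### Completeness of the radial space and decay of its elements. -/

section Space

variable {N : ℕ} {a : ℝ}

theorem gradSq_eq_norm_sq (w : Ambient N a) : gradSq a w.grad = ‖w.snd‖ ^ 2 := by
  rw [gradSq_eq_integral, ← real_inner_self_eq_norm_sq, L2.inner_def]
  refine integral_congr_ae (Eventually.of_forall fun x => ?_)
  simp only [real_inner_self_eq_norm_sq]; rfl

theorem integral_fn_sq_eq_norm_sq (w : Ambient N a) :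
    ∫ x, ‖x‖ ^ (-2 * a) * w.fn x ^ 2 = ‖w.fst‖ ^ 2 := by
  rw [← real_inner_self_eq_norm_sq, L2.inner_def, integral_wMeasure]
  refine integral_congr_ae (Eventually.of_forall fun x => ?_)
  simp only [real_inner_self_eq_norm_sq, Real.norm_eq_abs, sq_abs]; rfl

theorem norm_sq_eq (w : Ambient N a) : ‖w‖ ^ 2 = ‖w.fst‖ ^ 2 + ‖w.snd‖ ^ 2 :=
  WithLp.prod_norm_sq_eq_of_L2 w

theorem norm_fst_le (w : Ambient N a) : ‖w.fst‖ ≤ ‖w‖ := by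
  refine le_of_sq_le_sq ?_ (norm_nonneg _)
  rw [norm_sq_eq]; nlinarith [sq_nonneg ‖w.snd‖]

theorem norm_snd_le (w : Ambient N a) : ‖w.snd‖ ≤ ‖w‖ := by
  refine le_of_sq_le_sq ?_ (norm_nonneg _)
  rw [norm_sq_eq]; nlinarith [sq_nonneg ‖w.fst‖]

theorem hardy_integral (hN : 2 < N) (ha : 0 < a) (ha' : a < ((N : ℝ) - 2) / 2) {w : Ambient N a}
    (hw : w ∈ energySpace N a) :
    Integrable (fun x => ‖x‖ ^ (-2 * (a + 1)) * w.fn x ^ 2) ∧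
      ∫ x, ‖x‖ ^ (-2 * (a + 1)) * w.fn x ^ 2 ≤ (2 / ((N : ℝ) - 2 * a - 2)) ^ 2 * ‖w.snd‖ ^ 2 := by
  have hD : IsD a w.fn w.grad := hw
  have h1 := hD.memLp_hardy hN ha ha'
  have h2 := ((memLp_two_wMeasure hN _).1 h1).2
  simp only [Real.norm_eq_abs, sq_abs] at h2
  refine ⟨h2, ?_⟩
  have h3 := hD.hardy hN ha rfl (by linarith)
  rw [eLpNorm_two_eq_sqrt h1, eLpNorm_two_eq_sqrt hD.memLp_grad, ← gradSq_eq_integral,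
    gradSq_eq_norm_sq, Real.sqrt_sq (norm_nonneg _), integral_wMeasure,
    ← ENNReal.ofReal_mul (by have : 0 < (N : ℝ) - 2 * a - 2 := by linarith
                             positivity)] at h3
  have hc : 0 < (N : ℝ) - 2 * a - 2 := by linarith
  have h4 := (ENNReal.ofReal_le_ofReal_iff (by positivity)).1 h3
  have h5 := (Real.sqrt_le_left (by positivity)).1 h4
  simp only [Real.norm_eq_abs, sq_abs, smul_eq_mul] at h5
  rw [mul_pow] at h5
  exact h5

/-- Radial elements are those whose function component lies in the range of the isometry f ↦ f(|x|),
and an isometry from a complete space has closed range. -/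
theorem isClosed_radialSpace : IsClosed (radialSpace N a : Set (Ambient N a)) := by
  set T := Lp.compMeasurePreservingₗᵢ ℝ (E := ℝ) (p := 2) norm (measurePreserving_norm N a) with hT
  have hTf : ∀ f : Lp ℝ 2 (radMeasure N a), T f =ᵐ[wMeasure N a] fun x => f ‖x‖ := fun f =>
    Lp.coeFn_compMeasurePreserving f (measurePreserving_norm N a)
  have : (radialSpace N a : Set (Ambient N a)) = (fun w : Ambient N a => w.fst) ⁻¹' Set.range T := by
    ext w
    constructor
    · rintro ⟨f, hf, h⟩
      have hL : MemLp (fun x : EuclideanSpace ℝ (Fin N) => f ‖x‖) 2 (wMeasure N a) :=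
        (Lp.memLp w.fst).ae_eq h
      have hL' : MemLp f 2 (radMeasure N a) :=
        (memLp_map_measure_iff hf.aestronglyMeasurable measurable_norm.aemeasurable).2 hL
      refine ⟨hL'.toLp f, Lp.ext ?_⟩
      filter_upwards [hTf (hL'.toLp f), h,
        (measurePreserving_norm N a).quasiMeasurePreserving.ae hL'.coeFn_toLp] with x h1 h2 h3
      rw [h1, h2, h3]
    · rintro ⟨k, hk⟩
      refine ⟨k, (Lp.stronglyMeasurable k).measurable, ?_⟩
      have hk' : T k = w.fst := hk
      rw [← hk']
      exact hTf k
  rw [this]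
  exact T.isometry.isClosedEmbedding.isClosed_range.preimage (WithLp.continuous_fst _ _ _)

/-- Each term of a convergent sequence is replaced by a test function within 1/(n+1) of it in both
the Dirichlet and the Hardy norm. Hardy closeness and L² convergence then give, along a common
subsequence, the almost everywhere convergence that `IsD` demands. -/
theorem isClosed_energySpace (hN : 2 < N) (ha : 0 < a) (ha' : a < ((N : ℝ) - 2) / 2) :
    IsClosed (energySpace N a : Set (Ambient N a)) := by
  refine isClosed_of_closure_subset fun w hw => ?_
  obtain ⟨u, hu, hlim⟩ := mem_closure_iff_seq_limit.1 hw
  have hD : ∀ n, IsD a (u n).fst (u n).snd := fun n => hu n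
  have hex : ∀ n : ℕ, ∃ φ : EuclideanSpace ℝ (Fin N) → ℝ, (ContDiff ℝ ∞ φ ∧ HasCompactSupport φ) ∧
      eLpNorm (gradient φ - ⇑(u n).snd) 2 (wMeasure N a) < ENNReal.ofReal (1 / ((n : ℝ) + 1)) ∧
      eLpNorm (φ - ⇑(u n).fst) 2 (wMeasure N (a + 1)) < ENNReal.ofReal (1 / ((n : ℝ) + 1)) := by
    intro n
    obtain ⟨φ, h1, h2, h3, h4⟩ := (hD n).exists_approx hN ha ha'
    have hp : 0 < ENNReal.ofReal (1 / ((n : ℝ) + 1)) := by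
      rw [ENNReal.ofReal_pos]; positivity
    obtain ⟨m, hm1, hm2⟩ := ((h3.eventually_lt_const hp).and (h4.eventually_lt_const hp)).exists
    exact ⟨φ m, h1 m, hm1, hm2⟩
  choose φ h1 h2 h3 using hex
  have h0 : Tendsto (fun n : ℕ => ENNReal.ofReal (1 / ((n : ℝ) + 1))) atTop (𝓝 0) := by
    have := (ENNReal.continuous_ofReal.tendsto 0).comp
      (tendsto_one_div_add_atTop_nhds_zero_nat (𝕜 := ℝ))
    rwa [ENNReal.ofReal_zero] at this
  have h2' : Tendsto (fun n => eLpNorm (gradient (φ n) - ⇑(u n).snd) 2 (wMeasure N a)) atTop (𝓝 0) :=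
    tendsto_of_tendsto_of_tendsto_of_le_of_le tendsto_const_nhds h0 (fun _ => bot_le)
      fun n => (h2 n).le
  have h3' : Tendsto (fun n => eLpNorm (φ n - ⇑(u n).fst) 2 (wMeasure N (a + 1))) atTop (𝓝 0) :=
    tendsto_of_tendsto_of_tendsto_of_le_of_le tendsto_const_nhds h0 (fun _ => bot_le)
      fun n => (h3 n).le
  have hf : Tendsto (fun n => (u n).fst) atTop (𝓝 w.fst) :=
    ((WithLp.continuous_fst _ _ _).tendsto w).comp hlim
  have hs : Tendsto (fun n => (u n).snd) atTop (𝓝 w.snd) :=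
    ((WithLp.continuous_snd _ _ _).tendsto w).comp hlim
  have hf' := (Lp.tendsto_Lp_iff_tendsto_eLpNorm' _ _).1 hf
  have hs' := (Lp.tendsto_Lp_iff_tendsto_eLpNorm' _ _).1 hs
  have hum : ∀ n, AEStronglyMeasurable (u n).fst volume := fun n => (hD n).aestronglyMeasurable hN
  have m1 : TendstoInMeasure (wMeasure N (a + 1)) (fun n => φ n - ⇑(u n).fst) atTop 0 := by
    refine tendstoInMeasure_of_tendsto_eLpNorm (p := 2) (by norm_num) (fun n => ?_)
      aestronglyMeasurable_zero (by simpa using h3')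
    exact (h1 n).1.continuous.aestronglyMeasurable.sub
      ((aestronglyMeasurable_wMeasure hN).2 (hum n))
  obtain ⟨k, hk, hk'⟩ := m1.exists_seq_tendsto_ae
  have m2 : TendstoInMeasure (wMeasure N a) (fun n => ⇑(u (k n)).fst) atTop w.fst := by
    refine tendstoInMeasure_of_tendsto_eLpNorm (p := 2) (by norm_num)
      (fun n => Lp.aestronglyMeasurable _) (Lp.aestronglyMeasurable _)
      (hf'.comp hk.tendsto_atTop)
  obtain ⟨j, hj, hj'⟩ := m2.exists_seq_tendsto_ae
  have hkj := hk.comp hj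
  change IsD a w.fst w.snd
  refine ⟨Lp.memLp _, fun n => φ (k (j n)), fun n => h1 _, ?_, ?_⟩
  · have hsum := (h2'.comp hkj.tendsto_atTop).add (hs'.comp hkj.tendsto_atTop)
    rw [add_zero] at hsum
    refine tendsto_of_tendsto_of_tendsto_of_le_of_le tendsto_const_nhds hsum
      (fun _ => bot_le) fun n => ?_
    have e : (fun x => gradient (φ (k (j n))) x - w.snd x) =
        (gradient (φ (k (j n))) - ⇑(u (k (j n))).snd) + (⇑(u (k (j n))).snd - ⇑w.snd) := by
      funext x; simp
    simp only
    rw [e]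
    exact eLpNorm_add_le ((aestronglyMeasurable_gradient (h1 _).1).sub
      (Lp.aestronglyMeasurable _)) ((Lp.aestronglyMeasurable _).sub
      (Lp.aestronglyMeasurable _)) (by norm_num)
  · rw [ae_wMeasure hN] at hk' hj' ⊢
    filter_upwards [hk', hj'] with x hx hx'
    have := (hx.comp hj.tendsto_atTop).add hx'
    simpa using this

theorem completeSpace_X (hN : 2 < N) (ha : 0 < a) (ha' : a < ((N : ℝ) - 2) / 2) :
    CompleteSpace (X N a) := by
  have : IsClosed ((X N a : Submodule ℝ (Ambient N a)) : Set (Ambient N a)) :=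
    (isClosed_energySpace hN ha ha').inter isClosed_radialSpace
  exact this.completeSpace_coe

theorem exists_profile (hN : 2 < N) (ha : 0 < a) (ha' : a < ((N : ℝ) - 2) / 2) (w : X N a) :
    ∃ κ : ℝ → ℝ, Measurable κ ∧ MemLp κ 2 (radMeasure N a) ∧
      w.1.fn =ᵐ[volume] (fun x => tailInt κ ‖x‖) ∧ w.1.grad =ᵐ[volume] radField κ :=
  IsD.exists_profile hN ha ha' w.2.1 w.2.2

/-- Evaluation at radius `r`. -/
theorem exists_eval (hN : 2 < N) (ha : 0 < a) (ha' : a < ((N : ℝ) - 2) / 2) :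
    ∃ (K : ℝ) (ev : ℝ → X N a →L[ℝ] ℝ), 0 < K ∧
      (∀ w : X N a, ∀ᵐ x : EuclideanSpace ℝ (Fin N), w.1.fn x = ev ‖x‖ w) ∧
      ∀ r, 0 < r → ∀ w : X N a, |ev r w| ≤ K * r ^ (-(((N : ℝ) - 2 - 2 * a) / 2)) * ‖w.1.snd‖ := by
  classical
  set σ := sphereConst N with hσ
  have hσ0 : 0 < σ := sphereConst_pos hN
  set c := (N : ℝ) - 2 - 2 * a with hc
  have hc0 : 0 < c := by rw [hc]; linarith
  -- The radial field of `tailKernel`, paired with the gradient, represents evaluation at radius r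
  -- up to the factor -σ. Evaluation is thus linear, continuous and defined at every r > 0, not just
  -- almost everywhere.
  let e : ∀ r : ℝ, 0 < r → Lp (EuclideanSpace ℝ (Fin N)) 2 (wMeasure N a) := fun r hr =>
    (memLp_radField (memLp_tailKernel (a := a) hN ha' hr)).toLp _
  have hsnd : Continuous fun w : Ambient N a => w.snd := WithLp.continuous_snd _ _ _
  let ev : ℝ → X N a →L[ℝ] ℝ := fun r =>
    if hr : 0 < r then
      { toFun := fun w => -(σ⁻¹ * inner ℝ (e r hr) w.1.snd)
        map_add' := fun v w => by simp [inner_add_right]; ring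
        map_smul' := fun c w => by simp [inner_smul_right]; ring
        cont := ((continuous_const.inner (hsnd.comp continuous_subtype_val)).const_mul _).neg }
    else 0
  have hev : ∀ r (hr : 0 < r) (w : X N a), ev r w = -(σ⁻¹ * inner ℝ (e r hr) w.1.snd) := by
    intro r hr w
    simp only [ev, dif_pos hr]
    rfl
  have hen : ∀ r (hr : 0 < r), ‖e r hr‖ = √(σ * (r ^ (-c) / c)) := by
    intro r hr
    rw [← Real.sqrt_sq (norm_nonneg (e r hr)), ← integral_tailKernel_sq hN ha' hr,
      ← real_inner_self_eq_norm_sq, L2.inner_def]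
    congr 1
    refine integral_congr_ae ?_
    have h0 : ∀ᵐ x ∂(wMeasure N a), x ≠ 0 := by rw [ae_wMeasure hN]; exact ae_ne_zero hN
    filter_upwards [(memLp_radField (memLp_tailKernel (a := a) hN ha' hr)).coeFn_toLp, h0]
      with x hx hx0
    simp only [e]
    rw [hx, real_inner_self_eq_norm_sq, norm_radField _ hx0, sq_abs]
  refine ⟨σ⁻¹ * √(σ / c), ev, by positivity, fun w => ?_, fun r hr w => ?_⟩
  · obtain ⟨κ, hκm, hκ, h1, h2⟩ := exists_profile hN ha ha' w
    filter_upwards [h1, ae_ne_zero hN] with x hx hx0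
    have hr : 0 < ‖x‖ := norm_pos_iff.2 hx0
    rw [hx, hev _ hr, tailInt_eq_integral (a := a) hN hr, L2.inner_def]
    congr 2
    refine integral_congr_ae ?_
    rw [EventuallyEq, ae_wMeasure hN]
    have h3 := (memLp_radField (memLp_tailKernel (a := a) hN ha' hr)).coeFn_toLp
    rw [EventuallyEq, ae_wMeasure hN] at h3
    filter_upwards [h2, h3, ae_ne_zero hN] with y h4 h5 h6
    have h7 : w.1.snd y = radField κ y := h4
    simp only [e]
    rw [h5, h7]
    have h8 : ‖y‖ ≠ 0 := norm_ne_zero_iff.2 h6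
    rw [show radField κ y = κ ‖y‖ • (‖y‖⁻¹ • y) from rfl, inner_smul_right, inner_smul_right,
      inner_radField_self]
    simp
    field_simp
  · rw [hev r hr, abs_neg, abs_mul, abs_of_pos (by positivity)]
    have h1 := abs_real_inner_le_norm (e r hr) w.1.snd
    rw [hen r hr] at h1
    have h2 : √(σ * (r ^ (-c) / c)) = √(σ / c) * r ^ (-(c / 2)) := by
      rw [show σ * (r ^ (-c) / c) = σ / c * r ^ (-c) by ring, Real.sqrt_mul (by positivity)]
      congr 1
      rw [Real.sqrt_eq_rpow, ← Real.rpow_mul hr.le]; congr 1; ring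
    rw [h2] at h1
    calc σ⁻¹ * |inner ℝ (e r hr) w.1.snd| ≤ σ⁻¹ * (√(σ / c) * r ^ (-(c / 2)) * ‖w.1.snd‖) := by
          gcongr
      _ = _ := by ring

end Space

/-! ### Elementary inequalities for powers. -/

section Pointwise

/-- `|s|^{p-2} s`. -/
noncomputable def sgnPow (p s : ℝ) : ℝ := |s| ^ (p - 2) * s

theorem continuous_sgnPow {p : ℝ} (hp : 2 < p) : Continuous (sgnPow p) :=
  (continuous_abs.rpow_const fun _ => Or.inr (by linarith)).mul continuous_id

theorem sgnPow_mul_self {p : ℝ} (hp : 2 < p) (s : ℝ) : sgnPow p s * s = |s| ^ p := by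
  rw [sgnPow, mul_assoc, ← abs_mul_abs_self s, ← mul_assoc]
  by_cases hs : |s| = 0
  · rw [hs, Real.zero_rpow (by linarith), Real.zero_rpow (by linarith)]; simp
  · have h0 : 0 < |s| := lt_of_le_of_ne (abs_nonneg s) (Ne.symm hs)
    have : |s| ^ p = |s| ^ (p - 2) * |s| ^ (2 : ℝ) := by rw [← Real.rpow_add h0]; congr 1; ring
    rw [this, Real.rpow_two]; ring

theorem abs_rpow_eq {p : ℝ} (hp : 2 < p) (s : ℝ) : |s| ^ p = |s| ^ (p - 2) * s ^ 2 := by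
  rw [← sgnPow_mul_self hp, sgnPow]; ring

theorem abs_sgnPow (p s : ℝ) : |sgnPow p s| = |s| ^ (p - 2) * |s| := by
  rw [sgnPow, abs_mul, abs_of_nonneg (by positivity)]

theorem hasDerivAt_abs_rpow' {p : ℝ} (hp : 2 < p) (s : ℝ) :
    HasDerivAt (fun t : ℝ => |t| ^ p) (p * sgnPow p s) s := by
  have := hasDerivAt_abs_rpow s (p := p) (by linarith)
  convert this using 1
  simp [sgnPow]; ring

theorem hasDerivAt_sgnPow {p : ℝ} (hp : 2 < p) (s : ℝ) :
    HasDerivAt (sgnPow p) ((p - 1) * |s| ^ (p - 2)) s := by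
  by_cases hs : s = 0
  · subst hs
    -- At the origin the difference quotient is |t|^(p-2), which tends to 0 because p > 2.
    rw [abs_zero, Real.zero_rpow (by linarith), mul_zero, hasDerivAt_iff_tendsto_slope]
    have h1 : Tendsto (fun t : ℝ => |t| ^ (p - 2)) (𝓝[≠] 0) (𝓝 0) := by
      have : Continuous fun t : ℝ => |t| ^ (p - 2) :=
        continuous_abs.rpow_const fun _ => Or.inr (by linarith)
      have := this.tendsto 0
      rw [abs_zero, Real.zero_rpow (by linarith)] at this
      exact this.mono_left nhdsWithin_le_nhds
    refine h1.congr' ?_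
    filter_upwards [self_mem_nhdsWithin] with t ht
    have ht' : t ≠ 0 := ht
    simp only [slope_def_field, sgnPow, mul_zero, sub_zero]
    field_simp
  · have h1 : HasDerivAt (fun t : ℝ => |t| ^ (p - 2)) ((p - 2) * |s| ^ (p - 2 - 1) * SignType.sign s) s := by
      have := (hasDerivAt_abs hs).rpow_const (p := p - 2) (Or.inl (abs_ne_zero.2 hs))
      convert this using 1; ring
    have h2 := h1.mul (hasDerivAt_id s)
    refine HasDerivAt.congr_deriv h2 ?_
    have h0 : 0 < |s| := abs_pos.2 hs
    have e : |s| ^ (p - 2) = |s| ^ (p - 2 - 1) * |s| := by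
      nth_rewrite 3 [← Real.rpow_one |s|]
      rw [← Real.rpow_add h0]; congr 1; ring
    have e2 : (SignType.sign s : ℝ) * s = |s| := sign_mul_self s
    simp only [id]
    rw [e]
    linear_combination (p - 2) * |s| ^ (p - 2 - 1) * e2

theorem abs_sgnPow_sub_le {p : ℝ} (hp : 2 < p) {x y R : ℝ} (hx : |x| ≤ R) (hy : |y| ≤ R) :
    |sgnPow p x - sgnPow p y| ≤ (p - 1) * R ^ (p - 2) * |x - y| := by
  have := (convex_Icc (-R) R).norm_image_sub_le_of_norm_hasDerivWithin_le
    (f := sgnPow p) (f' := fun s => (p - 1) * |s| ^ (p - 2)) (C := (p - 1) * R ^ (p - 2))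
    (fun s _ => (hasDerivAt_sgnPow hp s).hasDerivWithinAt) (fun s hs => ?_)
    (abs_le.1 hy) (abs_le.1 hx)
  · simpa using this
  · rw [Real.norm_of_nonneg (mul_nonneg (by linarith) (by positivity))]
    exact mul_le_mul_of_nonneg_left (Real.rpow_le_rpow (abs_nonneg _) (abs_le.2 hs) (by linarith))
      (by linarith)

theorem abs_rpow_sub_le {p : ℝ} (hp : 2 < p) {x y R : ℝ} (hx : |x| ≤ R) (hy : |y| ≤ R) :
    |(|x| ^ p - |y| ^ p)| ≤ p * (R ^ (p - 2) * R) * |x - y| := by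
  have hR : 0 ≤ R := (abs_nonneg x).trans hx
  have := (convex_Icc (-R) R).norm_image_sub_le_of_norm_hasDerivWithin_le
    (f := fun t : ℝ => |t| ^ p) (f' := fun s => p * sgnPow p s) (C := p * (R ^ (p - 2) * R))
    (fun s _ => (hasDerivAt_abs_rpow' hp s).hasDerivWithinAt) (fun s hs => ?_)
    (abs_le.1 hy) (abs_le.1 hx)
  · simpa using this
  · rw [norm_mul, Real.norm_of_nonneg (by linarith : 0 ≤ p), Real.norm_eq_abs, abs_sgnPow]
    have h1 := Real.rpow_le_rpow (abs_nonneg _) (abs_le.2 hs) (by linarith : 0 ≤ p - 2)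
    have h2 : |s| ≤ R := abs_le.2 hs
    gcongr

/-- Mean value inequality for r ↦ |r|^p - p |s|^(p-2) s r, whose derivative vanishes at r = s and is
Lipschitz on the segment. -/
theorem abs_rpow_taylor {p : ℝ} (hp : 2 < p) (s t : ℝ) :
    |(|s + t| ^ p - |s| ^ p - p * sgnPow p s * t)| ≤
      p * (p - 1) * (|s| + |t|) ^ (p - 2) * t ^ 2 := by
  set R := |s| + |t| with hR
  have key := (convex_uIcc s (s + t)).norm_image_sub_le_of_norm_hasDerivWithin_le
    (f := fun r : ℝ => |r| ^ p - p * sgnPow p s * r)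
    (f' := fun r => p * sgnPow p r - p * sgnPow p s)
    (C := p * ((p - 1) * R ^ (p - 2) * |t|))
    (fun r _ => by
      have := (hasDerivAt_abs_rpow' hp r).sub ((hasDerivAt_id r).const_mul (p * sgnPow p s))
      rw [mul_one] at this
      exact this.hasDerivWithinAt) (fun r hr => ?_)
    Set.left_mem_uIcc Set.right_mem_uIcc
  · have e : |s + t| ^ p - p * sgnPow p s * (s + t) - (|s| ^ p - p * sgnPow p s * s) =
        |s + t| ^ p - |s| ^ p - p * sgnPow p s * t := by ring
    simp only [Real.norm_eq_abs] at key
    rw [e, add_sub_cancel_left] at key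
    refine key.trans (le_of_eq ?_)
    rw [← sq_abs t]; ring
  · have h1 : |r - s| ≤ |t| := by
      have := Set.abs_sub_left_of_mem_uIcc hr
      simpa using this
    have h2 : |r| ≤ R := by
      have := abs_add_le s (r - s)
      rw [add_sub_cancel] at this
      linarith
    have h3 := abs_sgnPow_sub_le hp h2 (show |s| ≤ R by rw [hR]; linarith [abs_nonneg t])
    rw [← mul_sub, norm_mul, Real.norm_of_nonneg (by linarith : 0 ≤ p), Real.norm_eq_abs]
    refine mul_le_mul_of_nonneg_left (h3.trans ?_) (by linarith)
    exact mul_le_mul_of_nonneg_left h1 (mul_nonneg (by linarith) (by positivity))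

/-- By symmetry |t| ≤ |s|. Then |s+t|^p - |s|^p is at most a constant times |s|^(p-1)|t| by the mean
value inequality on [-2|s|, 2|s|], and |t|^p ≤ |s|^(p-1)|t|. The factor |s||t| in the bound is what
later meets weak convergence to zero. -/
theorem abs_rpow_brezisLieb {p : ℝ} (hp : 2 < p) (s t : ℝ) :
    |(|s + t| ^ p - |s| ^ p - |t| ^ p)| ≤
      (p * (2 ^ (p - 2) * 2) + 1) * ((|s| ^ (p - 2) + |t| ^ (p - 2)) * (|s| * |t|)) := by
  wlog h : |t| ≤ |s| generalizing s t with H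
  · have := H t s (le_of_not_ge h)
    rw [add_comm t s, add_comm (|t| ^ (p - 2)), mul_comm |t|] at this
    rwa [show |s + t| ^ p - |s| ^ p - |t| ^ p = |s + t| ^ p - |t| ^ p - |s| ^ p by ring]
  have h1 := abs_rpow_sub_le hp (x := s + t) (y := s) (R := 2 * |s|)
    ((abs_add_le s t).trans (by linarith)) (by linarith [abs_nonneg s])
  rw [add_sub_cancel_left, Real.mul_rpow (by norm_num) (abs_nonneg s)] at h1
  have h2 : |(|t| ^ p)| ≤ |s| ^ (p - 2) * (|s| * |t|) := by
    rw [abs_of_nonneg (by positivity), abs_rpow_eq hp, ← sq_abs t, sq]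
    have := Real.rpow_le_rpow (abs_nonneg t) h (by linarith : 0 ≤ p - 2)
    gcongr
  have h3 : 0 ≤ (p * (2 ^ (p - 2) * 2) + 1) * (|t| ^ (p - 2) * (|s| * |t|)) := by positivity
  calc _ ≤ |(|s + t| ^ p - |s| ^ p)| + |(|t| ^ p)| := abs_sub _ _
    _ ≤ p * (2 ^ (p - 2) * |s| ^ (p - 2) * (2 * |s|)) * |t| + |s| ^ (p - 2) * (|s| * |t|) :=
        add_le_add h1 h2
    _ = (p * (2 ^ (p - 2) * 2) + 1) * (|s| ^ (p - 2) * (|s| * |t|)) := by ring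
    _ ≤ _ := by linarith

end Pointwise

/-! ### Powers dominated by an L² norm: differentiability, Brezis–Lieb splitting, compactness. -/

section Abstract

variable {α : Type*} [MeasurableSpace α] {τ : Measure α}

/-- An `L²`-bounded sequence which tends to zero almost everywhere tends to zero weakly, in the
strong sense that `∫ |f_n| |h| → 0`. -/
theorem tendsto_integral_abs_mul {f : ℕ → α → ℝ} {h : α → ℝ} {B : ℝ}
    (hf : ∀ n, MemLp (f n) 2 τ) (hh : MemLp h 2 τ) (hB : ∀ n, ∫ x, f n x ^ 2 ∂τ ≤ B)
    (hlim : ∀ᵐ x ∂τ, Tendsto (fun n => f n x) atTop (𝓝 0)) :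
    Tendsto (fun n => ∫ x, |f n x| * |h x| ∂τ) atTop (𝓝 0) := by
  have hB0 : 0 ≤ B := (integral_nonneg fun x => sq_nonneg (f 0 x)).trans (hB 0)
  have hi : ∀ n, Integrable (fun x => |f n x| * |h x|) τ := fun n => by
    have := ((hf n).integrable_mul hh).abs
    refine this.congr (Eventually.of_forall fun x => ?_)
    simp [abs_mul]
  have hf2 : ∀ n, Integrable (fun x => f n x ^ 2) τ := fun n =>
    (memLp_two_iff_integrable_sq (hf n).1).1 (hf n)
  have hh2 : Integrable (fun x => h x ^ 2) τ := (memLp_two_iff_integrable_sq hh.1).1 hh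
  rw [Metric.tendsto_atTop]
  intro ε hε
  -- Where |f_n| ≤ K|h| the product is dominated by K h². Elsewhere it is at most f_n²/K, whose
  -- integral is below ε/2 by this choice of K.
  set K : ℝ := 2 * (B + 1) / ε with hK
  have hK0 : 0 < K := by positivity
  have hmin : ∀ n, Integrable (fun x => min (|f n x| * |h x|) (K * h x ^ 2)) τ := fun n =>
    (hi n).inf (hh2.const_mul K)
  have hlim0 : Tendsto (fun n => ∫ x, min (|f n x| * |h x|) (K * h x ^ 2) ∂τ) atTop (𝓝 0) := by
    have := tendsto_integral_of_dominated_convergence (f := fun _ => (0 : ℝ))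
      (F := fun n x => min (|f n x| * |h x|) (K * h x ^ 2)) (μ := τ) (fun x => K * h x ^ 2)
      (fun n => (hmin n).1) (hh2.const_mul K) (fun n => Eventually.of_forall fun x => ?_) ?_
    · simpa using this
    · rw [Real.norm_of_nonneg (le_min (by positivity) (by positivity))]
      exact min_le_right _ _
    · filter_upwards [hlim] with x hx
      have h1 : Tendsto (fun n => |f n x| * |h x|) atTop (𝓝 0) := by
        simpa using hx.abs.mul_const |h x|
      have h2 := h1.min (tendsto_const_nhds (x := K * h x ^ 2))
      rwa [min_eq_left (by positivity)] at h2
  obtain ⟨n₀, hn₀⟩ := (hlim0.eventually_lt_const (half_pos hε)).exists_forall_of_atTop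
  refine ⟨n₀, fun n hn => ?_⟩
  rw [Real.dist_0_eq_abs, abs_of_nonneg (integral_nonneg fun x => by positivity)]
  have hle : ∫ x, |f n x| * |h x| ∂τ ≤
      ∫ x, (min (|f n x| * |h x|) (K * h x ^ 2) + K⁻¹ * f n x ^ 2) ∂τ := by
    refine integral_mono (hi n) ((hmin n).add ((hf2 n).const_mul _)) fun x => ?_
    simp only
    have hp : 0 ≤ K⁻¹ * f n x ^ 2 := by positivity
    by_cases hc : |f n x| ≤ K * |h x|
    · have : |f n x| * |h x| ≤ K * h x ^ 2 := by
        rw [← sq_abs (h x)]; nlinarith [abs_nonneg (h x)]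
      rw [min_eq_left this]; linarith
    · have h1 : |f n x| * |h x| ≤ K⁻¹ * f n x ^ 2 := by
        rw [← sq_abs (f n x), inv_mul_eq_div, le_div_iff₀ hK0]
        nlinarith [abs_nonneg (f n x)]
      have h2 : 0 ≤ min (|f n x| * |h x|) (K * h x ^ 2) := le_min (by positivity) (by positivity)
      linarith
  rw [integral_add (hmin n) ((hf2 n).const_mul _), integral_const_mul] at hle
  have h1 : K⁻¹ * ∫ x, f n x ^ 2 ∂τ < ε / 2 := by
    calc K⁻¹ * ∫ x, f n x ^ 2 ∂τ ≤ K⁻¹ * B := by gcongr; exact hB n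
      _ < K⁻¹ * (B + 1) := by gcongr; linarith
      _ = ε / 2 := by rw [hK]; field_simp
  linarith [hn₀ n hn]

variable {X : Type*} [NormedAddCommGroup X] [NormedSpace ℝ X]

/-- A continuous embedding into `L²(τ)` with a pointwise bound `|w| ≤ D ‖w‖`, and a weight `θ`
with `θ D^{p-2}` bounded. -/
structure IsSubcritical (ι : X →L[ℝ] Lp ℝ 2 τ) (D θ : α → ℝ) (p C : ℝ) : Prop where
  two_lt : 2 < p
  D_nonneg : ∀ x, 0 ≤ D x
  bound : ∀ w, ∀ᵐ x ∂τ, |ι w x| ≤ D x * ‖w‖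
  meas : Measurable θ
  nonneg : ∀ x, 0 ≤ θ x
  weight : ∀ᵐ x ∂τ, θ x * D x ^ (p - 2) ≤ C

variable {ι : X →L[ℝ] Lp ℝ 2 τ} {D θ : α → ℝ} {p C : ℝ}

/-- `∫ θ |w|^p`. -/
noncomputable def powInt (ι : X →L[ℝ] Lp ℝ 2 τ) (θ : α → ℝ) (p : ℝ) (w : X) : ℝ :=
  ∫ x, θ x * |ι w x| ^ p ∂τ

namespace IsSubcritical

/-- The mechanism behind the whole abstract setting: p-2 of the p powers are spent on the pointwise
bound, so that θ|f|^p becomes at most a constant times f². -/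
theorem weight_bound (S : IsSubcritical ι D θ p C) {f : α → ℝ} {M : ℝ} (hM : 0 ≤ M)
    (hf : ∀ᵐ x ∂τ, |f x| ≤ D x * M) : ∀ᵐ x ∂τ, θ x * |f x| ^ (p - 2) ≤ C * M ^ (p - 2) := by
  filter_upwards [hf, S.weight] with x h1 h2
  have hp := S.two_lt
  calc θ x * |f x| ^ (p - 2) ≤ θ x * (D x * M) ^ (p - 2) :=
        mul_le_mul_of_nonneg_left (Real.rpow_le_rpow (abs_nonneg _) h1 (by linarith)) (S.nonneg x)
    _ = θ x * D x ^ (p - 2) * M ^ (p - 2) := by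
        rw [Real.mul_rpow (S.D_nonneg x) hM]; ring
    _ ≤ _ := mul_le_mul_of_nonneg_right h2 (by positivity)

theorem weight_bound_self (S : IsSubcritical ι D θ p C) (w : X) :
    ∀ᵐ x ∂τ, θ x * |ι w x| ^ (p - 2) ≤ C * ‖w‖ ^ (p - 2) :=
  S.weight_bound (norm_nonneg w) (S.bound w)

theorem memLp_nonlin (S : IsSubcritical ι D θ p C) (v : X) :
    MemLp (fun x => θ x * sgnPow p (ι v x)) 2 τ := by
  refine ((Lp.memLp (ι v)).const_mul (C * ‖v‖ ^ (p - 2))).of_le ?_ ?_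
  · exact S.meas.aestronglyMeasurable.mul
      ((continuous_sgnPow S.two_lt).comp_aestronglyMeasurable (Lp.aestronglyMeasurable _))
  · filter_upwards [S.weight_bound_self v] with x hx
    rw [norm_mul, Real.norm_of_nonneg (S.nonneg x), Real.norm_eq_abs, abs_sgnPow, ← mul_assoc,
      norm_mul, Real.norm_eq_abs, Real.norm_eq_abs]
    exact mul_le_mul_of_nonneg_right (hx.trans (le_abs_self _)) (abs_nonneg _)

/-- The derivative of `∫ θ |w|^p / p`. -/
noncomputable def nonlin (S : IsSubcritical ι D θ p C) (v : X) : X →L[ℝ] ℝ :=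
  (innerSL ℝ (S.memLp_nonlin v).toLp).comp ι

theorem nonlin_apply (S : IsSubcritical ι D θ p C) (v h : X) :
    S.nonlin v h = ∫ x, θ x * sgnPow p (ι v x) * ι h x ∂τ := by
  change inner ℝ ((S.memLp_nonlin v).toLp) (ι h) = _
  rw [L2.inner_def]
  refine integral_congr_ae ?_
  filter_upwards [(S.memLp_nonlin v).coeFn_toLp] with x hx
  rw [hx]; simp [mul_comm]

theorem integrable_nonlin (S : IsSubcritical ι D θ p C) (v h : X) :
    Integrable (fun x => θ x * sgnPow p (ι v x) * ι h x) τ :=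
  (S.memLp_nonlin v).integrable_mul (Lp.memLp (ι h))

theorem integrable_pow (S : IsSubcritical ι D θ p C) (v : X) :
    Integrable (fun x => θ x * |ι v x| ^ p) τ := by
  refine (S.integrable_nonlin v v).congr (Eventually.of_forall fun x => ?_)
  simp only
  rw [mul_assoc, sgnPow_mul_self S.two_lt]

theorem integrable_pow_sub (S : IsSubcritical ι D θ p C) (v w : X) :
    Integrable (fun x => θ x * |ι v x| ^ p - θ x * |ι w x| ^ p) τ :=
  (S.integrable_pow v).sub (S.integrable_pow w)

theorem nonlin_self (S : IsSubcritical ι D θ p C) (v : X) : S.nonlin v v = powInt ι θ p v := by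
  rw [S.nonlin_apply, powInt]
  refine integral_congr_ae (Eventually.of_forall fun x => ?_)
  simp only
  rw [mul_assoc, sgnPow_mul_self S.two_lt]

theorem powInt_nonneg (S : IsSubcritical ι D θ p C) (v : X) : 0 ≤ powInt ι θ p v :=
  integral_nonneg fun x => mul_nonneg (S.nonneg x) (by positivity)

theorem integral_sq (f : Lp ℝ 2 τ) : ∫ x, f x ^ 2 ∂τ = ‖f‖ ^ 2 := by
  rw [← real_inner_self_eq_norm_sq, L2.inner_def]
  exact integral_congr_ae (Eventually.of_forall fun x => by simp [sq])

theorem integrable_sq (f : Lp ℝ 2 τ) : Integrable (fun x => f x ^ 2) τ :=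
  (memLp_two_iff_integrable_sq (Lp.memLp f).1).1 (Lp.memLp f)

/-- The Taylor remainder is bounded by a multiple of θ(|v|+|h|)^(p-2) h², and `weight_bound` turns
the first factors into a constant. The error is therefore O(‖h‖²). -/
theorem hasFDerivAt_powInt (S : IsSubcritical ι D θ p C) (v : X) :
    HasFDerivAt (powInt ι θ p) (p • S.nonlin v) v := by
  have hp := S.two_lt
  rw [hasFDerivAt_iff_isLittleO_nhds_zero]
  have hbig : (fun h => powInt ι θ p (v + h) - powInt ι θ p v - (p • S.nonlin v) h) =O[𝓝 0]
      fun h => ‖h‖ ^ 2 := by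
    refine Asymptotics.IsBigO.of_bound
      (p * (p - 1) * (|C| * (‖v‖ + 1) ^ (p - 2)) * ‖ι‖ ^ 2) ?_
    filter_upwards [Metric.ball_mem_nhds (0 : X) one_pos] with h hh
    have hh1 : ‖h‖ ≤ 1 := by simpa using (Metric.mem_ball.1 hh).le
    have e : powInt ι θ p (v + h) - powInt ι θ p v - (p • S.nonlin v) h =
        ∫ x, (θ x * |ι (v + h) x| ^ p - θ x * |ι v x| ^ p -
          p * (θ x * sgnPow p (ι v x) * ι h x)) ∂τ := by
      rw [integral_sub (S.integrable_pow_sub _ _)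
        ((S.integrable_nonlin v h).const_mul p), integral_sub (S.integrable_pow _)
        (S.integrable_pow _), integral_const_mul, ← S.nonlin_apply]
      rfl
    rw [e]
    have hadd : ι (v + h) =ᵐ[τ] fun x => ι v x + ι h x := by
      rw [map_add]; exact Lp.coeFn_add _ _
    have hw : ∀ᵐ x ∂τ, |(|ι v x| + |ι h x|)| ≤ D x * (‖v‖ + ‖h‖) := by
      filter_upwards [S.bound v, S.bound h] with x h1 h2
      rw [abs_of_nonneg (by positivity), mul_add]; linarith
    have hle : ‖∫ x, (θ x * |ι (v + h) x| ^ p - θ x * |ι v x| ^ p -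
        p * (θ x * sgnPow p (ι v x) * ι h x)) ∂τ‖ ≤
        ∫ x, p * (p - 1) * (|C| * (‖v‖ + 1) ^ (p - 2)) * (ι h x) ^ 2 ∂τ := by
      refine norm_integral_le_of_norm_le ((integrable_sq (ι h)).const_mul _) ?_
      filter_upwards [hadd, S.weight_bound (by positivity) hw] with x h1 h2
      rw [h1, Real.norm_eq_abs]
      have h3 := abs_rpow_taylor hp (ι v x) (ι h x)
      have e2 : θ x * |ι v x + ι h x| ^ p - θ x * |ι v x| ^ p -
          p * (θ x * sgnPow p (ι v x) * ι h x) =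
          θ x * (|ι v x + ι h x| ^ p - |ι v x| ^ p - p * sgnPow p (ι v x) * ι h x) := by ring
      rw [e2, abs_mul, abs_of_nonneg (S.nonneg x)]
      have hpp : 0 ≤ p * (p - 1) := mul_nonneg (by linarith) (by linarith)
      rw [abs_of_nonneg (by positivity : 0 ≤ |ι v x| + |ι h x|)] at h2
      have h4 : C * (‖v‖ + ‖h‖) ^ (p - 2) ≤ |C| * (‖v‖ + 1) ^ (p - 2) := by
        refine mul_le_mul (le_abs_self _) ?_ (by positivity) (abs_nonneg _)
        exact Real.rpow_le_rpow (by positivity) (by linarith) (by linarith)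
      calc θ x * |(|ι v x + ι h x| ^ p - |ι v x| ^ p - p * sgnPow p (ι v x) * ι h x)|
          ≤ θ x * (p * (p - 1) * (|ι v x| + |ι h x|) ^ (p - 2) * (ι h x) ^ 2) :=
            mul_le_mul_of_nonneg_left h3 (S.nonneg x)
        _ = p * (p - 1) * (θ x * (|ι v x| + |ι h x|) ^ (p - 2)) * (ι h x) ^ 2 := by ring
        _ ≤ p * (p - 1) * (|C| * (‖v‖ + 1) ^ (p - 2)) * (ι h x) ^ 2 := by
            exact mul_le_mul_of_nonneg_right
              (mul_le_mul_of_nonneg_left (h2.trans h4) hpp) (sq_nonneg _)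
    refine hle.trans ?_
    rw [integral_const_mul, integral_sq, Real.norm_of_nonneg (by positivity)]
    have h5 : ‖ι h‖ ^ 2 ≤ ‖ι‖ ^ 2 * ‖h‖ ^ 2 := by
      rw [← mul_pow]; gcongr; exact ι.le_opNorm h
    have hpp : 0 ≤ p * (p - 1) := mul_nonneg (by linarith) (by linarith)
    calc _ ≤ p * (p - 1) * (|C| * (‖v‖ + 1) ^ (p - 2)) * (‖ι‖ ^ 2 * ‖h‖ ^ 2) := by gcongr
      _ = _ := by ring
  refine hbig.trans_isLittleO ?_
  have := (Asymptotics.isLittleO_norm_pow_id (E' := X) (n := 2) (by norm_num))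
  exact this

/-- Weak continuity of the derivative. -/
theorem tendsto_nonlin (S : IsSubcritical ι D θ p C) {u : ℕ → X} {v : X} {B : ℝ}
    (hB : ∀ n, ‖u n‖ ≤ B) (hlim : ∀ᵐ x ∂τ, Tendsto (fun n => ι (u n) x) atTop (𝓝 (ι v x))) (h : X) :
    Tendsto (fun n => S.nonlin (u n) h) atTop (𝓝 (S.nonlin v h)) := by
  have hp := S.two_lt
  have hB0 : 0 ≤ B := (norm_nonneg _).trans (hB 0)
  set f : ℕ → α → ℝ := fun n x => θ x * sgnPow p (ι (u n) x) - θ x * sgnPow p (ι v x) with hf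
  have hfL : ∀ n, MemLp (f n) 2 τ := fun n => (S.memLp_nonlin (u n)).sub (S.memLp_nonlin v)
  have hbd : ∀ w : X, ∫ x, (θ x * sgnPow p (ι w x)) ^ 2 ∂τ ≤
      (|C| * ‖w‖ ^ (p - 2) * (‖ι‖ * ‖w‖)) ^ 2 := by
    intro w
    calc _ ≤ ∫ x, (|C| * ‖w‖ ^ (p - 2)) ^ 2 * (ι w x) ^ 2 ∂τ := by
          refine integral_mono_ae ((memLp_two_iff_integrable_sq (S.memLp_nonlin w).1).1
            (S.memLp_nonlin w)) ((integrable_sq (ι w)).const_mul _) ?_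
          filter_upwards [S.weight_bound_self w] with x hx
          have h1 : θ x * |ι w x| ^ (p - 2) ≤ |C| * ‖w‖ ^ (p - 2) :=
            hx.trans (by gcongr; exact le_abs_self C)
          have h2 : 0 ≤ θ x * |ι w x| ^ (p - 2) := mul_nonneg (S.nonneg x) (by positivity)
          rw [sgnPow, ← mul_assoc, mul_pow]
          gcongr
      _ = (|C| * ‖w‖ ^ (p - 2)) ^ 2 * ‖ι w‖ ^ 2 := by rw [integral_const_mul, integral_sq]
      _ ≤ _ := by
          rw [← mul_pow]
          gcongr
          exact ι.le_opNorm w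
  have hfB : ∀ n, ∫ x, f n x ^ 2 ∂τ ≤ 2 * (|C| * B ^ (p - 2) * (‖ι‖ * B)) ^ 2 +
      2 * (|C| * ‖v‖ ^ (p - 2) * (‖ι‖ * ‖v‖)) ^ 2 := by
    intro n
    have i1 := (memLp_two_iff_integrable_sq (S.memLp_nonlin (u n)).1).1 (S.memLp_nonlin (u n))
    have i2 := (memLp_two_iff_integrable_sq (S.memLp_nonlin v).1).1 (S.memLp_nonlin v)
    calc _ ≤ ∫ x, (2 * (θ x * sgnPow p (ι (u n) x)) ^ 2 + 2 * (θ x * sgnPow p (ι v x)) ^ 2) ∂τ := by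
          refine integral_mono ((memLp_two_iff_integrable_sq (hfL n).1).1 (hfL n))
            ((i1.const_mul 2).add (i2.const_mul 2)) fun x => ?_
          simp only [hf]
          nlinarith [sq_nonneg (θ x * sgnPow p (ι (u n) x) + θ x * sgnPow p (ι v x))]
      _ = 2 * ∫ x, (θ x * sgnPow p (ι (u n) x)) ^ 2 ∂τ +
          2 * ∫ x, (θ x * sgnPow p (ι v x)) ^ 2 ∂τ := by
          rw [integral_add (i1.const_mul 2) (i2.const_mul 2), integral_const_mul,
            integral_const_mul]
      _ ≤ _ := by
          have h1 := hbd (u n)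
          have h2 : |C| * ‖u n‖ ^ (p - 2) * (‖ι‖ * ‖u n‖) ≤ |C| * B ^ (p - 2) * (‖ι‖ * B) := by
            have h3 := Real.rpow_le_rpow (norm_nonneg _) (hB n) (by linarith : 0 ≤ p - 2)
            have h4 := hB n
            gcongr
          have h3 := pow_le_pow_left₀ (by positivity) h2 2
          linarith [hbd v]
  have hf0 : ∀ᵐ x ∂τ, Tendsto (fun n => f n x) atTop (𝓝 0) := by
    filter_upwards [hlim] with x hx
    have h1 := ((((continuous_sgnPow hp).tendsto _).comp hx).const_mul (θ x)).sub_const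
      (θ x * sgnPow p (ι v x))
    simpa using h1
  -- The differences of the nonlinear terms are bounded in L² and tend to zero almost everywhere,
  -- hence weakly.
  have key := tendsto_integral_abs_mul hfL (Lp.memLp (ι h)) hfB hf0
  rw [tendsto_iff_dist_tendsto_zero]
  refine squeeze_zero (fun n => dist_nonneg) (fun n => ?_) key
  rw [Real.dist_eq, S.nonlin_apply, S.nonlin_apply,
    ← integral_sub (S.integrable_nonlin _ _) (S.integrable_nonlin _ _)]
  refine (abs_integral_le_integral_abs).trans (le_of_eq ?_)
  refine integral_congr_ae (Eventually.of_forall fun x => ?_)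
  simp only [hf]
  rw [← sub_mul, abs_mul]

/-- The Brezis–Lieb lemma. -/
theorem brezisLieb (S : IsSubcritical ι D θ p C) {u : ℕ → X} {v : X} {B : ℝ}
    (hB : ∀ n, ‖u n‖ ≤ B) (hlim : ∀ᵐ x ∂τ, Tendsto (fun n => ι (u n) x) atTop (𝓝 (ι v x))) :
    Tendsto (fun n => powInt ι θ p (u n) - powInt ι θ p v - powInt ι θ p (u n - v)) atTop
      (𝓝 0) := by
  have hp := S.two_lt
  have hB0 : 0 ≤ B := (norm_nonneg _).trans (hB 0)
  have hwn : ∀ n, ‖u n - v‖ ≤ B + ‖v‖ := fun n => (norm_sub_le _ _).trans (by linarith [hB n])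
  have hsub : ∀ n, ι (u n - v) =ᵐ[τ] fun x => ι (u n) x - ι v x := fun n => by
    rw [map_sub]; exact Lp.coeFn_sub _ _
  have hw0 : ∀ᵐ x ∂τ, Tendsto (fun n => ι (u n - v) x) atTop (𝓝 0) := by
    filter_upwards [hlim, ae_all_iff.2 hsub] with x hx h1
    simp only [h1]
    simpa using hx.sub_const (ι v x)
  have hwB : ∀ n, ∫ x, (ι (u n - v) x) ^ 2 ∂τ ≤ (‖ι‖ * (B + ‖v‖)) ^ 2 := fun n => by
    rw [integral_sq]
    gcongr
    exact (ι.le_opNorm _).trans (by gcongr; exact hwn n)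
  have key := tendsto_integral_abs_mul (fun n => Lp.memLp (ι (u n - v))) (Lp.memLp (ι v)) hwB hw0
  -- A absorbs θ|v|^(p-2) and θ|u_n - v|^(p-2). What remains is the integral of |u_n - v||v|, which
  -- tends to zero.
  set A : ℝ := (p * (2 ^ (p - 2) * 2) + 1) * (|C| * ‖v‖ ^ (p - 2) + |C| * (B + ‖v‖) ^ (p - 2))
    with hA
  have key2 := key.const_mul A
  rw [mul_zero] at key2
  refine squeeze_zero_norm (fun n => ?_) key2
  rw [powInt, powInt, powInt, ← integral_sub (S.integrable_pow _) (S.integrable_pow _),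
    ← integral_sub (S.integrable_pow_sub _ _) (S.integrable_pow _),
    ← integral_const_mul]
  have hi : Integrable (fun x => |ι (u n - v) x| * |ι v x|) τ := by
    refine ((Lp.memLp (ι (u n - v))).integrable_mul (Lp.memLp (ι v))).abs.congr
      (Eventually.of_forall fun x => ?_)
    simp [abs_mul]
  refine norm_integral_le_of_norm_le (hi.const_mul A) ?_
  filter_upwards [hsub n, S.weight_bound_self v, S.weight_bound_self (u n - v)] with x h1 h2 h3
  have e : ι (u n) x = ι v x + ι (u n - v) x := by rw [h1]; ring
  set s := ι v x
  set t := ι (u n - v) x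
  rw [e]
  have h4 := abs_rpow_brezisLieb hp s t
  rw [← mul_sub, ← mul_sub, Real.norm_eq_abs, abs_mul, abs_of_nonneg (S.nonneg x)]
  have h5 : θ x * |s| ^ (p - 2) ≤ |C| * ‖v‖ ^ (p - 2) :=
    h2.trans (by gcongr; exact le_abs_self C)
  have h6 : θ x * |t| ^ (p - 2) ≤ |C| * (B + ‖v‖) ^ (p - 2) := by
    refine h3.trans (mul_le_mul (le_abs_self C) ?_ (by positivity) (abs_nonneg _))
    exact Real.rpow_le_rpow (norm_nonneg _) (hwn n) (by linarith)
  calc _ ≤ θ x * ((p * (2 ^ (p - 2) * 2) + 1) *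
        ((|s| ^ (p - 2) + |t| ^ (p - 2)) * (|s| * |t|))) :=
        mul_le_mul_of_nonneg_left h4 (S.nonneg x)
    _ = (p * (2 ^ (p - 2) * 2) + 1) * (θ x * |s| ^ (p - 2) + θ x * |t| ^ (p - 2)) *
        (|t| * |s|) := by ring
    _ ≤ A * (|t| * |s|) := by
        rw [hA]
        gcongr

/-- Compactness: if `θ D^{p-2}` is small off sets of finite measure on which `D` is bounded, then
`∫ θ |v_n|^p → 0` for bounded sequences tending to zero almost everywhere. -/
theorem tendsto_powInt_zero (S : IsSubcritical ι D θ p C)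
    (hA : ∀ ε > 0, ∃ A : Set α, MeasurableSet A ∧ τ A < ⊤ ∧ (∃ M, ∀ x ∈ A, D x ≤ M) ∧
      ∀ᵐ x ∂τ, x ∉ A → θ x * D x ^ (p - 2) ≤ ε)
    {v : ℕ → X} {B : ℝ} (hB : ∀ n, ‖v n‖ ≤ B)
    (hlim : ∀ᵐ x ∂τ, Tendsto (fun n => ι (v n) x) atTop (𝓝 0)) :
    Tendsto (fun n => powInt ι θ p (v n)) atTop (𝓝 0) := by
  have hp := S.two_lt
  have hB0 : 0 ≤ B := (norm_nonneg _).trans (hB 0)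
  rw [Metric.tendsto_atTop]
  intro ε hε
  -- Off the chosen set the integral is at most ε/(2Q) · B^(p-2)(‖ι‖B)²; the added 1 makes Q
  -- positive and the final inequality strict. On the set itself dominated convergence applies, its
  -- measure being finite and D bounded there.
  set Q : ℝ := B ^ (p - 2) * (‖ι‖ * B) ^ 2 + 1 with hQ
  have hQ0 : 0 < Q := by positivity
  obtain ⟨A, hAm, hAf, ⟨M, hM⟩, hAs⟩ := hA (ε / (2 * Q)) (by positivity)
  have hlimA : Tendsto (fun n => ∫ x in A, θ x * |ι (v n) x| ^ p ∂τ) atTop (𝓝 0) := by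
    have := tendsto_integral_of_dominated_convergence (f := fun _ => (0 : ℝ))
      (F := fun n x => θ x * |ι (v n) x| ^ p) (μ := τ.restrict A)
      (fun x => |C| * B ^ (p - 2) * (|M| * B) ^ 2)
      (fun n => (S.integrable_pow _).1.restrict) ?_ (fun n => ?_) ?_
    · simpa using this
    · have : IsFiniteMeasure (τ.restrict A) := ⟨by simpa using hAf⟩
      exact integrable_const _
    · filter_upwards [ae_restrict_mem hAm, ae_restrict_of_ae (S.weight_bound_self (v n)),
        ae_restrict_of_ae (S.bound (v n))] with x h1 h2 h3
      rw [Real.norm_of_nonneg (mul_nonneg (S.nonneg x) (by positivity)), abs_rpow_eq hp, ← mul_assoc]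
      refine mul_le_mul (h2.trans ?_) ?_ (sq_nonneg _) (by positivity)
      · refine mul_le_mul (le_abs_self C) ?_ (by positivity) (abs_nonneg _)
        exact Real.rpow_le_rpow (norm_nonneg _) (hB n) (by linarith)
      · rw [← sq_abs]
        have : D x ≤ |M| := (hM x h1).trans (le_abs_self _)
        exact pow_le_pow_left₀ (abs_nonneg _)
          (h3.trans (mul_le_mul this (hB n) (norm_nonneg _) (abs_nonneg _))) 2
    · refine ae_restrict_of_ae ?_
      filter_upwards [hlim] with x hx
      have h1 : Tendsto (fun n => |ι (v n) x| ^ p) atTop (𝓝 (|(0 : ℝ)| ^ p)) :=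
        hx.abs.rpow_const (Or.inr (by linarith))
      rw [abs_zero, Real.zero_rpow (by linarith)] at h1
      simpa using h1.const_mul (θ x)
  obtain ⟨n₀, hn₀⟩ := (hlimA.eventually_lt_const (half_pos hε)).exists_forall_of_atTop
  refine ⟨n₀, fun n hn => ?_⟩
  rw [Real.dist_0_eq_abs, abs_of_nonneg (S.powInt_nonneg _), powInt,
    ← integral_add_compl hAm (S.integrable_pow _)]
  have h1 : ∫ x in Aᶜ, θ x * |ι (v n) x| ^ p ∂τ ≤ ε / (2 * Q) * (B ^ (p - 2) * (‖ι‖ * B) ^ 2) := by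
    calc _ ≤ ∫ x in Aᶜ, ε / (2 * Q) * B ^ (p - 2) * (ι (v n) x) ^ 2 ∂τ := by
          refine setIntegral_mono_ae_restrict (S.integrable_pow _).integrableOn
            ((integrable_sq _).const_mul _).integrableOn ?_
          filter_upwards [ae_restrict_mem hAm.compl, ae_restrict_of_ae hAs,
            ae_restrict_of_ae (S.bound (v n))] with x h1 h2 h3
          rw [abs_rpow_eq hp, ← mul_assoc]
          refine mul_le_mul_of_nonneg_right ?_ (sq_nonneg _)
          calc θ x * |ι (v n) x| ^ (p - 2) ≤ θ x * (D x * B) ^ (p - 2) := by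
                refine mul_le_mul_of_nonneg_left (Real.rpow_le_rpow (abs_nonneg _) ?_
                  (by linarith)) (S.nonneg x)
                exact h3.trans (mul_le_mul_of_nonneg_left (hB n) (S.D_nonneg x))
            _ = θ x * D x ^ (p - 2) * B ^ (p - 2) := by
                rw [Real.mul_rpow (S.D_nonneg x) hB0]; ring
            _ ≤ _ := mul_le_mul_of_nonneg_right (h2 h1) (by positivity)
      _ ≤ ∫ x, ε / (2 * Q) * B ^ (p - 2) * (ι (v n) x) ^ 2 ∂τ :=
          setIntegral_le_integral ((integrable_sq _).const_mul _)
            (Eventually.of_forall fun x => by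
              have : 0 ≤ ε / (2 * Q) * B ^ (p - 2) := by positivity
              exact mul_nonneg this (sq_nonneg _))
      _ = ε / (2 * Q) * B ^ (p - 2) * ‖ι (v n)‖ ^ 2 := by rw [integral_const_mul, integral_sq]
      _ ≤ ε / (2 * Q) * B ^ (p - 2) * (‖ι‖ * B) ^ 2 := by
          gcongr
          exact (ι.le_opNorm _).trans (by gcongr; exact hB n)
      _ = _ := by ring
  have h2 : ε / (2 * Q) * (B ^ (p - 2) * (‖ι‖ * B) ^ 2) < ε / 2 := by
    calc _ < ε / (2 * Q) * Q := by gcongr; rw [hQ]; linarith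
      _ = ε / 2 := by field_simp
  linarith [hn₀ n hn]

end IsSubcritical

end Abstract

/-- The standing assumptions on `N`, `a`, `b`. -/
structure Admissible (N : ℕ) (a b : ℝ) : Prop where
  hN : 2 < N
  ha : 0 < a
  ha' : a < ((N : ℝ) - 2) / 2
  hab : a < b
  hba : b < a + 1

/-! ### The weights of the problem relative to the Hardy measure. -/

section Hardy

variable {N : ℕ} {a b : ℝ}

theorem Admissible.denom_pos (h : Admissible N a b) : 0 < (N : ℝ) - 2 * dExp a b := by
  have h1 := h.ha'; have h2 := h.hab; have h3 := h.hba; have h4 := h.ha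
  simp only [dExp]
  have : (2 : ℝ) < N := by exact_mod_cast h.hN
  linarith

theorem Admissible.dExp_pos (h : Admissible N a b) : 0 < dExp a b := by
  have := h.hba
  simp only [dExp]; linarith

theorem Admissible.two_lt_critExp (h : Admissible N a b) : 2 < critExp N a b := by
  have h1 := h.denom_pos
  have h2 := h.dExp_pos
  rw [critExp, lt_div_iff₀ h1]
  linarith

/-- The decay rate of radial functions. -/
noncomputable def decay (N : ℕ) (a : ℝ) : ℝ := ((N : ℝ) - 2 - 2 * a) / 2

/-- The homogeneity of the weight `|x|^{-bp} |x|^{-(p-2)σ}`, with `σ` the decay rate. -/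
noncomputable def weightExp (N : ℕ) (a b p : ℝ) : ℝ := b * p + decay N a * (p - 2)

theorem Admissible.decay_pos (h : Admissible N a b) : 0 < decay N a := by
  have := h.ha'
  simp only [decay]; linarith

theorem Admissible.lt_weightExp (h : Admissible N a b) {p : ℝ} (hp : 2 < p) :
    2 * a < weightExp N a b p := by
  have h1 := h.decay_pos
  have h2 := h.hab
  have h3 := h.ha
  rw [weightExp]
  nlinarith [mul_pos h1 (sub_pos.2 hp)]

/-- This is where criticality enters: once the radial decay is inserted, the power 2^♯ carries
exactly the Hardy weight |x|^(-2a-2). -/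
theorem Admissible.weightExp_critExp (h : Admissible N a b) :
    weightExp N a b (critExp N a b) = 2 * a + 2 := by
  have h1 := h.denom_pos
  simp only [dExp] at h1
  rw [weightExp, critExp, decay, dExp]
  field_simp
  ring

theorem Admissible.weightExp_strictMono (h : Admissible N a b) {p q : ℝ} (hpq : p < q) :
    weightExp N a b p < weightExp N a b q := by
  have h1 := h.decay_pos
  have h2 : 0 < b := h.ha.trans h.hab
  simp only [weightExp]
  nlinarith

/-- The density `|x|^{-2a} + |x|^{-2a-2}`. -/
noncomputable def hardyWeight (a : ℝ) (x : EuclideanSpace ℝ (Fin N)) : ℝ :=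
  ‖x‖ ^ (-2 * a) + ‖x‖ ^ (-2 * (a + 1))

/-- The measure `(|x|^{-2a} + |x|^{-2a-2}) dx`. -/
noncomputable def hardyMeasure (N : ℕ) (a : ℝ) : Measure (EuclideanSpace ℝ (Fin N)) :=
  volume.withDensity fun x => ENNReal.ofReal (hardyWeight a x)

theorem measurable_hardyWeight : Measurable (hardyWeight (N := N) a) :=
  (measurable_norm_rpow _).add (measurable_norm_rpow _)

theorem hardyWeight_nonneg (x : EuclideanSpace ℝ (Fin N)) : 0 ≤ hardyWeight a x := by
  unfold hardyWeight; positivity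

theorem hardyWeight_pos {x : EuclideanSpace ℝ (Fin N)} (hx : x ≠ 0) : 0 < hardyWeight a x := by
  have : 0 < ‖x‖ := norm_pos_iff.2 hx
  unfold hardyWeight; positivity

theorem ae_hardyMeasure (hN : 2 < N) : ae (hardyMeasure N a) = ae volume := by
  refine le_antisymm (withDensity_absolutelyContinuous _ _).ae_le ?_
  refine (withDensity_absolutelyContinuous' ?_ ?_).ae_le
  · exact measurable_hardyWeight.ennreal_ofReal.aemeasurable
  · filter_upwards [ae_ne_zero hN] with x hx
    simp only [ne_eq, ENNReal.ofReal_eq_zero, not_le]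
    exact hardyWeight_pos hx

theorem integral_hardyMeasure (f : EuclideanSpace ℝ (Fin N) → ℝ) :
    ∫ x, f x ∂(hardyMeasure N a) = ∫ x, hardyWeight a x * f x := by
  rw [hardyMeasure, integral_withDensity_eq_integral_toReal_smul
    measurable_hardyWeight.ennreal_ofReal (by simp)]
  refine integral_congr_ae (Eventually.of_forall fun x => ?_)
  simp only
  rw [ENNReal.toReal_ofReal (hardyWeight_nonneg x), smul_eq_mul]

theorem integrable_hardyMeasure (f : EuclideanSpace ℝ (Fin N) → ℝ) :
    Integrable f (hardyMeasure N a) ↔ Integrable (fun x => hardyWeight a x * f x) := by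
  rw [hardyMeasure, integrable_withDensity_iff_integrable_smul'
    measurable_hardyWeight.ennreal_ofReal (by simp)]
  refine integrable_congr (Eventually.of_forall fun x => ?_)
  simp only
  rw [ENNReal.toReal_ofReal (hardyWeight_nonneg x), smul_eq_mul]

theorem integrable_fn_sq (w : Ambient N a) : Integrable (fun x => ‖x‖ ^ (-2 * a) * w.fn x ^ 2) := by
  have h := (memLp_two_iff_integrable_sq (Lp.memLp w.fst).1).1 (Lp.memLp w.fst)
  exact (integrable_wMeasure a _).1 h

theorem memLp_hardyMeasure (h : Admissible N a b) {w : Ambient N a} (hw : w ∈ energySpace N a) :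
    MemLp w.fn 2 (hardyMeasure N a) := by
  have hD : IsD a w.fn w.grad := hw
  have hm : AEStronglyMeasurable w.fn (hardyMeasure N a) := by
    obtain ⟨g, hg, h'⟩ := hD.aestronglyMeasurable h.hN
    exact ⟨g, hg, by rwa [EventuallyEq, ae_hardyMeasure h.hN]⟩
  rw [memLp_two_iff_integrable_sq hm, integrable_hardyMeasure]
  refine ((integrable_fn_sq w).add (hardy_integral h.hN h.ha h.ha' hw).1).congr
    (Eventually.of_forall fun x => ?_)
  simp only [Pi.add_apply, hardyWeight]; ring

theorem integral_sq_hardyMeasure (h : Admissible N a b) {w : Ambient N a}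
    (hw : w ∈ energySpace N a) : ∫ x, w.fn x ^ 2 ∂(hardyMeasure N a) =
      ‖w.fst‖ ^ 2 + ∫ x, ‖x‖ ^ (-2 * (a + 1)) * w.fn x ^ 2 := by
  rw [integral_hardyMeasure, ← integral_fn_sq_eq_norm_sq, ← integral_add (integrable_fn_sq w)
    (hardy_integral h.hN h.ha h.ha' hw).1]
  refine integral_congr_ae (Eventually.of_forall fun x => ?_)
  simp only [hardyWeight]; ring

/-- The Hardy constant. -/
noncomputable def hardyConst (N : ℕ) (a : ℝ) : ℝ := 2 / ((N : ℝ) - 2 * a - 2)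

/-- The embedding of the energy space into `L²(hardyMeasure)`. -/
noncomputable def hardyEmb (h : Admissible N a b) :
    energySpace N a →L[ℝ] Lp ℝ 2 (hardyMeasure N a) :=
  LinearMap.mkContinuous
    { toFun := fun w => (memLp_hardyMeasure h w.2).toLp w.1.fn
      map_add' := fun v w => by
        rw [← MemLp.toLp_add]
        refine (MemLp.toLp_eq_toLp_iff _ _).2 ?_
        have := Lp.coeFn_add v.1.fst w.1.fst
        rw [EventuallyEq, ae_wMeasure h.hN] at this
        rw [EventuallyEq, ae_hardyMeasure h.hN]
        exact this
      map_smul' := fun c w => by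
        rw [RingHom.id_apply, ← MemLp.toLp_const_smul]
        refine (MemLp.toLp_eq_toLp_iff _ _).2 ?_
        have := Lp.coeFn_smul c w.1.fst
        rw [EventuallyEq, ae_wMeasure h.hN] at this
        rw [EventuallyEq, ae_hardyMeasure h.hN]
        exact this }
    (1 + hardyConst N a) (fun w => by
      have h1 : ‖(memLp_hardyMeasure h w.2).toLp w.1.fn‖ ^ 2 =
          ∫ x, w.1.fn x ^ 2 ∂(hardyMeasure N a) := by
        rw [← IsSubcritical.integral_sq]
        refine integral_congr_ae ?_
        filter_upwards [(memLp_hardyMeasure h w.2).coeFn_toLp] with x hx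
        rw [hx]
      have hc : 0 < hardyConst N a := by
        have := h.ha'
        have : 0 < (N : ℝ) - 2 * a - 2 := by linarith
        unfold hardyConst; positivity
      refine le_of_sq_le_sq ?_ (by positivity)
      change ‖(memLp_hardyMeasure h w.2).toLp w.1.fn‖ ^ 2 ≤ _
      rw [h1, integral_sq_hardyMeasure h w.2]
      have h2 := (hardy_integral h.hN h.ha h.ha' w.2).2
      change _ ≤ hardyConst N a ^ 2 * _ at h2
      have h3 : ‖w‖ ^ 2 = ‖w.1.fst‖ ^ 2 + ‖w.1.snd‖ ^ 2 := norm_sq_eq w.1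
      rw [mul_pow, h3]
      nlinarith [sq_nonneg ‖w.1.fst‖, sq_nonneg ‖w.1.snd‖,
        mul_nonneg hc.le (sq_nonneg ‖w.1.fst‖), mul_nonneg hc.le (sq_nonneg ‖w.1.snd‖),
        mul_nonneg (sq_nonneg (hardyConst N a)) (sq_nonneg ‖w.1.fst‖)])

theorem hardyEmb_coeFn (h : Admissible N a b) (w : energySpace N a) :
    hardyEmb h w =ᵐ[volume] w.1.fn := by
  have := (memLp_hardyMeasure h w.2).coeFn_toLp
  rwa [EventuallyEq, ae_hardyMeasure h.hN] at this

/-- The embedding of the radial energy space into `L²(hardyMeasure)`. -/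
noncomputable def radEmb (h : Admissible N a b) : X N a →L[ℝ] Lp ℝ 2 (hardyMeasure N a) :=
  (hardyEmb h).comp
    { toLinearMap := Submodule.inclusion inf_le_left
      cont := continuous_inclusion inf_le_left }

theorem radEmb_coeFn (h : Admissible N a b) (w : X N a) : radEmb h w =ᵐ[volume] w.1.fn :=
  hardyEmb_coeFn h ⟨w.1, w.2.1⟩

/-- The weight `|x|^{-bp}`, relative to `hardyMeasure`. -/
noncomputable def relWeight (a b p : ℝ) (x : EuclideanSpace ℝ (Fin N)) : ℝ :=
  ‖x‖ ^ (-b * p) / hardyWeight a x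

theorem integral_relWeight (hN : 2 < N) (p : ℝ) {f g : EuclideanSpace ℝ (Fin N) → ℝ}
    (hfg : f =ᵐ[volume] g) :
    ∫ x, relWeight a b p x * f x ∂(hardyMeasure N a) = ∫ x, ‖x‖ ^ (-b * p) * g x := by
  rw [integral_hardyMeasure]
  refine integral_congr_ae ?_
  filter_upwards [ae_ne_zero hN, hfg] with x hx h1
  have := (hardyWeight_pos (a := a) hx).ne'
  rw [h1, relWeight]
  field_simp

theorem powInt_radEmb (h : Admissible N a b) (p : ℝ) (w : X N a) :
    powInt (radEmb h) (relWeight a b p) p w = wPow b p w.1.fn := by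
  refine integral_relWeight h.hN p ?_
  filter_upwards [radEmb_coeFn h w] with x hx
  rw [hx]

/-- Compare exponents for r ≥ 1 and r ≤ 1 separately; each summand takes care of one range. -/
theorem rpow_neg_weightExp_le {r e : ℝ} (hr : 0 < r) (h1 : 2 * a ≤ e) (h2 : e ≤ 2 * a + 2) :
    r ^ (-e) ≤ r ^ (-2 * a) + r ^ (-2 * (a + 1)) := by
  have p1 : 0 < r ^ (-2 * a) := by positivity
  have p2 : 0 < r ^ (-2 * (a + 1)) := by positivity
  rcases le_total 1 r with h | h
  · have := Real.rpow_le_rpow_of_exponent_le h (show -e ≤ -2 * a by linarith)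
    linarith
  · have := Real.rpow_le_rpow_of_exponent_ge hr h (show -2 * (a + 1) ≤ -e by linarith)
    linarith

theorem relWeight_mul_decay {K p : ℝ} (hK : 0 < K) {x : EuclideanSpace ℝ (Fin N)} (hx : x ≠ 0) :
    relWeight a b p x * (K * ‖x‖ ^ (-decay N a)) ^ (p - 2) =
      K ^ (p - 2) * (‖x‖ ^ (-weightExp N a b p) / hardyWeight a x) := by
  have hx' : 0 < ‖x‖ := norm_pos_iff.2 hx
  rw [Real.mul_rpow hK.le (by positivity), ← Real.rpow_mul hx'.le, relWeight]
  have : ‖x‖ ^ (-weightExp N a b p) = ‖x‖ ^ (-b * p) * ‖x‖ ^ (-decay N a * (p - 2)) := by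
    rw [← Real.rpow_add hx']; congr 1; rw [weightExp]; ring
  rw [this]; ring

/-- Radial decay supplies the pointwise bound, and the weight condition reduces to 2a ≤ e ≤ 2a+2 for
e given by `weightExp`. The endpoint p = 2^♯ is included, so the Brezis–Lieb splitting and weak
continuity also cover the critical term. -/
theorem exists_isSubcritical (h : Admissible N a b) :
    ∃ (K : ℝ) (ev : ℝ → X N a →L[ℝ] ℝ), 0 < K ∧
      (∀ w : X N a, ∀ᵐ x : EuclideanSpace ℝ (Fin N), w.1.fn x = ev ‖x‖ w) ∧
      (∀ r, 0 < r → ∀ w : X N a, |ev r w| ≤ K * r ^ (-decay N a) * ‖w.1.snd‖) ∧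
      ∀ p, 2 < p → p ≤ critExp N a b →
        IsSubcritical (radEmb h) (fun x => K * ‖x‖ ^ (-decay N a)) (relWeight a b p) p
          (K ^ (p - 2)) := by
  obtain ⟨K, ev, hK, h1, h2⟩ := exists_eval (a := a) h.hN h.ha h.ha'
  refine ⟨K, ev, hK, h1, h2, fun p hp hp' => ⟨hp, fun x => by positivity, fun w => ?_, ?_,
    fun x => div_nonneg (by positivity) (hardyWeight_nonneg x), ?_⟩⟩
  · rw [ae_hardyMeasure h.hN]
    filter_upwards [radEmb_coeFn h w, h1 w, ae_ne_zero h.hN] with x h3 h4 h5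
    rw [h3, h4]
    refine (h2 _ (norm_pos_iff.2 h5) w).trans ?_
    exact mul_le_mul_of_nonneg_left (norm_snd_le w.1) (by positivity)
  · exact (measurable_norm_rpow _).div measurable_hardyWeight
  · rw [ae_hardyMeasure h.hN]
    filter_upwards [ae_ne_zero h.hN] with x hx
    have hx' : 0 < ‖x‖ := norm_pos_iff.2 hx
    rw [relWeight_mul_decay hK hx]
    refine mul_le_of_le_one_right (by positivity) ?_
    rw [div_le_one (hardyWeight_pos hx)]
    refine rpow_neg_weightExp_le hx' (h.lt_weightExp hp).le ?_
    rw [← h.weightExp_critExp]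
    rcases hp'.eq_or_lt with h3 | h3
    · rw [h3]
    · exact (h.weightExp_strictMono h3).le

theorem hardyMeasure_annulus_lt_top {δ R : ℝ} (hδ : 0 < δ) :
    hardyMeasure N a {x | δ ≤ ‖x‖ ∧ ‖x‖ ≤ R} < ⊤ := by
  have hset : {x : EuclideanSpace ℝ (Fin N) | δ ≤ ‖x‖ ∧ ‖x‖ ≤ R} =
      Metric.closedBall 0 R ∩ (Metric.ball 0 δ)ᶜ := by
    ext x; simp [and_comm]
  have hcpt : IsCompact {x : EuclideanSpace ℝ (Fin N) | δ ≤ ‖x‖ ∧ ‖x‖ ≤ R} := by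
    rw [hset]
    exact (isCompact_closedBall _ _).inter_right Metric.isOpen_ball.isClosed_compl
  have hcont : ContinuousOn (hardyWeight (N := N) a) {x | δ ≤ ‖x‖ ∧ ‖x‖ ≤ R} := by
    intro x hx
    have : ‖x‖ ≠ 0 := (lt_of_lt_of_le hδ hx.1).ne'
    exact ((continuous_norm.continuousAt.rpow_const (Or.inl this)).add
      (continuous_norm.continuousAt.rpow_const (Or.inl this))).continuousWithinAt
  rw [hardyMeasure, withDensity_apply _ hcpt.measurableSet]
  exact (hcont.integrableOn_compact hcpt).lintegral_lt_top

/-- For q < 2^♯ the exponent e is strictly between 2a and 2a+2, so |x|^(-e) is negligible against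
the Hardy density both near 0 and near infinity; A is the annulus in between. At 2^♯ the smallness
near 0 is lost. -/
theorem compactness_condition (h : Admissible N a b) {K q : ℝ} (hK : 0 < K) (hq : 2 < q)
    (hq' : q < critExp N a b) : ∀ ε > 0, ∃ A : Set (EuclideanSpace ℝ (Fin N)), MeasurableSet A ∧
      hardyMeasure N a A < ⊤ ∧ (∃ M, ∀ x ∈ A, K * ‖x‖ ^ (-decay N a) ≤ M) ∧
      ∀ᵐ x ∂(hardyMeasure N a), x ∉ A →
        relWeight a b q x * (K * ‖x‖ ^ (-decay N a)) ^ (q - 2) ≤ ε := by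
  intro ε hε
  set e := weightExp N a b q with he
  have he1 : 2 * a < e := h.lt_weightExp hq
  have he2 : e < 2 * a + 2 := by
    rw [← h.weightExp_critExp]; exact h.weightExp_strictMono hq'
  have hσ := h.decay_pos
  set η : ℝ := ε / K ^ (q - 2) with hη
  have hη0 : 0 < η := by positivity
  have t1 : Tendsto (fun r : ℝ => r ^ (-(e - 2 * a))) atTop (𝓝 0) :=
    tendsto_rpow_neg_atTop (by linarith)
  have t2 : Tendsto (fun r : ℝ => r ^ (2 * a + 2 - e)) (𝓝 0) (𝓝 0) := by
    have := (Real.continuous_rpow_const (q := 2 * a + 2 - e) (by linarith)).tendsto 0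
    rwa [Real.zero_rpow (by linarith)] at this
  obtain ⟨R, hR⟩ := (t1.eventually_lt_const hη0).exists_forall_of_atTop
  obtain ⟨δ, hδ, hball⟩ := Metric.eventually_nhds_iff_ball.1 (t2.eventually_lt_const hη0)
  refine ⟨{x | δ ≤ ‖x‖ ∧ ‖x‖ ≤ R}, ?_, hardyMeasure_annulus_lt_top hδ,
    ⟨K * δ ^ (-decay N a), fun x hx => ?_⟩, ?_⟩
  · exact (measurableSet_le measurable_const measurable_norm).inter
      (measurableSet_le measurable_norm measurable_const)
  · refine mul_le_mul_of_nonneg_left ?_ hK.le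
    exact Real.rpow_le_rpow_of_nonpos hδ hx.1 (by linarith)
  · rw [ae_hardyMeasure h.hN]
    filter_upwards [ae_ne_zero h.hN] with x hx hxA
    have hx' : 0 < ‖x‖ := norm_pos_iff.2 hx
    rw [relWeight_mul_decay hK hx]
    have key : ‖x‖ ^ (-e) / hardyWeight a x ≤ η := by
      rw [div_le_iff₀ (hardyWeight_pos hx), hardyWeight]
      have p1 : 0 < ‖x‖ ^ (-2 * a) := by positivity
      have p2 : 0 < ‖x‖ ^ (-2 * (a + 1)) := by positivity
      by_cases hc : δ ≤ ‖x‖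
      · have hxR : R ≤ ‖x‖ := by
          by_contra h5
          exact hxA ⟨hc, (not_le.1 h5).le⟩
        have h6 := (hR _ hxR).le
        have h7 : ‖x‖ ^ (-e) = ‖x‖ ^ (-(e - 2 * a)) * ‖x‖ ^ (-2 * a) := by
          rw [← Real.rpow_add hx']; congr 1; ring
        rw [h7]
        nlinarith
      · have h6 := (hball ‖x‖ (by
          rw [Metric.mem_ball, dist_zero_right, norm_norm]; exact not_le.1 hc)).le
        have h7 : ‖x‖ ^ (-e) = ‖x‖ ^ (2 * a + 2 - e) * ‖x‖ ^ (-2 * (a + 1)) := by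
          rw [← Real.rpow_add hx']; congr 1; ring
        rw [h7]
        nlinarith
    calc K ^ (q - 2) * (‖x‖ ^ (-e) / hardyWeight a x) ≤ K ^ (q - 2) * η := by gcongr
      _ = ε := by rw [hη]; field_simp

end Hardy

/-! ### One-dimensional integration lemmas. -/

section OneDim

/-- If `G' ` and `G / r` are integrable on `(0, ∞)` then `∫ G' = 0`. -/
theorem integral_Ioi_deriv_eq_zero {G G' : ℝ → ℝ} (hG : ∀ r, 0 < r → HasDerivAt G (G' r) r)
    (h1 : IntegrableOn G' (Set.Ioi 0)) (h2 : IntegrableOn (fun r => r⁻¹ * G r) (Set.Ioi 0)) :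
    ∫ r in Set.Ioi (0 : ℝ), G' r = 0 := by
  -- Under r = e^s the hypotheses say that s ↦ G(e^s) and its derivative are integrable on ℝ, so
  -- boundary values of G never have to be examined.
  have himg : Real.exp '' Set.univ = Set.Ioi 0 := by
    rw [Set.image_univ, Real.range_exp]
  have hd : ∀ x ∈ Set.univ, HasDerivWithinAt Real.exp (Real.exp x) Set.univ x := fun x _ =>
    (Real.hasDerivAt_exp x).hasDerivWithinAt
  have hinj : Set.InjOn Real.exp Set.univ := Real.exp_injective.injOn
  have i1 := (integrableOn_image_iff_integrableOn_abs_deriv_smul MeasurableSet.univ hd hinj G').1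
    (by rwa [himg])
  have i2 := (integrableOn_image_iff_integrableOn_abs_deriv_smul MeasurableSet.univ hd hinj
    (fun r => r⁻¹ * G r)).1 (by rwa [himg])
  have e := integral_image_eq_integral_abs_deriv_smul MeasurableSet.univ hd hinj G'
  rw [himg] at e
  rw [e, setIntegral_univ]
  rw [integrableOn_univ] at i1 i2
  have hder : ∀ x, HasDerivAt (fun s => G (Real.exp s)) (|Real.exp x| • G' (Real.exp x)) x := by
    intro x
    have := (hG _ (Real.exp_pos x)).comp x (Real.hasDerivAt_exp x)
    rw [abs_of_pos (Real.exp_pos x), smul_eq_mul, mul_comm]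
    exact this
  refine integral_eq_zero_of_hasDerivAt_of_integrable hder i1 (i2.congr ?_)
  refine Eventually.of_forall fun x => ?_
  have := Real.exp_pos x
  simp only [smul_eq_mul, abs_of_pos this]
  field_simp

theorem integrable_test_mul {F h : ℝ → ℝ} (hF : Continuous F) (hFs : HasCompactSupport F)
    (hF0 : tsupport F ⊆ Set.Ioi 0) (hh : LocallyIntegrableOn h (Set.Ioi 0)) :
    Integrable (fun r => F r * h r) := by
  have h1 := (hh.integrableOn_compact_subset hF0 hFs).continuousOn_mul hF.continuousOn hFs
  refine (integrableOn_iff_integrable_of_support_subset fun r hr => ?_).1 h1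
  exact subset_tsupport F fun hc => hr (by simp [hc])

theorem setIntegral_test_mul {F : ℝ → ℝ} (hF0 : tsupport F ⊆ Set.Ioi 0) (h : ℝ → ℝ) :
    ∫ r in Set.Ioi (0 : ℝ), F r * h r = ∫ r, F r * h r := by
  refine setIntegral_eq_integral_of_forall_compl_eq_zero fun r hr => ?_
  have : F r = 0 := by
    by_contra hc
    exact hr (hF0 (subset_tsupport F hc))
  simp [this]

/-- A primitive vanishing at the origin. -/
theorem primitive_properties {F : ℝ → ℝ} (hc : ContinuousOn F (Set.Ioi 0))
    (hi : ∀ R, IntegrableOn F (Set.Ioc 0 R)) :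
    (∀ r, 0 < r → HasDerivAt (fun r => ∫ t in (0 : ℝ)..r, F t) (F r) r) ∧
      Tendsto (fun r => ∫ t in (0 : ℝ)..r, F t) (𝓝[>] 0) (𝓝 0) := by
  have hint : ∀ r, 0 < r → IntervalIntegrable F volume 0 r := fun r hr => by
    rw [intervalIntegrable_iff_integrableOn_Ioc_of_le hr.le]; exact hi r
  constructor
  · intro r hr
    exact intervalIntegral.integral_hasDerivAt_right (hint r hr)
      (hc.stronglyMeasurableAtFilter isOpen_Ioi r hr) (hc.continuousAt (Ioi_mem_nhds hr))
  · have h1 := intervalIntegral.continuousOn_primitive_interval' (b₁ := 0) (b₂ := 1)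
      (hint 1 one_pos) Set.left_mem_uIcc
    have h2 : Tendsto (fun r => ∫ t in (0 : ℝ)..r, F t) (𝓝[Set.uIcc 0 1] 0)
        (𝓝 (∫ t in (0 : ℝ)..0, F t)) := h1 0 Set.left_mem_uIcc
    rw [intervalIntegral.integral_same] at h2
    refine h2.mono_left ?_
    rw [Set.uIcc_of_le zero_le_one]
    refine nhdsWithin_le_of_mem ?_
    exact mem_of_superset (Ioc_mem_nhdsGT one_pos) fun x hx => ⟨hx.1.le, hx.2⟩

theorem exists_tailInt_eq_zero {χ : ℝ → ℝ} (hχ : IsTest χ) :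
    ∃ R, 0 < R ∧ ∀ r, R ≤ r → tailInt χ r = 0 := by
  obtain ⟨R, hR⟩ := hχ.2.1.isCompact.isBounded.subset_closedBall 0
  refine ⟨max R 1, by positivity, fun r hr => ?_⟩
  rw [tailInt, neg_eq_zero, setIntegral_congr_fun (g := fun _ => (0 : ℝ)) measurableSet_Ioi
    fun t ht => ?_]
  · simp
  · by_contra h1
    have h2 := hR (subset_tsupport χ h1)
    simp only [Metric.mem_closedBall, dist_zero_right, Real.norm_eq_abs] at h2
    have h3 : r < t := ht
    linarith [le_abs_self t, le_max_left R 1]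

/-- Integration by parts against a test function on `(0, ∞)`. -/
theorem integral_mul_tailInt {F χ : ℝ → ℝ} (hc : ContinuousOn F (Set.Ioi 0))
    (hi : ∀ R, IntegrableOn F (Set.Ioc 0 R)) (hχ : IsTest χ) :
    ∫ r in Set.Ioi (0 : ℝ), F r * tailInt χ r =
      -∫ r in Set.Ioi (0 : ℝ), (∫ t in (0 : ℝ)..r, F t) * χ r := by
  obtain ⟨hd, h0⟩ := primitive_properties hc hi
  obtain ⟨hk, hkd⟩ := contDiff_tailInt hχ.1 hχ.2.1
  set M : ℝ → ℝ := fun r => ∫ t in (0 : ℝ)..r, F t with hM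
  have hMc : ContinuousOn M (Set.Ioi 0) := fun r hr => (hd r hr).continuousAt.continuousWithinAt
  obtain ⟨R, hR0, hR⟩ := exists_tailInt_eq_zero hχ
  have hiF : IntegrableOn (fun r => F r * tailInt χ r) (Set.Ioi 0) := by
    have h1 : IntegrableOn (fun r => F r * tailInt χ r) (Set.Icc 0 R) := by
      have : IntegrableOn F (Set.Icc 0 R) := by
        rw [integrableOn_Icc_iff_integrableOn_Ioc]; exact hi R
      exact this.mul_continuousOn hk.continuous.continuousOn isCompact_Icc
    refine IntegrableOn.of_forall_sdiff_eq_zero (s := Set.Ioc 0 R) (h1.mono_set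
      Set.Ioc_subset_Icc_self) measurableSet_Ioi fun r hr => ?_
    have h2 : R ≤ r := by
      by_contra h3
      exact hr.2 ⟨hr.1, (not_le.1 h3).le⟩
    simp [hR r h2]
  have hiM : IntegrableOn (fun r => M r * χ r) (Set.Ioi 0) := by
    have := integrable_test_mul hχ.1.continuous hχ.2.1 hχ.2.2
      (hMc.locallyIntegrableOn measurableSet_Ioi)
    exact (this.congr (Eventually.of_forall fun r => mul_comm _ _)).integrableOn
  have key := integral_Ioi_mul_deriv_eq_deriv_mul (a := 0) (a' := 0) (b' := 0) (u := M)
    (v := tailInt χ) (u' := F) (v' := χ) (fun r hr => hd r hr) (fun r _ => hkd r) hiM hiF ?_ ?_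
  · rw [key]; ring
  · have := h0.mul (hk.continuous.continuousWithinAt (s := Set.Ioi 0) (x := 0)).tendsto
    rw [zero_mul] at this; exact this
  · refine tendsto_const_nhds.congr' ?_
    filter_upwards [eventually_ge_atTop R] with r hr
    simp [hR r hr]

end OneDim

/-! ### The right-hand side of the equation and radial test elements. -/

section Source

variable {N : ℕ} {a b : ℝ}

/-- The right-hand side of the radial equation. -/
noncomputable def source (N : ℕ) (a b q β l : ℝ) (f : ℝ → ℝ) (r : ℝ) : ℝ :=
  l * (r ^ (-2 * a) * f r) + β * (r ^ (-b * q) * sgnPow q (f r)) +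
    r ^ (-b * critExp N a b) * sgnPow (critExp N a b) (f r)

theorem continuousOn_source {q β l : ℝ} {f : ℝ → ℝ} (hp : 2 < critExp N a b) (hq : 2 < q)
    (hf : ContinuousOn f (Set.Ioi 0)) : ContinuousOn (source N a b q β l f) (Set.Ioi 0) := by
  have h : ∀ s : ℝ, ContinuousOn (fun r : ℝ => r ^ s) (Set.Ioi 0) := fun s r (hr : 0 < r) =>
    (continuousAt_id.rpow_const (Or.inl hr.ne')).continuousWithinAt
  exact ((continuousOn_const.mul ((h _).mul hf)).add (continuousOn_const.mul
    ((h _).mul ((continuous_sgnPow hq).comp_continuousOn hf)))).add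
    ((h _).mul ((continuous_sgnPow hp).comp_continuousOn hf))

theorem integral_nonlin_energy (h : Admissible N a b) {D : EuclideanSpace ℝ (Fin N) → ℝ} {p C : ℝ}
    (S : IsSubcritical (radEmb h) D (relWeight a b p) p C) (w : X N a) (φ : energySpace N a) :
    Integrable (fun x => ‖x‖ ^ (-b * p) * (sgnPow p (w.1.fn x) * φ.1.fn x)) := by
  have h1 := (S.memLp_nonlin w).integrable_mul (Lp.memLp (hardyEmb h φ))
  rw [integrable_hardyMeasure] at h1
  refine h1.congr ?_
  filter_upwards [radEmb_coeFn h w, hardyEmb_coeFn h φ, ae_ne_zero h.hN] with x h2 h3 h4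
  have := (hardyWeight_pos (a := a) h4).ne'
  simp only [Pi.mul_apply]
  rw [h2, h3, relWeight]
  field_simp

theorem nonlin_eq_integral (h : Admissible N a b) {D : EuclideanSpace ℝ (Fin N) → ℝ} {p C : ℝ}
    (S : IsSubcritical (radEmb h) D (relWeight a b p) p C) (w ψ : X N a) :
    S.nonlin w ψ = ∫ x, ‖x‖ ^ (-b * p) * (sgnPow p (w.1.fn x) * ψ.1.fn x) := by
  rw [S.nonlin_apply]
  simp only [mul_assoc]
  refine integral_relWeight h.hN p ?_
  filter_upwards [radEmb_coeFn h w, radEmb_coeFn h ψ] with x h1 h2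
  rw [h1, h2]

theorem integrable_fst_mul (v w : Ambient N a) :
    Integrable (fun x => ‖x‖ ^ (-2 * a) * (v.fn x * w.fn x)) :=
  (integrable_wMeasure a _).1 ((Lp.memLp v.fst).integrable_mul (Lp.memLp w.fst))

theorem inner_fst_eq (v w : Ambient N a) :
    inner ℝ v.fst w.fst = ∫ x, ‖x‖ ^ (-2 * a) * (v.fn x * w.fn x) := by
  rw [L2.inner_def, integral_wMeasure]
  refine integral_congr_ae (Eventually.of_forall fun x => ?_)
  simp [mul_comm, Ambient.fn]

theorem inner_snd_eq (v w : Ambient N a) :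
    inner ℝ v.snd w.snd = ∫ x, ‖x‖ ^ (-2 * a) * inner ℝ (v.grad x) (w.grad x) := by
  rw [L2.inner_def, integral_wMeasure]
  rfl

theorem source_integral (h : Admissible N a b) {D : EuclideanSpace ℝ (Fin N) → ℝ} {q β l C C' : ℝ}
    (Sq : IsSubcritical (radEmb h) D (relWeight a b q) q C)
    (Sp : IsSubcritical (radEmb h) D (relWeight a b (critExp N a b)) (critExp N a b) C')
    (w : X N a) {f : ℝ → ℝ} (hf : w.1.fn =ᵐ[volume] fun x => f ‖x‖) (φ : energySpace N a) :
    Integrable (fun x => source N a b q β l f ‖x‖ * φ.1.fn x) ∧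
    ∫ x, source N a b q β l f ‖x‖ * φ.1.fn x =
      l * (∫ x, ‖x‖ ^ (-2 * a) * (w.1.fn x * φ.1.fn x)) +
      β * (∫ x, ‖x‖ ^ (-b * q) * (sgnPow q (w.1.fn x) * φ.1.fn x)) +
      ∫ x, ‖x‖ ^ (-b * critExp N a b) * (sgnPow (critExp N a b) (w.1.fn x) * φ.1.fn x) := by
  have i1 := (integrable_fst_mul w.1 φ.1).const_mul l
  have i2 := (integral_nonlin_energy h Sq w φ).const_mul β
  have i3 := integral_nonlin_energy h Sp w φ
  have e : (fun x => source N a b q β l f ‖x‖ * φ.1.fn x) =ᵐ[volume] fun x =>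
      l * (‖x‖ ^ (-2 * a) * (w.1.fn x * φ.1.fn x)) +
      β * (‖x‖ ^ (-b * q) * (sgnPow q (w.1.fn x) * φ.1.fn x)) +
      ‖x‖ ^ (-b * critExp N a b) * (sgnPow (critExp N a b) (w.1.fn x) * φ.1.fn x) := by
    filter_upwards [hf] with x hx
    rw [hx, source]; ring
  have i12 : Integrable fun x => l * (‖x‖ ^ (-2 * a) * (w.1.fn x * φ.1.fn x)) +
      β * (‖x‖ ^ (-b * q) * (sgnPow q (w.1.fn x) * φ.1.fn x)) := i1.add i2
  refine ⟨(i12.add i3).congr e.symm, ?_⟩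
  rw [integral_congr_ae e, integral_add i12 i3, integral_add i1 i2, integral_const_mul,
    integral_const_mul]

/-- The radial element of the energy space with given radial derivative. -/
theorem exists_radial_element (hN : 2 < N) (ha' : a < ((N : ℝ) - 2) / 2) {κ : ℝ → ℝ}
    (hκ : MemLp κ 2 (radMeasure N a)) (hm : Measurable (tailInt κ))
    (hL : MemLp (tailInt κ) 2 (radMeasure N a)) :
    ∃ ψ : X N a, ψ.1.fn =ᵐ[volume] (fun x => tailInt κ ‖x‖) ∧
      ψ.1.grad =ᵐ[volume] radField κ := by
  have hD := isD_tailInt (N := N) hN ha' hκ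
  have hL' : MemLp (fun x : EuclideanSpace ℝ (Fin N) => tailInt κ ‖x‖) 2 (wMeasure N a) :=
    hL.comp_measurePreserving (measurePreserving_norm N a)
  have hg := hD.memLp_grad
  let w : Ambient N a := WithLp.toLp 2 (hL'.toLp _, hg.toLp _)
  have h1 : w.fst =ᵐ[wMeasure N a] fun x => tailInt κ ‖x‖ := hL'.coeFn_toLp
  have h2 : w.snd =ᵐ[wMeasure N a] radField κ := hg.coeFn_toLp
  refine ⟨⟨w, hD.congr h1.symm h2.symm, ⟨tailInt κ, hm, h1⟩⟩, ?_, ?_⟩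
  · rwa [EventuallyEq, ae_wMeasure hN] at h1
  · rwa [EventuallyEq, ae_wMeasure hN] at h2

/-- The primitive of χ is smooth on the line and zero beyond some R, and the polar weight has
exponent N-1-2a ≥ 0; hence it is square integrable although it need not vanish near the origin. -/
theorem exists_test_element (hN : 2 < N) (ha' : a < ((N : ℝ) - 2) / 2) {χ : ℝ → ℝ}
    (hχ : IsTest χ) : ∃ ψ : X N a, ψ.1.fn =ᵐ[volume] (fun x => tailInt χ ‖x‖) ∧
      ψ.1.grad =ᵐ[volume] radField χ := by
  obtain ⟨hk, -⟩ := contDiff_tailInt hχ.1 hχ.2.1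
  refine exists_radial_element hN ha' (hχ.memLp hN a) hk.continuous.measurable ?_
  refine (memLp_radMeasure_iff hN).2 ⟨hk.continuous.aestronglyMeasurable, ?_⟩
  obtain ⟨R, hR0, hR⟩ := exists_tailInt_eq_zero hχ
  have hN' : (0 : ℝ) ≤ (N : ℝ) - 1 - 2 * a := by linarith
  have hc : Continuous fun r : ℝ => r ^ ((N : ℝ) - 1 - 2 * a) * tailInt χ r ^ 2 :=
    (Real.continuous_rpow_const hN').mul (hk.continuous.pow 2)
  refine IntegrableOn.of_forall_sdiff_eq_zero (s := Set.Ioc 0 R)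
    ((hc.integrableOn_Icc (a := 0) (b := R)).mono_set Set.Ioc_subset_Icc_self)
    measurableSet_Ioi fun r hr => ?_
  have h2 : R ≤ r := by
    by_contra h3
    exact hr.2 ⟨hr.1, (not_le.1 h3).le⟩
  simp [hR r h2]

end Source

/-! ### The ordinary differential equation for the radial profile. -/

variable {N : ℕ} {a b : ℝ}

/-- The one-variable form of the exchange in `relWeight_mul_decay`: p-2 powers of s are traded for
decay. -/
theorem abs_nonlin_le (h : Admissible N a b) {B p r s : ℝ} (hp : 2 < p) (hp' : p ≤ critExp N a b)
    (hB : 0 ≤ B) (hr : 0 < r) (hs : |s| ≤ B * r ^ (-decay N a)) :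
    |r ^ (-b * p) * sgnPow p s| ≤ B ^ (p - 2) * ((r ^ (-2 * a) + r ^ (-2 * (a + 1))) * |s|) := by
  have h1 : |s| ^ (p - 2) ≤ B ^ (p - 2) * r ^ (-(decay N a * (p - 2))) := by
    refine (Real.rpow_le_rpow (abs_nonneg _) hs (by linarith)).trans_eq ?_
    rw [Real.mul_rpow hB (by positivity), ← Real.rpow_mul hr.le, neg_mul]
  have h2 : r ^ (-weightExp N a b p) ≤ r ^ (-2 * a) + r ^ (-2 * (a + 1)) := by
    refine rpow_neg_weightExp_le hr (h.lt_weightExp hp).le ?_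
    rcases hp'.eq_or_lt with e | e
    · rw [e, h.weightExp_critExp]
    · exact (h.weightExp_strictMono e).le.trans_eq h.weightExp_critExp
  have h3 : r ^ (-b * p) * r ^ (-(decay N a * (p - 2))) = r ^ (-weightExp N a b p) := by
    rw [← Real.rpow_add hr, weightExp]; ring_nf
  rw [abs_mul, abs_of_pos (Real.rpow_pos_of_pos hr _), abs_sgnPow]
  calc r ^ (-b * p) * (|s| ^ (p - 2) * |s|)
      ≤ r ^ (-b * p) * (B ^ (p - 2) * r ^ (-(decay N a * (p - 2))) * |s|) := by gcongr
    _ = B ^ (p - 2) * (r ^ (-weightExp N a b p) * |s|) := by rw [← h3]; ring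
    _ ≤ _ := by gcongr

theorem abs_source_le (h : Admissible N a b) {B q β l r : ℝ} {f : ℝ → ℝ} (hq : 2 < q)
    (hq' : q < critExp N a b) (hB : 0 ≤ B) (hr : 0 < r) (hs : |f r| ≤ B * r ^ (-decay N a)) :
    |source N a b q β l f r| ≤ (|l| + |β| * B ^ (q - 2) + B ^ (critExp N a b - 2)) *
      ((r ^ (-2 * a) + r ^ (-2 * (a + 1))) * |f r|) := by
  have h1 := abs_nonlin_le h hq hq'.le hB hr hs
  have h2 := abs_nonlin_le h h.two_lt_critExp le_rfl hB hr hs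
  have h3 : |r ^ (-2 * a) * f r| ≤ (r ^ (-2 * a) + r ^ (-2 * (a + 1))) * |f r| := by
    rw [abs_mul, abs_of_pos (Real.rpow_pos_of_pos hr _)]
    gcongr
    linarith [Real.rpow_pos_of_pos hr (-2 * (a + 1))]
  rw [source]
  refine (abs_add_three _ _ _).trans ?_
  rw [abs_mul l, abs_mul β]
  have h4 := mul_le_mul_of_nonneg_left h3 (abs_nonneg l)
  have h5 := mul_le_mul_of_nonneg_left h1 (abs_nonneg β)
  linarith

/-- With |f| ≤ B r^(-σ) and N-2-2a = 2σ, the two Hardy weights produce the powers r^(σ+1) and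
r^(σ-1), both integrable at 0 because σ > 0. The flux can therefore be defined as an integral
starting at the origin. -/
theorem integrableOn_source (h : Admissible N a b) {B q β l : ℝ} {f : ℝ → ℝ} (hq : 2 < q)
    (hq' : q < critExp N a b) (hB : 0 ≤ B) (hf : ContinuousOn f (Set.Ioi 0))
    (hs : ∀ᵐ r ∂(volume.restrict (Set.Ioi (0 : ℝ))), |f r| ≤ B * r ^ (-decay N a)) (R : ℝ) :
    IntegrableOn (fun r => r ^ ((N : ℝ) - 1) * source N a b q β l f r) (Set.Ioc 0 R) := by
  rcases le_or_gt R 0 with hR | hR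
  · simp [Set.Ioc_eq_empty_of_le hR]
  have hpow : ∀ s : ℝ, -1 < s → IntegrableOn (fun r : ℝ => r ^ s) (Set.Ioc 0 R) := fun s hs =>
    (intervalIntegrable_iff_integrableOn_Ioc_of_le hR.le).1
      (intervalIntegral.intervalIntegrable_rpow' hs)
  have hσ := h.decay_pos
  set C := |l| + |β| * B ^ (q - 2) + B ^ (critExp N a b - 2) with hC
  have hC0 : 0 ≤ C := by positivity
  have i1 := (((hpow (2 * decay N a + 1 - decay N a) (by linarith)).add
    (hpow (decay N a - 1) (by linarith))).const_mul (C * B))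
  refine Integrable.mono' i1 ?_ ?_
  · have hc : ContinuousOn (fun r => r ^ ((N : ℝ) - 1) * source N a b q β l f r) (Set.Ioi 0) :=
      ContinuousOn.mul (fun r (hr : 0 < r) =>
        (continuousAt_id.rpow_const (Or.inl hr.ne')).continuousWithinAt)
        (continuousOn_source h.two_lt_critExp hq hf)
    exact (hc.mono Set.Ioc_subset_Ioi_self).aestronglyMeasurable measurableSet_Ioc
  · filter_upwards [ae_restrict_of_ae_restrict_of_subset Set.Ioc_subset_Ioi_self hs,
      ae_restrict_mem measurableSet_Ioc] with r h1 h2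
    have hr : 0 < r := h2.1
    have h3 := abs_source_le (β := β) (l := l) h hq hq' hB hr h1
    rw [Real.norm_eq_abs, abs_mul, abs_of_pos (Real.rpow_pos_of_pos hr _)]
    have e1 : r ^ ((N : ℝ) - 1) * (r ^ (-2 * a) * r ^ (-decay N a)) =
        r ^ (2 * decay N a + 1 - decay N a) := by
      rw [← Real.rpow_add hr, ← Real.rpow_add hr]; congr 1; simp only [decay]; ring
    have e2 : r ^ ((N : ℝ) - 1) * (r ^ (-2 * (a + 1)) * r ^ (-decay N a)) =
        r ^ (decay N a - 1) := by
      rw [← Real.rpow_add hr, ← Real.rpow_add hr]; congr 1; simp only [decay]; ring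
    calc r ^ ((N : ℝ) - 1) * |source N a b q β l f r|
        ≤ r ^ ((N : ℝ) - 1) * (C * ((r ^ (-2 * a) + r ^ (-2 * (a + 1))) *
          (B * r ^ (-decay N a)))) := by
          refine mul_le_mul_of_nonneg_left (h3.trans ?_) (by positivity)
          gcongr
      _ = C * B * (r ^ (2 * decay N a + 1 - decay N a) + r ^ (decay N a - 1)) := by
          rw [← e1, ← e2]; ring

/-- The radial profile of a critical point solves an ordinary differential equation. -/
theorem exists_ode (h : Admissible N a b) {K q β l : ℝ} {ev : ℝ → X N a →L[ℝ] ℝ} (hK : 0 < K)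
    (hev : ∀ w : X N a, ∀ᵐ x : EuclideanSpace ℝ (Fin N), w.1.fn x = ev ‖x‖ w)
    (hev' : ∀ r, 0 < r → ∀ w : X N a, |ev r w| ≤ K * r ^ (-decay N a) * ‖w.1.snd‖)
    (hq : 2 < q) (hq' : q < critExp N a b) {w : X N a}
    (hw : ∀ (f : ℝ → ℝ), w.1.fn =ᵐ[volume] (fun x => f ‖x‖) → ∀ ψ : X N a,
      inner ℝ w.1.snd ψ.1.snd = ∫ x, source N a b q β l f ‖x‖ * ψ.1.fn x) :
    ∃ f M : ℝ → ℝ, w.1.fn =ᵐ[volume] (fun x => f ‖x‖) ∧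
      w.1.grad =ᵐ[volume] radField (fun r => -(r ^ (-((N : ℝ) - 1 - 2 * a)) * M r)) ∧
      (∀ r, 0 < r → HasDerivAt f (-(r ^ (-((N : ℝ) - 1 - 2 * a)) * M r)) r) ∧
      ∀ r, 0 < r → HasDerivAt M (r ^ ((N : ℝ) - 1) * source N a b q β l f r) r := by
  obtain ⟨κ, hκm, hκ, hf, hg⟩ := exists_profile h.hN h.ha h.ha' w
  set f := tailInt κ with hfdef
  set γ := (N : ℝ) - 1 - 2 * a with hγ
  have hfc : ContinuousOn f (Set.Ioi 0) := continuousOn_tailInt h.hN h.ha' hκ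
  have hfB : ∀ᵐ r ∂(volume.restrict (Set.Ioi (0 : ℝ))),
      |f r| ≤ (K * ‖w.1.snd‖) * r ^ (-decay N a) := by
    rw [← ae_norm_iff h.hN]
    filter_upwards [hf, hev w, ae_ne_zero h.hN] with x h1 h2 h3
    rw [← h1, h2]
    refine (hev' _ (norm_pos_iff.2 h3) w).trans_eq (by ring)
  have hsi := integrableOn_source (β := β) (l := l) h hq hq' (by positivity) hfc hfB
  set F : ℝ → ℝ := fun r => r ^ ((N : ℝ) - 1) * source N a b q β l f r with hF
  have hpc : ∀ s : ℝ, ContinuousOn (fun r : ℝ => r ^ s) (Set.Ioi 0) := fun s r (hr : 0 < r) =>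
    (continuousAt_id.rpow_const (Or.inl hr.ne')).continuousWithinAt
  have hFc : ContinuousOn F (Set.Ioi 0) :=
    (hpc _).mul (continuousOn_source h.two_lt_critExp hq hfc)
  obtain ⟨hM, -⟩ := primitive_properties hFc hsi
  -- Up to the sphere constant, M(r) is the source contained in the ball of radius r; the equation
  -- will identify it with -r^(N-1-2a) f'(r).
  set M : ℝ → ℝ := fun r => ∫ t in (0 : ℝ)..r, F t with hMdef
  have hMc : ContinuousOn M (Set.Ioi 0) := fun r hr => (hM r hr).continuousAt.continuousWithinAt
  have hloc : LocallyIntegrableOn (fun r => r ^ γ * κ r + M r) (Set.Ioi 0) := by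
    refine LocallyIntegrableOn.add ?_ (hMc.locallyIntegrableOn measurableSet_Ioi)
    exact (locallyIntegrableOn_of_memLp h.hN hκ).continuousOn_mul (hpc γ) isOpen_Ioi.isLocallyClosed
  -- Testing the equation with the primitive of an arbitrary χ, and integrating the source side by
  -- parts, shows r^(N-1-2a) κ + M = 0 as a distribution.
  have hzero := isOpen_Ioi.ae_eq_zero_of_integral_contDiff_smul_eq_zero hloc ?_
  · have hκM : ∀ᵐ r ∂(volume.restrict (Set.Ioi (0 : ℝ))), κ r = -(r ^ (-γ) * M r) := by
      rw [ae_restrict_iff' measurableSet_Ioi]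
      filter_upwards [hzero] with r h1 hr
      have h2 := h1 hr
      have h3 : r ^ (-γ) * r ^ γ = 1 := by
        rw [← Real.rpow_add hr]; simp
      linear_combination r ^ (-γ) * h2 - κ r * h3
    -- The identity for κ holds only almost everywhere, but its primitive does not notice: f is also
    -- the primitive of a continuous function, hence C¹.
    have hft : Set.EqOn f (tailInt fun r => -(r ^ (-γ) * M r)) (Set.Ioi 0) := by
      intro r (hr : 0 < r)
      simp only [hfdef, tailInt]
      congr 1
      exact integral_congr_ae (ae_restrict_of_ae_restrict_of_subset (Set.Ioi_subset_Ioi hr.le) hκM)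
    refine ⟨f, M, hf, hg.trans ?_, fun r hr => ?_, hM⟩
    · filter_upwards [(ae_norm_iff h.hN).2 hκM] with x hx
      simp only [radField, hx]
    · have hc : ContinuousOn (fun r => -(r ^ (-γ) * M r)) (Set.Ioi 0) := ((hpc _).mul hMc).neg
      refine (hasDerivAt_tailInt hc (fun s hs => ?_) hr).congr_of_eventuallyEq
        (hft.eventuallyEq_of_mem (Ioi_mem_nhds hr))
      exact (integrableOn_Ioi_of_memLp h.hN h.ha' hκ hs).congr
        (ae_restrict_of_ae_restrict_of_subset (Set.Ioi_subset_Ioi hs.le) hκM)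
  · intro χ h1 h2 h3
    have hχ : IsTest χ := ⟨h1, h2, h3⟩
    obtain ⟨ψ, hψ, hψg⟩ := exists_test_element (a := a) h.hN h.ha' hχ
    have e1 := hw f hf ψ
    have e2 : inner ℝ w.1.snd ψ.1.snd =
        sphereConst N * ∫ r in Set.Ioi (0 : ℝ), r ^ γ * (κ r * χ r) := by
      rw [← integral_radial_wMeasure h.hN a fun r => κ r * χ r, L2.inner_def]
      refine integral_congr_ae ?_
      have hg' : w.1.snd =ᵐ[volume] radField κ := hg
      have hψg' : ψ.1.snd =ᵐ[volume] radField χ := hψg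
      rw [EventuallyEq, ae_wMeasure h.hN]
      filter_upwards [hg', hψg', ae_ne_zero h.hN] with x k1 k2 k3
      have := norm_ne_zero_iff.2 k3
      rw [k1, k2]
      conv_lhs => rw [radField.eq_def χ]
      rw [inner_smul_right, inner_smul_right, inner_radField_self]
      field_simp
    have e3 : ∫ x, source N a b q β l f ‖x‖ * ψ.1.fn x =
        sphereConst N * ∫ r in Set.Ioi (0 : ℝ), F r * tailInt χ r := by
      have k := integral_radial h.hN fun r => source N a b q β l f r * tailInt χ r
      rw [show (∫ r in Set.Ioi (0 : ℝ), F r * tailInt χ r) = ∫ r in Set.Ioi (0 : ℝ),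
        r ^ ((N : ℝ) - 1) * (source N a b q β l f r * tailInt χ r) by simp only [hF, mul_assoc],
        ← k]
      refine integral_congr_ae ?_
      filter_upwards [hψ] with x hx
      rw [hx]
    rw [e2, e3, integral_mul_tailInt hFc hsi hχ] at e1
    have e4 := mul_left_cancel₀ (sphereConst_pos h.hN).ne' e1
    have j1 := integrable_test_mul hχ.1.continuous h2 h3
      ((locallyIntegrableOn_of_memLp h.hN hκ).continuousOn_mul (hpc γ) isOpen_Ioi.isLocallyClosed)
    have j2 := integrable_test_mul hχ.1.continuous h2 h3
      (hMc.locallyIntegrableOn measurableSet_Ioi)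
    have e5 : ∫ r, χ r * (r ^ γ * κ r) = ∫ r in Set.Ioi (0 : ℝ), r ^ γ * (κ r * χ r) := by
      rw [← setIntegral_test_mul h3 fun r => r ^ γ * κ r]
      congr 1; ext r; ring
    have e6 : ∫ r, χ r * M r = ∫ r in Set.Ioi (0 : ℝ), M r * χ r := by
      rw [← setIntegral_test_mul h3 M]
      congr 1; ext r; ring
    simp only [smul_eq_mul, mul_add]
    rw [integral_add j1 j2, e5, e6, e4]
    simp only [hMdef, neg_add_cancel]

/-! ### The Pohozaev identity. -/

theorem radial_integral (hN : 2 < N) {Φ : EuclideanSpace ℝ (Fin N) → ℝ} {φ : ℝ → ℝ}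
    (hΦ : Integrable Φ) (e : Φ =ᵐ[volume] fun x => ‖x‖ ^ (1 - (N : ℝ)) * φ ‖x‖) :
    IntegrableOn φ (Set.Ioi 0) ∧ ∫ x, Φ x = sphereConst N * ∫ r in Set.Ioi (0 : ℝ), φ r := by
  have e2 : Set.EqOn (fun r : ℝ => r ^ ((N : ℝ) - 1) * (r ^ (1 - (N : ℝ)) * φ r)) φ
      (Set.Ioi 0) := by
    intro r (hr : 0 < r)
    simp only
    rw [← mul_assoc, ← Real.rpow_add hr]
    simp
  constructor
  · exact ((integrable_radial hN _).1 (hΦ.congr e)).congr_fun e2 measurableSet_Ioi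
  · rw [integral_congr_ae e, integral_radial hN fun r => r ^ (1 - (N : ℝ)) * φ r,
      setIntegral_congr_fun measurableSet_Ioi e2]

theorem integrable_wPow (h : Admissible N a b) {D : EuclideanSpace ℝ (Fin N) → ℝ} {p C : ℝ}
    (S : IsSubcritical (radEmb h) D (relWeight a b p) p C) (w : X N a) :
    Integrable (fun x => ‖x‖ ^ (-b * p) * |w.1.fn x| ^ p) := by
  have := integral_nonlin_energy h S w ⟨w.1, w.2.1⟩
  simpa only [sgnPow_mul_self S.two_lt] using this

/-- The pointwise Pohozaev identity. -/
theorem hasDerivAt_pohozaev {q p β l : ℝ} (hq : 2 < q) (hp : 2 < p) (hpN : p = critExp N a b)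
    {f M : ℝ → ℝ} {r : ℝ} (hr : 0 < r)
    (hf : HasDerivAt f (-(r ^ (-((N : ℝ) - 1 - 2 * a)) * M r)) r)
    (hM : HasDerivAt M (r ^ ((N : ℝ) - 1) * source N a b q β l f r) r) :
    HasDerivAt (fun r => r * (1 / 2 * (r ^ (-((N : ℝ) - 1 - 2 * a)) * M r ^ 2) +
        l / 2 * (r ^ ((N : ℝ) - 1 - 2 * a) * f r ^ 2) +
        β / q * (r ^ ((N : ℝ) - 1 - b * q) * |f r| ^ q) +
        1 / p * (r ^ ((N : ℝ) - 1 - b * p) * |f r| ^ p)))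
      ((2 + 2 * a - N) / 2 * (r ^ (-((N : ℝ) - 1 - 2 * a)) * M r ^ 2) +
        l * (N - 2 * a) / 2 * (r ^ ((N : ℝ) - 1 - 2 * a) * f r ^ 2) +
        β / q * (N - b * q) * (r ^ ((N : ℝ) - 1 - b * q) * |f r| ^ q) +
        1 / p * (N - b * p) * (r ^ ((N : ℝ) - 1 - b * p) * |f r| ^ p)) r := by
  have hpow : ∀ s : ℝ, HasDerivAt (fun r : ℝ => r ^ s) (s * r ^ (s - 1)) r := fun s =>
    Real.hasDerivAt_rpow_const (Or.inl hr.ne')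
  have habs : ∀ s : ℝ, 2 < s → HasDerivAt (fun r => |f r| ^ s)
      (s * sgnPow s (f r) * (-(r ^ (-((N : ℝ) - 1 - 2 * a)) * M r))) r := fun s hs =>
    (hasDerivAt_abs_rpow' hs (f r)).comp r hf
  have key := (hasDerivAt_id r).mul
    ((((((hpow (-((N : ℝ) - 1 - 2 * a))).mul (hM.pow 2)).const_mul (1 / 2)).add
      (((hpow ((N : ℝ) - 1 - 2 * a)).mul (hf.pow 2)).const_mul (l / 2))).add
      (((hpow ((N : ℝ) - 1 - b * q)).mul (habs q hq)).const_mul (β / q))).add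
      (((hpow ((N : ℝ) - 1 - b * p)).mul (habs p hp)).const_mul (1 / p)))
  refine (key.congr_deriv ?_).congr_of_eventuallyEq (Eventually.of_forall fun t => ?_)
  -- All powers of r are expressed through four basic ones, r^(N-1) and 1/r, which then serve as
  -- independent atoms. In the remaining rational identity the products of M with f and with the
  -- nonlinear terms cancel.
  · have es : ∀ s : ℝ, r ^ (s - 1) = r ^ s * r⁻¹ := fun s => by
      rw [Real.rpow_sub_one hr.ne']; rfl
    have e1 : r ^ (-((N : ℝ) - 1 - 2 * a)) = (r ^ ((N : ℝ) - 1 - 2 * a))⁻¹ :=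
      Real.rpow_neg hr.le _
    have e2 : r ^ (-2 * a) = r ^ ((N : ℝ) - 1 - 2 * a) * (r ^ ((N : ℝ) - 1))⁻¹ := by
      rw [← Real.rpow_neg hr.le, ← Real.rpow_add hr]; ring_nf
    have e3 : ∀ s, r ^ (-b * s) = r ^ ((N : ℝ) - 1 - b * s) * (r ^ ((N : ℝ) - 1))⁻¹ := fun s => by
      rw [← Real.rpow_neg hr.le, ← Real.rpow_add hr]; ring_nf
    have p1 : r ^ ((N : ℝ) - 1 - 2 * a) ≠ 0 := (Real.rpow_pos_of_pos hr _).ne'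
    have p2 : r ^ ((N : ℝ) - 1) ≠ 0 := (Real.rpow_pos_of_pos hr _).ne'
    have hq0 : q ≠ 0 := by linarith
    have hp0 : p ≠ 0 := by linarith
    simp only [source, ← hpN, e2, e3, es, Pi.mul_apply, Pi.add_apply, Pi.pow_apply, id_eq, e1]
    generalize r ^ ((N : ℝ) - 1 - 2 * a) = P at *
    generalize r ^ ((N : ℝ) - 1) = Q at *
    generalize r ^ ((N : ℝ) - 1 - b * q) = Rq
    generalize r ^ ((N : ℝ) - 1 - b * p) = Rp
    generalize |f r| ^ q = Aq
    generalize |f r| ^ p = Ap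
    generalize sgnPow q (f r) = Bq
    generalize sgnPow p (f r) = Bp
    push_cast
    field_simp
    ring
  · simp

/-- The Pohozaev identity for radial critical points. -/
theorem pohozaev_eq_zero (h : Admissible N a b) {D : EuclideanSpace ℝ (Fin N) → ℝ}
    {q β l C C' : ℝ} (Sq : IsSubcritical (radEmb h) D (relWeight a b q) q C)
    (Sp : IsSubcritical (radEmb h) D (relWeight a b (critExp N a b)) (critExp N a b) C')
    {w : X N a} {f M : ℝ → ℝ} (hf : w.1.fn =ᵐ[volume] (fun x => f ‖x‖))
    (hg : w.1.grad =ᵐ[volume] radField (fun r => -(r ^ (-((N : ℝ) - 1 - 2 * a)) * M r)))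
    (hf' : ∀ r, 0 < r → HasDerivAt f (-(r ^ (-((N : ℝ) - 1 - 2 * a)) * M r)) r)
    (hM' : ∀ r, 0 < r → HasDerivAt M (r ^ ((N : ℝ) - 1) * source N a b q β l f r) r)
    (hneh : ‖w.1.snd‖ ^ 2 = l * ‖w.1.fst‖ ^ 2 + β * wPow b q w.1.fn +
      wPow b (critExp N a b) w.1.fn) : pohozaev b q β w = 0 := by
  have hq := Sq.two_lt
  have hp := Sp.two_lt
  have hr1 : ∀ {r : ℝ} (s t : ℝ), 0 < r →
      r ^ (-s * t) = r ^ (1 - (N : ℝ)) * r ^ ((N : ℝ) - 1 - s * t) :=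
    fun s t hr => by rw [← Real.rpow_add hr]; ring_nf
  have hgi : Integrable fun x => ‖x‖ ^ (-2 * a) * ‖w.1.grad x‖ ^ 2 := by
    have := (Lp.memLp w.1.snd).norm.integrable_sq
    rw [integrable_wMeasure] at this
    exact this
  obtain ⟨i1, e1⟩ := radial_integral (φ := fun r => r ^ (-((N : ℝ) - 1 - 2 * a)) * M r ^ 2)
    h.hN hgi (by
      filter_upwards [hg, ae_ne_zero h.hN] with x k1 k2
      have hx : 0 < ‖x‖ := norm_pos_iff.2 k2
      rw [k1, norm_radField _ k2, sq_abs, neg_sq, mul_pow, ← mul_assoc, ← mul_assoc]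
      congr 1
      rw [← Real.rpow_natCast, ← Real.rpow_mul hx.le, ← Real.rpow_add hx, ← Real.rpow_add hx]
      push_cast
      ring_nf)
  obtain ⟨i2, e2⟩ := radial_integral (φ := fun r => r ^ ((N : ℝ) - 1 - 2 * a) * f r ^ 2)
    h.hN (integrable_fn_sq w.1) (by
      filter_upwards [hf, ae_ne_zero h.hN] with x k1 k2
      rw [k1, ← mul_assoc, hr1 _ _ (norm_pos_iff.2 k2)])
  obtain ⟨i3, e3⟩ := radial_integral (φ := fun r => r ^ ((N : ℝ) - 1 - b * q) * |f r| ^ q)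
    h.hN (integrable_wPow h Sq w) (by
      filter_upwards [hf, ae_ne_zero h.hN] with x k1 k2
      rw [k1, ← mul_assoc, hr1 _ _ (norm_pos_iff.2 k2)])
  obtain ⟨i4, e4⟩ := radial_integral
    (φ := fun r => r ^ ((N : ℝ) - 1 - b * critExp N a b) * |f r| ^ critExp N a b)
    h.hN (integrable_wPow h Sp w) (by
      filter_upwards [hf, ae_ne_zero h.hN] with x k1 k2
      rw [k1, ← mul_assoc, hr1 _ _ (norm_pos_iff.2 k2)])
  set p := critExp N a b with hpdef
  set k1 := fun r => r ^ (-((N : ℝ) - 1 - 2 * a)) * M r ^ 2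
  set k2 := fun r => r ^ ((N : ℝ) - 1 - 2 * a) * f r ^ 2
  set k3 := fun r => r ^ ((N : ℝ) - 1 - b * q) * |f r| ^ q
  set k4 := fun r => r ^ ((N : ℝ) - 1 - b * p) * |f r| ^ p
  have icomb : ∀ c1 c2 c3 c4 : ℝ,
      IntegrableOn (fun r => c1 * k1 r + c2 * k2 r + c3 * k3 r + c4 * k4 r) (Set.Ioi 0) ∧
      ∫ r in Set.Ioi (0 : ℝ), (c1 * k1 r + c2 * k2 r + c3 * k3 r + c4 * k4 r) =
        c1 * (∫ r in Set.Ioi (0 : ℝ), k1 r) + c2 * (∫ r in Set.Ioi (0 : ℝ), k2 r) +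
        c3 * (∫ r in Set.Ioi (0 : ℝ), k3 r) + c4 * ∫ r in Set.Ioi (0 : ℝ), k4 r := by
    intro c1 c2 c3 c4
    have j1 := i1.const_mul c1
    have j2 := i2.const_mul c2
    have j3 := i3.const_mul c3
    have j4 := i4.const_mul c4
    have j12 : IntegrableOn (fun r => c1 * k1 r + c2 * k2 r) (Set.Ioi 0) := j1.add j2
    have j123 : IntegrableOn (fun r => c1 * k1 r + c2 * k2 r + c3 * k3 r) (Set.Ioi 0) := j12.add j3
    exact ⟨j123.add j4, by
      rw [integral_add j123 j4, integral_add j12 j3, integral_add j1 j2]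
      simp only [integral_const_mul]⟩
  -- Dividing by r removes the prefactor of the Pohozaev function, so it and its derivative are both
  -- combinations of the four integrable densities.
  have key := integral_Ioi_deriv_eq_zero
    (fun r hr => hasDerivAt_pohozaev hq hp hpdef hr (hf' r hr) (hM' r hr))
    (icomb _ _ _ _).1 (((icomb (1 / 2) (l / 2) (β / q) (1 / p)).1).congr_fun
      (fun r (hr : 0 < r) => by simp only [k1, k2, k3, k4]; field_simp) measurableSet_Ioi)
  rw [(icomb _ _ _ _).2] at key
  have hT : ‖w.1.snd‖ ^ 2 = sphereConst N * ∫ r in Set.Ioi (0 : ℝ), k1 r := by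
    rw [← gradSq_eq_norm_sq, gradSq, e1]
  have hA : ‖w.1.fst‖ ^ 2 = sphereConst N * ∫ r in Set.Ioi (0 : ℝ), k2 r := by
    rw [← integral_fn_sq_eq_norm_sq, e2]
  rw [pohozaev, gradSq_eq_norm_sq, deltaExp]
  have hden := h.denom_pos
  have hN0 : (0 : ℝ) < N := by exact_mod_cast (by have := h.hN; omega : 0 < N)
  have hpe : (N : ℝ) / p = (N - 2 * (1 + a - b)) / 2 := by
    rw [hpdef, critExp, dExp]
    simp only [dExp] at hden
    field_simp
  have e3' : wPow b q w.1.fn = sphereConst N * ∫ r in Set.Ioi (0 : ℝ), k3 r := e3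
  have e4' : wPow b p w.1.fn = sphereConst N * ∫ r in Set.Ioi (0 : ℝ), k4 r := e4
  have hq0 : q ≠ 0 := by linarith
  have hp0 : p ≠ 0 := by linarith
  have c4 : 1 / p * (N - b * p) = (N - 2 * (1 + a - b)) / 2 - b := by
    rw [← hpe]; field_simp
  rw [c4] at key
  rw [hT, hA, e3', e4'] at hneh
  rw [hT, e3', e4']
  have c3 : β / q * (N - b * q) = β * (N / q - b) := by field_simp
  rw [c3] at key
  have cd : ((N - 2 * a + 2 * b) * q - 2 * N) / (2 * q) = (N - 2 * a + 2 * b) / 2 - N / q := by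
    field_simp
  rw [cd]
  -- Adding (N-2a)/2 times the equation tested with w eliminates the λ term and leaves coefficient 1
  -- on the gradient.
  linear_combination sphereConst N * key + ((N : ℝ) - 2 * a) / 2 * hneh

/-! ### Logarithmic cut-offs. -/

section Cutoff

/-- Logarithmic cut-off functions on `(0, ∞)`. -/
theorem exists_log_cutoff : ∃ (η : ℕ → ℝ → ℝ) (C : ℝ), (∀ n, IsTest (η n)) ∧
    (∀ n r, |η n r| ≤ 1) ∧ (∀ (n : ℕ) (r : ℝ), 0 < r → |r * deriv (η n) r| ≤ C / (n + 1)) ∧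
    ∀ r, 0 < r → Tendsto (fun n => η n r) atTop (𝓝 1) := by
  let Θ : ContDiffBump (0 : ℝ) := ⟨1, 2, one_pos, one_lt_two⟩
  have hΘ : ContDiff ℝ ∞ (Θ : ℝ → ℝ) := Θ.contDiff
  have hΘ0 : ∀ t : ℝ, 2 ≤ |t| → Θ t = 0 := fun t ht =>
    Θ.zero_of_le_dist (by rwa [dist_zero_right, Real.norm_eq_abs])
  have hdc : Continuous (deriv (Θ : ℝ → ℝ)) := hΘ.continuous_deriv (by simp)
  obtain ⟨C, hC⟩ := hdc.bounded_above_of_compact_support Θ.hasCompactSupport.deriv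
  -- Rescaling in log r gives r η_n'(r) = Θ'(log r/(n+1))/(n+1), uniformly small in r. Dilating a
  -- fixed bump would only keep this quantity bounded.
  set η : ℕ → ℝ → ℝ := fun n r => if 0 < r then Θ (Real.log r / (n + 1)) else 0 with hη
  have hn : ∀ n : ℕ, (0 : ℝ) < n + 1 := fun n => by positivity
  have hnz : ∀ n r, η n r ≠ 0 → r ∈ Set.Icc (Real.exp (-(2 * (n + 1)))) (Real.exp (2 * (n + 1))) := by
    intro n r h1
    have hr : 0 < r := by
      by_contra hc
      exact h1 (by simp only [hη, if_neg hc])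
    simp only [hη, if_pos hr] at h1
    have h2 : |Real.log r / (n + 1)| < 2 := by
      by_contra hc
      exact h1 (hΘ0 _ (not_lt.1 hc))
    rw [abs_div, abs_of_pos (hn n), div_lt_iff₀ (hn n), abs_lt] at h2
    exact ⟨(Real.le_log_iff_exp_le hr).1 h2.1.le, (Real.log_le_iff_le_exp hr).1 h2.2.le⟩
  have hsupp : ∀ n, tsupport (η n) ⊆
      Set.Icc (Real.exp (-(2 * ((n : ℝ) + 1)))) (Real.exp (2 * ((n : ℝ) + 1))) := fun n =>
    closure_minimal (fun r hr => hnz n r hr) isClosed_Icc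
  have hpos : ∀ n, tsupport (η n) ⊆ Set.Ioi 0 := fun n r hr =>
    (Real.exp_pos _).trans_le (hsupp n hr).1
  have hev : ∀ n r, 0 < r → η n =ᶠ[𝓝 r] fun s => Θ (Real.log s / (n + 1)) := fun n r hr => by
    filter_upwards [Ioi_mem_nhds hr] with s hs
    simp only [hη, if_pos (show 0 < s from hs)]
  refine ⟨η, C, fun n => ⟨?_, ?_, hpos n⟩, ?_, ?_, ?_⟩
  · rw [contDiff_iff_contDiffAt]
    intro r
    by_cases hr : 0 < r
    · refine ContDiffAt.congr_of_eventuallyEq ?_ (hev n r hr)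
      exact hΘ.contDiffAt.comp r ((Real.contDiffAt_log.2 hr.ne').div_const _)
    · have : r ∉ tsupport (η n) := fun h => hr (hpos n h)
      exact contDiffAt_const.congr_of_eventuallyEq (notMem_tsupport_iff_eventuallyEq.1 this)
  · exact HasCompactSupport.of_support_subset_isCompact isCompact_Icc fun r hr => hnz n r hr
  · intro n r
    simp only [hη]
    split_ifs
    · rw [abs_of_nonneg Θ.nonneg]; exact Θ.le_one
    · simp
  · intro n r hr
    have h1 : HasDerivAt (fun s => Θ (Real.log s / (n + 1)))
        (deriv Θ (Real.log r / (n + 1)) * (r⁻¹ / (n + 1))) r :=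
      ((hΘ.differentiable (by simp)) _).hasDerivAt.comp r ((Real.hasDerivAt_log hr.ne').div_const _)
    rw [(hev n r hr).deriv_eq, h1.deriv]
    have e : r * (deriv Θ (Real.log r / (n + 1)) * (r⁻¹ / (n + 1))) =
        deriv Θ (Real.log r / (n + 1)) / (n + 1) := by
      field_simp
    rw [e, abs_div, abs_of_pos (hn n)]
    have := hC (Real.log r / (n + 1))
    rw [Real.norm_eq_abs] at this
    have := hn n
    gcongr
  · intro r hr
    have h0 : Tendsto (fun n : ℕ => Real.log r / ((n : ℝ) + 1)) atTop (𝓝 0) :=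
      tendsto_const_nhds.div_atTop (tendsto_atTop_add_const_right _ _ tendsto_natCast_atTop_atTop)
    have h1 := (hΘ.continuous.tendsto 0).comp h0
    rw [Θ.one_of_mem_closedBall (Metric.mem_closedBall_self Θ.rIn_pos.le)] at h1
    refine h1.congr fun n => ?_
    simp only [hη, if_pos hr, Function.comp]

/-- The flux M is only C¹, so the truncated flux is too; this is the regularity that
`IsD.radial_divergence` needs. -/
theorem IsTest.mul_of_hasDerivAt {χ M F : ℝ → ℝ} (hχ : IsTest χ) (hF : ContinuousOn F (Set.Ioi 0))
    (hM : ∀ r, 0 < r → HasDerivAt M (F r) r) :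
    ContDiff ℝ 1 (fun r => χ r * M r) ∧ tsupport (fun r => χ r * M r) ⊆ Set.Ioi 0 ∧
      HasCompactSupport (fun r => χ r * M r) ∧
      ∀ r, 0 < r → deriv (fun r => χ r * M r) r = χ r * F r + deriv χ r * M r := by
  have hsub : tsupport (fun r => χ r * M r) ⊆ tsupport χ := tsupport_mul_subset_left
  refine ⟨?_, hsub.trans hχ.2.2, hχ.2.1.mul_right, fun r hr => ?_⟩
  · rw [contDiff_iff_contDiffAt]
    intro r
    by_cases hr : 0 < r
    · refine (hχ.1.of_le (by simp)).contDiffAt.mul (contDiffAt_one_iff.2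
        ⟨fun r => ContinuousLinearMap.toSpanSingleton ℝ (F r), Set.Ioi 0, Ioi_mem_nhds hr, ?_,
          fun s hs => (hM s hs).hasFDerivAt⟩)
      exact (ContinuousLinearMap.toSpanSingletonCLE (𝕜 := ℝ) (E := ℝ)).continuous.comp_continuousOn hF
    · have : r ∉ tsupport (fun r => χ r * M r) := fun h => hr (hχ.2.2 (hsub h))
      exact contDiffAt_const.congr_of_eventuallyEq (notMem_tsupport_iff_eventuallyEq.1 this)
  · have h1 := (((hχ.1.differentiable (by simp)) r).hasDerivAt.mul (hM r hr)).deriv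
    rw [add_comm]
    exact h1

end Cutoff

/-! ### From radial to arbitrary test functions. -/

section WeakEquation

variable {N : ℕ} {a b : ℝ}

/-- A radial critical point satisfies the equation against all test functions. -/
theorem inner_snd_eq_integral_source (h : Admissible N a b) {q β l : ℝ} (hq : 2 < q) {w : X N a}
    {f M : ℝ → ℝ}
    (hg : w.1.grad =ᵐ[volume] radField (fun r => -(r ^ (-((N : ℝ) - 1 - 2 * a)) * M r)))
    (hf' : ∀ r, 0 < r → HasDerivAt f (-(r ^ (-((N : ℝ) - 1 - 2 * a)) * M r)) r)
    (hM' : ∀ r, 0 < r → HasDerivAt M (r ^ ((N : ℝ) - 1) * source N a b q β l f r) r)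
    (φ : energySpace N a)
    (hi : Integrable (fun x => source N a b q β l f ‖x‖ * φ.1.fn x)) :
    inner ℝ w.1.snd φ.1.snd = ∫ x, source N a b q β l f ‖x‖ * φ.1.fn x := by
  obtain ⟨η, C, hη, hη1, hηd, hηl⟩ := exists_log_cutoff
  set F : ℝ → ℝ := fun r => r ^ ((N : ℝ) - 1) * source N a b q β l f r with hFdef
  have hfc : ContinuousOn f (Set.Ioi 0) := fun r hr => (hf' r hr).continuousAt.continuousWithinAt
  have hF : ContinuousOn F (Set.Ioi 0) :=
    ContinuousOn.mul (fun r (hr : 0 < r) =>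
      (continuousAt_id.rpow_const (Or.inl hr.ne')).continuousWithinAt)
      (continuousOn_source h.two_lt_critExp hq hfc)
  set κ : ℝ → ℝ := fun r => -(r ^ (-((N : ℝ) - 1 - 2 * a)) * M r) with hκdef
  have hφ : IsD a φ.1.fn φ.1.grad := φ.2
  have hmem := fun n => (hη n).mul_of_hasDerivAt hF hM'
  -- A form of symmetric criticality: the field is radial with profile η_n M, but the φ it is
  -- integrated by parts against need not be.
  have key : ∀ n, ∫ x, inner ℝ (φ.1.grad x) (‖x‖⁻¹ • x) *
      (‖x‖ ^ (2 * a + 1 - N) * (η n ‖x‖ * M ‖x‖)) ∂(wMeasure N a) =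
      -∫ x, φ.1.fn x * (‖x‖ ^ (1 - (N : ℝ)) * deriv (fun r => η n r * M r) ‖x‖) := by
    intro n
    obtain ⟨k1, k2, k3, -⟩ := hmem n
    obtain ⟨B, hB⟩ := k3.exists_bound_of_continuous k1.continuous
    exact hφ.radial_divergence h.hN h.ha h.ha' k1 k2 hB k3.deriv
  have hgw : ∀ᵐ x ∂(wMeasure N a), w.1.snd x = radField κ x := by
    rw [ae_wMeasure h.hN]; exact hg
  have hκ2 : MemLp (fun x : EuclideanSpace ℝ (Fin N) => κ ‖x‖) 2 (wMeasure N a) := by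
    have h1 : MemLp (fun x => inner ℝ (w.1.snd x) (‖x‖⁻¹ • x)) 2 (wMeasure N a) := by
      refine MemLp.of_le (Lp.memLp w.1.snd) ((Lp.aestronglyMeasurable _).inner
        (measurable_norm.inv.smul measurable_id).aestronglyMeasurable)
        (Eventually.of_forall fun x => ?_)
      refine (norm_inner_le_norm _ _).trans ?_
      refine mul_le_of_le_one_right (norm_nonneg _) ?_
      rw [norm_smul, norm_inv, norm_norm]
      exact inv_mul_le_one
    refine h1.ae_eq ?_
    rw [EventuallyEq, ae_wMeasure h.hN]
    filter_upwards [ae_ne_zero h.hN, (ae_wMeasure h.hN (a := a)) ▸ hgw] with x k1 k2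
    have := norm_ne_zero_iff.2 k1
    rw [k2, inner_smul_right, inner_radField_self]
    field_simp
  -- the left-hand sides
  have lim1 : Tendsto (fun n => ∫ x, inner ℝ (φ.1.grad x) (‖x‖⁻¹ • x) *
      (‖x‖ ^ (2 * a + 1 - N) * (η n ‖x‖ * M ‖x‖)) ∂(wMeasure N a)) atTop
      (𝓝 (-inner ℝ w.1.snd φ.1.snd)) := by
    have e : -inner ℝ w.1.snd φ.1.snd =
        ∫ x, -inner ℝ (w.1.snd x) (φ.1.snd x) ∂(wMeasure N a) := by
      rw [integral_neg, L2.inner_def]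
    have ae1 : ∀ᵐ x ∂(wMeasure N a), ∀ n, inner ℝ (φ.1.grad x) (‖x‖⁻¹ • x) *
        (‖x‖ ^ (2 * a + 1 - N) * (η n ‖x‖ * M ‖x‖)) =
        η n ‖x‖ * -inner ℝ (w.1.snd x) (φ.1.snd x) := by
      filter_upwards [hgw, (ae_wMeasure h.hN a).symm ▸ ae_ne_zero h.hN] with x k1 k2 n
      rw [k1, radField, real_inner_smul_left, real_inner_comm]
      simp only [hκdef, Ambient.grad]
      rw [show (2 * a + 1 - (N : ℝ)) = -((N : ℝ) - 1 - 2 * a) by ring]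
      ring
    rw [e]
    refine tendsto_integral_of_dominated_convergence
      (fun x => ‖(inner ℝ (w.1.snd x) (φ.1.snd x) : ℝ)‖) (fun n => ?_)
      (L2.integrable_inner w.1.snd φ.1.snd).norm (fun n => ?_) ?_
    · have m1 : AEStronglyMeasurable (fun x => η n ‖x‖ * -inner ℝ (w.1.snd x) (φ.1.snd x))
          (wMeasure N a) :=
        (((hη n).1.continuous.comp continuous_norm).aestronglyMeasurable).mul
          (L2.integrable_inner w.1.snd φ.1.snd).1.neg
      exact m1.congr (ae1.mono fun x hx => (hx n).symm)
    · filter_upwards [ae1] with x hx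
      rw [hx n, norm_mul, norm_neg]
      exact mul_le_of_le_one_left (norm_nonneg _) (hη1 n _)
    · filter_upwards [ae1, (ae_wMeasure h.hN a).symm ▸ ae_ne_zero h.hN] with x k1 k2
      simp only [k1]
      have := (hηl ‖x‖ (norm_pos_iff.2 k2)).mul_const (-inner ℝ (w.1.snd x) (φ.1.snd x))
      rwa [one_mul] at this
  -- the right-hand sides
  have hH : Integrable fun x => ‖x‖ ^ (-2 * a) * (φ.1.fn x * ‖x‖⁻¹ * κ ‖x‖) := by
    have h1 : MemLp (fun x => φ.1.fn x * ‖x‖⁻¹) 2 (wMeasure N a) := by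
      obtain ⟨m1, m2⟩ := (memLp_two_wMeasure h.hN (a + 1)).1 (hφ.memLp_hardy h.hN h.ha h.ha')
      refine (memLp_two_wMeasure h.hN a).2
        ⟨m1.mul measurable_norm.inv.aestronglyMeasurable, m2.congr ?_⟩
      filter_upwards [ae_ne_zero h.hN] with x hx
      have hx' : 0 < ‖x‖ := norm_pos_iff.2 hx
      rw [norm_mul, norm_inv, norm_norm, mul_pow, mul_comm (_ ^ 2), ← mul_assoc, inv_pow,
        ← Real.rpow_natCast ‖x‖, ← Real.rpow_neg hx'.le, ← Real.rpow_add hx']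
      congr 2
      push_cast; ring
    exact (integrable_wMeasure a _).1 (h1.integrable_mul hκ2)
  -- The derivative of the cut-off contributes r η_n' times |x|^(-2a) (φ/|x|) κ. Hardy's inequality
  -- makes φ/|x| square integrable, so this product is integrable and the factor C/(n+1) sends it to
  -- zero.
  have ae2 : ∀ᵐ x : EuclideanSpace ℝ (Fin N), ∀ n,
      φ.1.fn x * (‖x‖ ^ (1 - (N : ℝ)) * deriv (fun r => η n r * M r) ‖x‖) =
      η n ‖x‖ * (source N a b q β l f ‖x‖ * φ.1.fn x) -
        (‖x‖ * deriv (η n) ‖x‖) * (‖x‖ ^ (-2 * a) * (φ.1.fn x * ‖x‖⁻¹ * κ ‖x‖)) := by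
    filter_upwards [ae_ne_zero h.hN] with x hx n
    have hx' : 0 < ‖x‖ := norm_pos_iff.2 hx
    rw [(hmem n).2.2.2 _ hx']
    have e1 : ‖x‖ ^ (1 - (N : ℝ)) * ‖x‖ ^ ((N : ℝ) - 1) = 1 := by
      rw [← Real.rpow_add hx']; simp
    have e2 : ‖x‖ ^ (-2 * a) * ‖x‖ ^ (-((N : ℝ) - 1 - 2 * a)) = ‖x‖ ^ (1 - (N : ℝ)) := by
      rw [← Real.rpow_add hx']; ring_nf
    have e3 : ‖x‖ * ‖x‖⁻¹ = 1 := mul_inv_cancel₀ hx'.ne'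
    simp only [hFdef, hκdef]
    linear_combination (φ.1.fn x * η n ‖x‖ * source N a b q β l f ‖x‖) * e1 -
      (φ.1.fn x * deriv (η n) ‖x‖ * M ‖x‖) * e2 -
      (φ.1.fn x * deriv (η n) ‖x‖ * M ‖x‖) *
        (‖x‖ ^ (-2 * a) * ‖x‖ ^ (-((N : ℝ) - 1 - 2 * a))) * e3
  have hC0 : 0 ≤ C := by
    have := (abs_nonneg _).trans (hηd 0 1 one_pos)
    simpa using this
  have lim2 : Tendsto (fun n => ∫ x, φ.1.fn x * (‖x‖ ^ (1 - (N : ℝ)) *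
      deriv (fun r => η n r * M r) ‖x‖)) atTop
      (𝓝 (∫ x, source N a b q β l f ‖x‖ * φ.1.fn x)) := by
    refine tendsto_integral_of_dominated_convergence
      (fun x => ‖source N a b q β l f ‖x‖ * φ.1.fn x‖ +
        C * ‖‖x‖ ^ (-2 * a) * (φ.1.fn x * ‖x‖⁻¹ * κ ‖x‖)‖) (fun n => ?_)
      (hi.norm.add (hH.norm.const_mul C)) (fun n => ?_) ?_
    · have m1 : AEStronglyMeasurable (fun x => η n ‖x‖ * (source N a b q β l f ‖x‖ * φ.1.fn x) -
        (‖x‖ * deriv (η n) ‖x‖) * (‖x‖ ^ (-2 * a) * (φ.1.fn x * ‖x‖⁻¹ * κ ‖x‖))) volume :=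
        ((((hη n).1.continuous.comp continuous_norm).aestronglyMeasurable).mul hi.1).sub
          ((continuous_norm.mul (((hη n).1.continuous_deriv (by simp)).comp
            continuous_norm)).aestronglyMeasurable.mul hH.1)
      exact m1.congr (ae2.mono fun x hx => (hx n).symm)
    · filter_upwards [ae2, ae_ne_zero h.hN] with x hx k2
      rw [hx n]
      refine (norm_sub_le _ _).trans ?_
      rw [norm_mul, norm_mul (_ * _)]
      refine add_le_add (mul_le_of_le_one_left (norm_nonneg _) (hη1 n _))
        (mul_le_mul_of_nonneg_right ?_ (norm_nonneg _))
      exact (hηd n _ (norm_pos_iff.2 k2)).trans (div_le_self hC0 (by simp))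
    · filter_upwards [ae2, ae_ne_zero h.hN] with x k1 k2
      simp only [k1]
      have hx' : 0 < ‖x‖ := norm_pos_iff.2 k2
      have t1 := (hηl ‖x‖ hx').mul_const (source N a b q β l f ‖x‖ * φ.1.fn x)
      have t2 : Tendsto (fun n => ‖x‖ * deriv (η n) ‖x‖) atTop (𝓝 0) := by
        refine squeeze_zero_norm (fun n => hηd n _ hx') ?_
        exact tendsto_const_nhds.div_atTop
          (tendsto_atTop_add_const_right _ _ tendsto_natCast_atTop_atTop)
      have t3 := t1.sub (t2.mul_const (‖x‖ ^ (-2 * a) * (φ.1.fn x * ‖x‖⁻¹ * κ ‖x‖)))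
      rwa [one_mul, zero_mul, sub_zero] at t3
  have := tendsto_nhds_unique lim1 ((lim2.neg).congr fun n => (key n).symm)
  linarith

end WeakEquation

/-! ### Weak sequential compactness in Hilbert spaces. -/

section WeakCompactness

variable {H : Type*} [NormedAddCommGroup H] [InnerProductSpace ℝ H] [CompleteSpace H]

/-- Bounded sequences in a Hilbert space have weakly convergent subsequences. -/
theorem exists_subseq_weak {u : ℕ → H} {B : ℝ} (hB : ∀ n, ‖u n‖ ≤ B) :
    ∃ (k : ℕ → ℕ) (v : H), StrictMono k ∧
      ∀ l : H →L[ℝ] ℝ, Tendsto (fun n => l (u (k n))) atTop (𝓝 (l v)) := by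
  -- Weak-star sequential compactness of dual balls needs separability, so the argument takes place
  -- in the closed span of the sequence and returns through the Riesz isomorphism.
  set Y := (Submodule.span ℝ (Set.range u)).topologicalClosure with hY
  have hsep : TopologicalSpace.IsSeparable (Y : Set H) := by
    rw [hY, Submodule.topologicalClosure_coe]
    exact (Set.countable_range u).isSeparable.span.closure
  have : TopologicalSpace.SeparableSpace Y := hsep.separableSpace
  have : CompleteSpace Y := (Submodule.isClosed_topologicalClosure _).completeSpace_coe
  have hu : ∀ n, u n ∈ Y := fun n =>
    Submodule.le_topologicalClosure _ (Submodule.subset_span (Set.mem_range_self n))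
  let f : ℕ → WeakDual ℝ Y := fun n =>
    StrongDual.toWeakDual (InnerProductSpace.toDual ℝ Y ⟨u n, hu n⟩)
  have hf : ∀ n, f n ∈ WeakDual.toStrongDual ⁻¹' Metric.closedBall (0 : StrongDual ℝ Y) B := by
    intro n
    change dist (InnerProductSpace.toDual ℝ Y ⟨u n, hu n⟩) 0 ≤ B
    refine (dist_zero_right (InnerProductSpace.toDual ℝ Y ⟨u n, hu n⟩)).trans_le ?_
    rw [LinearIsometryEquiv.norm_map]
    exact hB n
  obtain ⟨F, -, k, hk, hF⟩ := WeakDual.isSeqCompact_closedBall ℝ Y 0 B hf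
  set v := (InnerProductSpace.toDual ℝ Y).symm (WeakDual.toStrongDual F) with hv
  refine ⟨k, v, hk, fun l => ?_⟩
  have h1 := (WeakDual.eval_continuous
    ((InnerProductSpace.toDual ℝ Y).symm (l.comp Y.subtypeL))).tendsto F |>.comp hF
  have e : ∀ y : Y, l y = inner ℝ y ((InnerProductSpace.toDual ℝ Y).symm (l.comp Y.subtypeL)) := by
    intro y
    rw [real_inner_comm, InnerProductSpace.toDual_symm_apply]
    rfl
  have e2 : l v = F ((InnerProductSpace.toDual ℝ Y).symm (l.comp Y.subtypeL)) := by
    rw [e v, hv, InnerProductSpace.toDual_symm_apply]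
    rfl
  rw [e2]
  refine h1.congr fun n => ?_
  have := e ⟨u (k n), hu (k n)⟩
  rw [this]
  rfl

end WeakCompactness

/-! ### The differential of the energy and its critical points. -/

/-- The function component, as an operator on `X`. -/
noncomputable def fstX (N : ℕ) (a : ℝ) : X N a →L[ℝ] Lp ℝ 2 (wMeasure N a) :=
  (WithLp.fstL 2 ℝ _ _).comp (X N a).subtypeL

/-- The gradient component, as an operator on `X`. -/
noncomputable def sndX (N : ℕ) (a : ℝ) :
    X N a →L[ℝ] Lp (EuclideanSpace ℝ (Fin N)) 2 (wMeasure N a) :=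
  (WithLp.sndL 2 ℝ _ _).comp (X N a).subtypeL

@[simp] theorem fstX_apply (w : X N a) : fstX N a w = w.1.fst := rfl
@[simp] theorem sndX_apply (w : X N a) : sndX N a w = w.1.snd := rfl

/-- The energy is a squared norm minus two instances of `powInt`. In particular `fderiv` in
`IsPalaisSmale` is the true differential and not its default value 0. -/
theorem hasFDerivAt_energy (h : Admissible N a b) {D : EuclideanSpace ℝ (Fin N) → ℝ}
    {q C C' : ℝ} (β : ℝ) (Sq : IsSubcritical (radEmb h) D (relWeight a b q) q C)
    (Sp : IsSubcritical (radEmb h) D (relWeight a b (critExp N a b)) (critExp N a b) C')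
    (w : X N a) : HasFDerivAt (energy b q β)
      ((innerSL ℝ w.1.snd).comp (sndX N a) - β • Sq.nonlin w - Sp.nonlin w) w := by
  have hq := Sq.two_lt
  have hp := Sp.two_lt
  have d1 := ((sndX N a).hasFDerivAt (x := w)).norm_sq.const_mul (1 / 2)
  have d2 := (Sq.hasFDerivAt_powInt w).const_mul (β / q)
  have d3 := (Sp.hasFDerivAt_powInt w).const_mul (1 / critExp N a b)
  have d := (d1.sub d2).sub d3
  refine (d.congr_fderiv ?_).congr_of_eventuallyEq (Eventually.of_forall fun v => ?_)
  · have hq0 : q ≠ 0 := by linarith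
    have hp0 : critExp N a b ≠ 0 := by linarith
    ext ψ
    simp
    field_simp
  · simp only [energy, gradSq_eq_norm_sq, Pi.sub_apply, powInt_radEmb, sndX_apply]

/-- Radial critical points satisfy the Pohozaev identity and are weak solutions. -/
theorem critical_point (h : Admissible N a b) {K q β l C C' : ℝ} {ev : ℝ → X N a →L[ℝ] ℝ}
    {D : EuclideanSpace ℝ (Fin N) → ℝ} (hK : 0 < K)
    (hev : ∀ w : X N a, ∀ᵐ x : EuclideanSpace ℝ (Fin N), w.1.fn x = ev ‖x‖ w)
    (hev' : ∀ r, 0 < r → ∀ w : X N a, |ev r w| ≤ K * r ^ (-decay N a) * ‖w.1.snd‖)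
    (hq' : q < critExp N a b)
    (Sq : IsSubcritical (radEmb h) D (relWeight a b q) q C)
    (Sp : IsSubcritical (radEmb h) D (relWeight a b (critExp N a b)) (critExp N a b) C')
    {w : X N a} (hw : ∀ ψ : X N a, inner ℝ w.1.snd ψ.1.snd =
      l * inner ℝ w.1.fst ψ.1.fst + β * Sq.nonlin w ψ + Sp.nonlin w ψ) :
    pohozaev b q β w = 0 ∧ ∀ φ ∈ energySpace N a,
      ∫ x, ‖x‖ ^ (-2 * a) * inner ℝ (w.1.grad x) (φ.grad x) =
        l * (∫ x, ‖x‖ ^ (-2 * a) * (w.1.fn x * φ.fn x))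
        + β * (∫ x, ‖x‖ ^ (-b * q) * (|w.1.fn x| ^ (q - 2) * w.1.fn x * φ.fn x))
        + ∫ x, ‖x‖ ^ (-b * critExp N a b) *
          (|w.1.fn x| ^ (critExp N a b - 2) * w.1.fn x * φ.fn x) := by
  -- Both conclusions are read off from the differential equation of the profile.
  obtain ⟨f, M, hf, hg, hf', hM'⟩ := exists_ode (β := β) (l := l) h hK hev hev' Sq.two_lt hq'
    (w := w) (fun f hf ψ => by
      rw [hw ψ, (source_integral h Sq Sp w hf ⟨ψ.1, ψ.2.1⟩).2, inner_fst_eq,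
        nonlin_eq_integral h Sq, nonlin_eq_integral h Sp])
  constructor
  · refine pohozaev_eq_zero h Sq Sp hf hg hf' hM' ?_
    have := hw w
    rwa [Sq.nonlin_self, Sp.nonlin_self, powInt_radEmb, powInt_radEmb,
      real_inner_self_eq_norm_sq, real_inner_self_eq_norm_sq] at this
  · intro φ hφ
    obtain ⟨k1, k2⟩ := source_integral (β := β) (l := l) h Sq Sp w hf ⟨φ, hφ⟩
    have k3 := inner_snd_eq_integral_source h Sq.two_lt hg hf' hM' ⟨φ, hφ⟩ k1
    rw [k2, inner_snd_eq] at k3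
    exact k3

/-! ### Interpolation inequalities and coercivity. -/

/-- The Caffarelli–Kohn–Nirenberg inequality. -/
theorem bestConst_mul_le (h : Admissible N a b) (w : X N a) :
    bestConst N a b * wPow b (critExp N a b) w.1.fn ^ (2 / critExp N a b) ≤ ‖w.1.snd‖ ^ 2 := by
  rw [← gradSq_eq_norm_sq]
  have hg : ∀ g : EuclideanSpace ℝ (Fin N) → EuclideanSpace ℝ (Fin N), 0 ≤ gradSq a g :=
    fun g => integral_nonneg fun x => by positivity
  have hW : ∀ u : EuclideanSpace ℝ (Fin N) → ℝ, 0 ≤ wPow b (critExp N a b) u :=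
    fun u => integral_nonneg fun x => by positivity
  -- A vanishing critical term makes the inequality trivial; otherwise w is nonzero and competes in
  -- the infimum.
  rcases (Real.rpow_nonneg (hW w.1.fn) (2 / critExp N a b)).eq_or_lt with e | e
  · rw [← e, mul_zero]; exact hg _
  · rw [← le_div_iff₀ e]
    by_cases h0 : w.1.fn =ᵐ[volume] 0
    · exfalso
      have hp := h.two_lt_critExp
      have h1 : wPow b (critExp N a b) w.1.fn = 0 := by
        refine integral_eq_zero_of_ae ?_
        filter_upwards [h0] with x hx
        rw [hx]
        simp [Real.zero_rpow (show critExp N a b ≠ 0 by linarith)]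
      rw [h1, Real.zero_rpow (by positivity)] at e
      exact lt_irrefl _ e
    · refine csInf_le ⟨0, ?_⟩ ⟨w.1.fn, w.1.grad, w.2.1, h0, rfl⟩
      rintro s ⟨u, g, -, -, rfl⟩
      exact div_nonneg (hg g) (Real.rpow_nonneg (hW u) _)

theorem bestConst_nonneg : 0 ≤ bestConst N a b := by
  refine Real.sInf_nonneg ?_
  rintro s ⟨u, g, -, -, rfl⟩
  exact div_nonneg (integral_nonneg fun x => by positivity)
    (Real.rpow_nonneg (integral_nonneg fun x => by positivity) _)

/-- The unscaled inequality dilated by s. The free scale is spent in the Gagliardo–Nirenberg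
inequality. -/
theorem rpow_neg_le_scaled {r s e : ℝ} (hr : 0 < r) (hs : 0 < s) (h1 : 2 * a ≤ e)
    (h2 : e ≤ 2 * a + 2) :
    r ^ (-e) ≤ s ^ (2 * a - e) * r ^ (-2 * a) + s ^ (2 * a + 2 - e) * r ^ (-2 * (a + 1)) := by
  have key := mul_le_mul_of_nonneg_left (rpow_neg_weightExp_le (div_pos hr hs) h1 h2)
    (Real.rpow_nonneg hs.le (-e))
  have hd : ∀ t : ℝ, (r / s) ^ t = r ^ t * s ^ (-t) := fun t => by
    rw [Real.div_rpow hr.le hs.le, Real.rpow_neg hs.le]; rfl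
  rw [hd, hd, hd] at key
  have e1 : s ^ (-e) * s ^ (- -e) = 1 := by rw [← Real.rpow_add hs]; simp
  have e2 : s ^ (-e) * s ^ (-(-2 * a)) = s ^ (2 * a - e) := by
    rw [← Real.rpow_add hs]; ring_nf
  have e3 : s ^ (-e) * s ^ (-(-2 * (a + 1))) = s ^ (2 * a + 2 - e) := by
    rw [← Real.rpow_add hs]; ring_nf
  calc r ^ (-e) = s ^ (-e) * (r ^ (-e) * s ^ (- -e)) := by linear_combination -r ^ (-e) * e1
    _ ≤ _ := key
    _ = _ := by rw [← e2, ← e3]; ring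

theorem Admissible.weightExp_le (h : Admissible N a b) {p : ℝ} (hp : p ≤ critExp N a b) :
    weightExp N a b p ≤ 2 * a + 2 := by
  rcases hp.eq_or_lt with e | e
  · rw [e, h.weightExp_critExp]
  · exact ((h.weightExp_strictMono e).trans_eq h.weightExp_critExp).le

/-- In the Gagliardo–Nirenberg estimate the gradient collects q-2 powers from the radial decay and
e-2a from the choice of scale; their sum is what δ_q records. -/
theorem mul_deltaExp {q : ℝ} (hq : 2 < q) :
    q * deltaExp N a b q = weightExp N a b q - 2 * a + (q - 2) := by
  have : q ≠ 0 := by linarith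
  simp only [deltaExp, weightExp, decay]
  field_simp
  ring

/-- The Gagliardo–Nirenberg inequality for radial functions. -/
theorem wPow_le_rpow (h : Admissible N a b) {K q C : ℝ} {D : EuclideanSpace ℝ (Fin N) → ℝ}
    {ev : ℝ → X N a →L[ℝ] ℝ} (hK : 0 < K)
    (hev : ∀ w : X N a, ∀ᵐ x : EuclideanSpace ℝ (Fin N), w.1.fn x = ev ‖x‖ w)
    (hev' : ∀ r, 0 < r → ∀ w : X N a, |ev r w| ≤ K * r ^ (-decay N a) * ‖w.1.snd‖)
    (hq' : q ≤ critExp N a b)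
    (Sq : IsSubcritical (radEmb h) D (relWeight a b q) q C) (w : X N a) (hw : 0 < ‖w.1.snd‖) :
    wPow b q w.1.fn ≤ K ^ (q - 2) * (‖w.1.fst‖ ^ 2 + hardyConst N a ^ 2) *
      ‖w.1.snd‖ ^ (q * deltaExp N a b q) := by
  have hq := Sq.two_lt
  set n := ‖w.1.snd‖ with hn
  set e := weightExp N a b q with he
  obtain ⟨hi2, hH⟩ := hardy_integral h.hN h.ha h.ha' w.2.1
  have hi1 := integrable_fn_sq w.1
  have hpt : ∀ᵐ x : EuclideanSpace ℝ (Fin N), ‖x‖ ^ (-b * q) * |w.1.fn x| ^ q ≤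
      K ^ (q - 2) * n ^ (q - 2) * (n ^ (e - 2 * a) * (‖x‖ ^ (-2 * a) * w.1.fn x ^ 2) +
        n ^ (e - 2 * a - 2) * (‖x‖ ^ (-2 * (a + 1)) * w.1.fn x ^ 2)) := by
    filter_upwards [hev w, ae_ne_zero h.hN] with x k1 k2
    have hx : 0 < ‖x‖ := norm_pos_iff.2 k2
    have k3 := hev' ‖x‖ hx w
    rw [← k1] at k3
    -- At scale 1/n, with n the gradient norm, the mass term and the Hardy term both carry n^(e-2a).
    -- The mass stays in the constant, which is harmless on the sphere.
    have k4 := rpow_neg_le_scaled (a := a) hx (inv_pos.2 hw) (h.lt_weightExp hq).le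
      (h.weightExp_le hq')
    rw [Real.inv_rpow hw.le, Real.inv_rpow hw.le, ← Real.rpow_neg hw.le,
      ← Real.rpow_neg hw.le] at k4
    rw [show -(2 * a - weightExp N a b q) = e - 2 * a by rw [he]; ring,
      show -(2 * a + 2 - weightExp N a b q) = e - 2 * a - 2 by rw [he]; ring] at k4
    have k5 : |w.1.fn x| ^ (q - 2) ≤ K ^ (q - 2) * n ^ (q - 2) *
        ‖x‖ ^ (-(decay N a * (q - 2))) := by
      refine (Real.rpow_le_rpow (abs_nonneg _) k3 (by linarith)).trans_eq ?_
      rw [Real.mul_rpow (by positivity) hw.le, Real.mul_rpow hK.le (by positivity),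
        ← Real.rpow_mul hx.le, neg_mul]
      ring
    have k6 : ‖x‖ ^ (-b * q) * ‖x‖ ^ (-(decay N a * (q - 2))) = ‖x‖ ^ (-e) := by
      rw [← Real.rpow_add hx, he, weightExp]; ring_nf
    calc ‖x‖ ^ (-b * q) * |w.1.fn x| ^ q
        = ‖x‖ ^ (-b * q) * (|w.1.fn x| ^ (q - 2) * w.1.fn x ^ 2) := by rw [abs_rpow_eq hq]
      _ ≤ ‖x‖ ^ (-b * q) * (K ^ (q - 2) * n ^ (q - 2) *
        ‖x‖ ^ (-(decay N a * (q - 2))) * w.1.fn x ^ 2) := by gcongr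
      _ = K ^ (q - 2) * n ^ (q - 2) * (‖x‖ ^ (-e) * w.1.fn x ^ 2) := by rw [← k6]; ring
      _ ≤ K ^ (q - 2) * n ^ (q - 2) * ((n ^ (e - 2 * a) * ‖x‖ ^ (-2 * a) +
          n ^ (e - 2 * a - 2) * ‖x‖ ^ (-2 * (a + 1))) * w.1.fn x ^ 2) := by gcongr
      _ = _ := by ring
  have j1 := hi1.const_mul (n ^ (e - 2 * a))
  have j2 := hi2.const_mul (n ^ (e - 2 * a - 2))
  have hint := integral_mono_ae (integrable_wPow h Sq w) ((j1.add j2).const_mul _) hpt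
  rw [integral_const_mul, integral_add' j1 j2, integral_const_mul, integral_const_mul,
    integral_fn_sq_eq_norm_sq] at hint
  have e1 : n ^ (e - 2 * a - 2) * n ^ 2 = n ^ (e - 2 * a) := by
    rw [← Real.rpow_natCast n 2, ← Real.rpow_add hw]; norm_num
  have e2 : n ^ (q - 2) * n ^ (e - 2 * a) = n ^ (q * deltaExp N a b q) := by
    rw [← Real.rpow_add hw, mul_deltaExp hq, ← he]; ring_nf
  refine hint.trans ?_
  calc K ^ (q - 2) * n ^ (q - 2) * (n ^ (e - 2 * a) * ‖w.1.fst‖ ^ 2 +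
        n ^ (e - 2 * a - 2) * ∫ x, ‖x‖ ^ (-2 * (a + 1)) * w.1.fn x ^ 2)
      ≤ K ^ (q - 2) * n ^ (q - 2) * (n ^ (e - 2 * a) * ‖w.1.fst‖ ^ 2 +
        n ^ (e - 2 * a - 2) * (hardyConst N a ^ 2 * n ^ 2)) := by
        gcongr
        exact hH
    _ = _ := by
        rw [← e2, ← e1]; ring

/-- Split at the value η with η^(q-2) = ε: below it q-2 powers are worth at most ε, above it y^(q-p)
is at most η^(q-p). -/
theorem rpow_le_interpolate {q p ε y : ℝ} (hq : 2 < q) (hp : q < p) (hε : 0 < ε) (hy : 0 ≤ y) :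
    y ^ q ≤ ε * y ^ 2 + (ε ^ (1 / (q - 2))) ^ (q - p) * y ^ p := by
  set η := ε ^ (1 / (q - 2)) with hη
  have hη0 : 0 < η := Real.rpow_pos_of_pos hε _
  have hηε : η ^ (q - 2) = ε := by
    rw [hη, ← Real.rpow_mul hε.le, one_div, inv_mul_cancel₀ (by linarith), Real.rpow_one]
  rcases le_or_gt y η with h | h
  · have h1 : y ^ q = y ^ (q - 2) * y ^ 2 := by
      have := abs_rpow_eq hq y
      rwa [abs_of_nonneg hy] at this
    have h2 : y ^ (q - 2) ≤ ε := hηε ▸ Real.rpow_le_rpow hy h (by linarith)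
    have h3 : 0 ≤ η ^ (q - p) * y ^ p := by positivity
    nlinarith [sq_nonneg y]
  · have hy0 : 0 < y := hη0.trans h
    have h1 : y ^ q = y ^ (q - p) * y ^ p := by rw [← Real.rpow_add hy0]; ring_nf
    have h2 : y ^ (q - p) ≤ η ^ (q - p) := Real.rpow_le_rpow_of_nonpos hη0 h.le (by linarith)
    have h3 := mul_le_mul_of_nonneg_right h2 (Real.rpow_nonneg hy p)
    rw [h1]
    nlinarith [sq_nonneg y]

/-- Interpolation between the Hardy terms and the critical term. -/
theorem wPow_le_interpolate (h : Admissible N a b) {q C C' : ℝ}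
    {D : EuclideanSpace ℝ (Fin N) → ℝ} (hq' : q < critExp N a b)
    (Sq : IsSubcritical (radEmb h) D (relWeight a b q) q C)
    (Sp : IsSubcritical (radEmb h) D (relWeight a b (critExp N a b)) (critExp N a b) C')
    {ε : ℝ} (hε : 0 < ε) :
    ∃ L, ∀ w : X N a, wPow b q w.1.fn ≤
      ε * (‖w.1.fst‖ ^ 2 + hardyConst N a ^ 2 * ‖w.1.snd‖ ^ 2) +
        L * wPow b (critExp N a b) w.1.fn := by
  have hq := Sq.two_lt
  refine ⟨(ε ^ (1 / (q - 2))) ^ (q - critExp N a b), fun w => ?_⟩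
  set L := (ε ^ (1 / (q - 2))) ^ (q - critExp N a b) with hL
  obtain ⟨hi2, hH⟩ := hardy_integral h.hN h.ha h.ha' w.2.1
  have hi1 := integrable_fn_sq w.1
  have hpt : ∀ᵐ x : EuclideanSpace ℝ (Fin N), ‖x‖ ^ (-b * q) * |w.1.fn x| ^ q ≤
      ε * (‖x‖ ^ (-2 * a) * w.1.fn x ^ 2 + ‖x‖ ^ (-2 * (a + 1)) * w.1.fn x ^ 2) +
        L * (‖x‖ ^ (-b * critExp N a b) * |w.1.fn x| ^ critExp N a b) := by
    filter_upwards [ae_ne_zero h.hN] with x k2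
    have hx : 0 < ‖x‖ := norm_pos_iff.2 k2
    -- Applied to |x|^(-b)|u|: the square has weight |x|^(-2b), which the sum of the two Hardy
    -- weights dominates because a < b < a+1.
    have k := rpow_le_interpolate hq hq' hε (y := ‖x‖ ^ (-b) * |w.1.fn x|) (by positivity)
    rw [Real.mul_rpow (by positivity) (abs_nonneg _), Real.mul_rpow (by positivity) (abs_nonneg _),
      ← Real.rpow_mul hx.le, ← Real.rpow_mul hx.le, mul_pow, sq_abs, ← Real.rpow_natCast (‖x‖ ^ _),
      ← Real.rpow_mul hx.le, ← hL] at k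
    refine k.trans ?_
    have k3 := rpow_neg_weightExp_le (a := a) (e := 2 * b) hx (by linarith [h.hab])
      (by linarith [h.hba])
    have e1 : -b * ((2 : ℕ) : ℝ) = -(2 * b) := by push_cast; ring
    rw [e1]
    have k4 := mul_le_mul_of_nonneg_right k3 (sq_nonneg (w.1.fn x))
    have := mul_le_mul_of_nonneg_left k4 hε.le
    linarith
  have hint := integral_mono_ae (integrable_wPow h Sq w)
    (((hi1.add hi2).const_mul ε).add ((integrable_wPow h Sp w).const_mul L)) hpt
  rw [integral_add' ((hi1.add hi2).const_mul ε) ((integrable_wPow h Sp w).const_mul L),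
    integral_const_mul, integral_const_mul, integral_add' hi1 hi2,
    integral_fn_sq_eq_norm_sq] at hint
  refine hint.trans (add_le_add ?_ le_rfl)
  gcongr
  exact hH

theorem wPow_nonneg (p : ℝ) (u : EuclideanSpace ℝ (Fin N) → ℝ) : 0 ≤ wPow b p u :=
  integral_nonneg fun x => by positivity

theorem norm_fst_of_mem_sphere {ρ : ℝ} {w : X N a} (hw : w ∈ sphere ρ) : ‖w.1.fst‖ ^ 2 = ρ ^ 2 := by
  rw [← integral_fn_sq_eq_norm_sq]; exact hw

/-- Coercivity of the energy on the sphere, subject to a bound on the Pohozaev functional. -/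
theorem exists_bound (h : Admissible N a b) {K q β ρ E₀ P₀ C C' : ℝ}
    {D : EuclideanSpace ℝ (Fin N) → ℝ} {ev : ℝ → X N a →L[ℝ] ℝ} (hK : 0 < K)
    (hev : ∀ w : X N a, ∀ᵐ x : EuclideanSpace ℝ (Fin N), w.1.fn x = ev ‖x‖ w)
    (hev' : ∀ r, 0 < r → ∀ w : X N a, |ev r w| ≤ K * r ^ (-decay N a) * ‖w.1.snd‖)
    (hq' : q < critExp N a b) (hβ : 0 < β)
    (Sq : IsSubcritical (radEmb h) D (relWeight a b q) q C)
    (Sp : IsSubcritical (radEmb h) D (relWeight a b (critExp N a b)) (critExp N a b) C') :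
    ∃ B, ∀ w ∈ sphere (N := N) (a := a) ρ, |energy b q β w| ≤ E₀ → |pohozaev b q β w| ≤ P₀ →
      ‖w‖ ≤ B := by
  have hq := Sq.two_lt
  have hp := h.two_lt_critExp
  set p := critExp N a b with hpdef
  set δ := deltaExp N a b q with hδ
  have hq0 : 0 < q := by linarith
  have hp0 : 0 < p := by linarith
  have hδq : 0 < q * δ := by
    rw [hδ, mul_deltaExp hq]; linarith [h.lt_weightExp hq]
  have hδ0 : 0 < δ := (mul_pos_iff_of_pos_left hq0).1 hδq
  suffices hs : ∃ B, ∀ w ∈ sphere (N := N) (a := a) ρ, |energy b q β w| ≤ E₀ →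
      |pohozaev b q β w| ≤ P₀ → ‖w.1.snd‖ ^ 2 ≤ B by
    obtain ⟨B, hB⟩ := hs
    refine ⟨√(ρ ^ 2 + B), fun w h1 h2 h3 => Real.le_sqrt_of_sq_le ?_⟩
    have := hB w h1 h2 h3
    have e : ‖w‖ ^ 2 = ‖w.1.fst‖ ^ 2 + ‖w.1.snd‖ ^ 2 := norm_sq_eq w.1
    rw [e, norm_fst_of_mem_sphere h1]; linarith
  -- If qδ_q < 2, the q-term grows more slowly than the squared gradient norm and ℰ_β - P_β/2^♯
  -- bounds the gradient. If qδ_q ≥ 2, the q-term in ℰ_β - P_β/2 is nonnegative, so this combination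
  -- bounds the critical term; interpolation and P_β then bound the gradient.
  rcases lt_or_ge (q * δ) 2 with hc | hc
  · set c := 1 / 2 - 1 / p with hcdef
    have hc0 : 0 < c := by
      rw [hcdef, sub_pos]; exact one_div_lt_one_div_of_lt two_pos hp
    set G := K ^ (q - 2) * (ρ ^ 2 + hardyConst N a ^ 2) with hG
    set L := (E₀ + P₀ / p + β * |1 / q - δ / p| * G) / c with hL
    refine ⟨max 1 ((L ^ (1 / (2 - q * δ))) ^ 2), fun w h1 h2 h3 => ?_⟩
    rcases le_or_gt ‖w.1.snd‖ 1 with hn | hn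
    · exact le_max_of_le_left (by nlinarith [norm_nonneg w.1.snd])
    refine le_max_of_le_right ?_
    have hn0 : 0 < ‖w.1.snd‖ := one_pos.trans hn
    have hgn := wPow_le_rpow h hK hev hev' hq'.le Sq w hn0
    rw [norm_fst_of_mem_sphere h1, ← hG, ← hδ] at hgn
    simp only [energy, gradSq_eq_norm_sq] at h2
    simp only [pohozaev, gradSq_eq_norm_sq] at h3
    rw [← hpdef] at h2 h3
    rw [← hδ] at h3
    set n := ‖w.1.snd‖
    set Q := wPow b q w.1.fn
    set R := wPow b p w.1.fn
    have hQ0 : 0 ≤ Q := wPow_nonneg q _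
    have hmain : c * n ^ 2 ≤ E₀ + P₀ / p + β * |1 / q - δ / p| * Q := by
      have e : c * n ^ 2 = (1 / 2 * n ^ 2 - β / q * Q - 1 / p * R) -
          (n ^ 2 - β * δ * Q - R) / p + β * (1 / q - δ / p) * Q := by
        rw [hcdef]; field_simp; ring
      rw [e]
      have k1 := le_of_abs_le h2
      have k2 : -(n ^ 2 - β * δ * Q - R) / p ≤ P₀ / p := by
        gcongr; exact (neg_le_abs _).trans h3
      have k3 : β * (1 / q - δ / p) * Q ≤ β * |1 / q - δ / p| * Q := by
        gcongr; exact le_abs_self _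
      rw [neg_div] at k2
      linarith
    have hnθ : 1 ≤ n ^ (q * δ) := Real.one_le_rpow hn.le hδq.le
    have hE0 : 0 ≤ E₀ + P₀ / p := by
      have := (abs_nonneg _).trans h2
      have := (abs_nonneg _).trans h3
      positivity
    have hmain2 : c * n ^ 2 ≤ (c * L) * n ^ (q * δ) := by
      have e : c * L = E₀ + P₀ / p + β * |1 / q - δ / p| * G := by
        rw [hL]; field_simp
      rw [e]
      have k1 : β * |1 / q - δ / p| * Q ≤ β * |1 / q - δ / p| * (G * n ^ (q * δ)) := by gcongr
      have k2 := mul_le_mul_of_nonneg_left hnθ hE0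
      linarith
    have hmain3 : n ^ (2 - q * δ) ≤ L := by
      have e : n ^ 2 = n ^ (2 - q * δ) * n ^ (q * δ) := by
        rw [← Real.rpow_add hn0, ← Real.rpow_natCast]; norm_num
      rw [e, mul_assoc] at hmain2
      have := le_of_mul_le_mul_left hmain2 hc0
      exact le_of_mul_le_mul_right this (by positivity)
    have hfin : n ≤ L ^ (1 / (2 - q * δ)) := by
      have := Real.rpow_le_rpow (by positivity) hmain3
        (show 0 ≤ 1 / (2 - q * δ) by rw [one_div_nonneg]; linarith)
      rwa [← Real.rpow_mul hn0.le, mul_one_div_cancel (by linarith), Real.rpow_one] at this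
    gcongr
  · set H2 := hardyConst N a ^ 2 with hH2
    have hH20 : 0 ≤ H2 := sq_nonneg _
    -- With this ε the gradient part of βδ_q times the q-term is at most half the squared gradient
    -- norm and can be absorbed; the summand 1 keeps the denominator positive.
    obtain ⟨L, hL⟩ := wPow_le_interpolate h hq' Sq Sp
      (ε := 1 / (2 * (β * δ) * (H2 + 1))) (by positivity)
    set ε := 1 / (2 * (β * δ) * (H2 + 1)) with hε
    set R₀ := (E₀ + P₀ / 2) / (1 / 2 - 1 / p) with hR0
    have hc0 : 0 < 1 / 2 - 1 / p := by
      rw [sub_pos]; exact one_div_lt_one_div_of_lt two_pos hp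
    refine ⟨2 * (P₀ + β * δ * (ε * ρ ^ 2 + |L| * R₀) + R₀), fun w h1 h2 h3 => ?_⟩
    have hint := hL w
    rw [norm_fst_of_mem_sphere h1] at hint
    simp only [energy, gradSq_eq_norm_sq] at h2
    simp only [pohozaev, gradSq_eq_norm_sq] at h3
    rw [← hpdef] at h2 h3 hint
    rw [← hδ] at h3
    set n := ‖w.1.snd‖
    set Q := wPow b q w.1.fn
    set R := wPow b p w.1.fn
    have hQ0 : 0 ≤ Q := wPow_nonneg q _
    have hR0' : 0 ≤ R := wPow_nonneg p _
    have hRle : R ≤ R₀ := by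
      rw [hR0, le_div_iff₀ hc0]
      have e : R * (1 / 2 - 1 / p) = (1 / 2 * n ^ 2 - β / q * Q - 1 / p * R) -
          (n ^ 2 - β * δ * Q - R) / 2 - β * Q * ((q * δ - 2) / (2 * q)) := by
        field_simp; ring
      rw [e]
      have k1 := le_of_abs_le h2
      have k2 := neg_le_of_abs_le h3
      have k3 : 0 ≤ β * Q * ((q * δ - 2) / (2 * q)) := by
        have : 0 ≤ q * δ - 2 := by linarith
        positivity
      linarith
    have k1 := le_of_abs_le h3
    have k2 : L * R ≤ |L| * R₀ := by
      calc L * R ≤ |L| * R := by gcongr; exact le_abs_self L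
        _ ≤ |L| * R₀ := by gcongr
    have k3 : β * δ * Q ≤ β * δ * (ε * (ρ ^ 2 + H2 * n ^ 2) + |L| * R₀) := by
      have : 0 < β * δ := by positivity
      gcongr
      linarith
    have k4 : β * δ * (ε * (H2 * n ^ 2)) ≤ n ^ 2 / 2 := by
      have e : β * δ * (ε * (H2 * n ^ 2)) = n ^ 2 / 2 * (H2 / (H2 + 1)) := by
        rw [hε]; field_simp
      rw [e]
      refine mul_le_of_le_one_right (by positivity) ?_
      rw [div_le_one (by positivity)]; linarith
    linarith

/-! ### Lagrange multipliers and weak limits. -/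

theorem mem_tangentSpace_iff {w ψ : X N a} :
    ψ ∈ tangentSpace w ↔ inner ℝ w.1.fst ψ.1.fst = 0 := Iff.rfl

theorem abs_apply_le_restrict {E : Type*} [NormedAddCommGroup E] [NormedSpace ℝ E]
    (V : Submodule ℝ E) (G : E →L[ℝ] ℝ) {x : E} (hx : x ∈ V) {R : ℝ} (hR : ‖x‖ ≤ R) :
    |G x| ≤ ‖G.comp V.subtypeL‖ * R :=
  ((G.comp V.subtypeL).le_opNorm ⟨x, hx⟩).trans (mul_le_mul_of_nonneg_left hR (norm_nonneg _))

/-- Lagrange multipliers on the sphere. -/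
theorem abs_sub_multiplier_le {ρ : ℝ} (hρ : 0 < ρ) {w : X N a} (hw : w ∈ sphere ρ) {B : ℝ}
    (hB : ‖w‖ ≤ B) (G : X N a →L[ℝ] ℝ) (ψ : X N a) :
    |G ψ - G w / ρ ^ 2 * inner ℝ w.1.fst ψ.1.fst| ≤
      ‖G.comp (tangentSpace w).subtypeL‖ * (‖ψ‖ + ‖ψ‖ / ρ * B) := by
  have hA := norm_fst_of_mem_sphere hw
  have hA' : ‖w.1.fst‖ = ρ := (sq_eq_sq₀ (norm_nonneg _) hρ.le).1 hA
  set s : ℝ := inner ℝ w.1.fst ψ.1.fst with hs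
  have hs' : |s| ≤ ρ * ‖ψ‖ := by
    refine (abs_real_inner_le_norm _ _).trans ?_
    rw [hA']
    exact mul_le_mul_of_nonneg_left (norm_fst_le ψ.1) hρ.le
  -- Removing the component of ψ along w lands in the tangent space; the removed part produces the
  -- multiplier G(w)/ρ².
  have hmem : ψ - (s / ρ ^ 2) • w ∈ tangentSpace w := by
    rw [mem_tangentSpace_iff]
    have e : (ψ - (s / ρ ^ 2) • w).1.fst = ψ.1.fst - (s / ρ ^ 2) • w.1.fst := rfl
    rw [e, inner_sub_right, inner_smul_right, real_inner_self_eq_norm_sq, hA, ← hs]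
    field_simp
    ring
  have e : G ψ - G w / ρ ^ 2 * s = G (ψ - (s / ρ ^ 2) • w) := by
    rw [map_sub, map_smul, smul_eq_mul]
    ring
  rw [e]
  refine abs_apply_le_restrict _ G hmem ?_
  refine (norm_sub_le ψ ((s / ρ ^ 2) • w)).trans (add_le_add le_rfl ?_)
  rw [norm_smul, Real.norm_eq_abs, abs_div, abs_of_pos (by positivity : 0 < ρ ^ 2)]
  refine mul_le_mul ?_ hB (norm_nonneg _) (by positivity)
  rw [div_le_div_iff₀ (by positivity) hρ]
  nlinarith

/-- By `mul_deltaExp`, q(δ_q - 1) = e - 2a - 2, which is negative below 2^♯. This is the source of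
the sign of the multiplier. -/
theorem deltaExp_lt_one (h : Admissible N a b) {q : ℝ} (hq : 2 < q) (hq' : q < critExp N a b) :
    deltaExp N a b q < 1 := by
  have h1 := mul_deltaExp (N := N) (a := a) (b := b) hq
  have h2 := (h.weightExp_strictMono hq').trans_eq h.weightExp_critExp
  nlinarith

/-- A lost part whose gradient and critical terms both equal s has energy (1/2 - 1/2^♯)s; this is
the factor d/N of the threshold. -/
theorem half_sub_inv_critExp (h : Admissible N a b) :
    1 / 2 - 1 / critExp N a b = dExp a b / N := by
  have h1 := h.denom_pos
  have h2 : (0 : ℝ) < N := by exact_mod_cast (by have := h.hN; omega : 0 < N)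
  rw [critExp]
  field_simp
  ring

/-- Concentration alternative at the level of the limit values. -/
theorem rpow_bestConst_le (h : Admissible N a b) {S t : ℝ} (hS : 0 ≤ S) (ht : 0 < t)
    (hle : S * t ^ (2 / critExp N a b) ≤ t) : S ^ ((N : ℝ) / (2 * dExp a b)) ≤ t := by
  have hd := h.dExp_pos
  have hp := h.two_lt_critExp
  have hN : (0 : ℝ) < N := by exact_mod_cast (by have := h.hN; omega : 0 < N)
  have h1 := half_sub_inv_critExp h
  have h2 : S ≤ t ^ (2 * dExp a b / N) := by
    -- The exponents 2d/N and 2/2^♯ add up to 1. Positivity of the best constant plays no role.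
    have e : t = t ^ (2 * dExp a b / N) * t ^ (2 / critExp N a b) := by
      rw [← Real.rpow_add ht]
      have : 2 * dExp a b / N + 2 / critExp N a b = 1 := by
        linear_combination -2 * h1
      rw [this, Real.rpow_one]
    nth_rewrite 2 [e] at hle
    exact le_of_mul_le_mul_right hle (by positivity)
  have h3 := Real.rpow_le_rpow hS h2 (show 0 ≤ (N : ℝ) / (2 * dExp a b) by positivity)
  rwa [← Real.rpow_mul ht.le, show 2 * dExp a b / N * (N / (2 * dExp a b)) = 1 by field_simp,
    Real.rpow_one] at h3

/-- Evaluation at each radius is a continuous functional on `X`, so weak convergence implies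
pointwise convergence and no Rellich-type theorem is needed. -/
theorem ae_tendsto_radEmb (h : Admissible N a b) {ev : ℝ → X N a →L[ℝ] ℝ}
    (hev : ∀ w : X N a, ∀ᵐ x : EuclideanSpace ℝ (Fin N), w.1.fn x = ev ‖x‖ w)
    {v : ℕ → X N a} {w : X N a} (hv : WeaklyTendsto v w) :
    ∀ᵐ x ∂(hardyMeasure N a), Tendsto (fun n => radEmb h (v n) x) atTop (𝓝 (radEmb h w x)) := by
  rw [ae_hardyMeasure h.hN]
  filter_upwards [hev w, radEmb_coeFn h w, ae_all_iff.2 fun n => hev (v n),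
    ae_all_iff.2 fun n => radEmb_coeFn h (v n)] with x h1 h2 h3 h4
  rw [h2, h1]
  refine (hv (ev ‖x‖)).congr fun n => ?_
  rw [h4, h3]

theorem WeaklyTendsto.sub_const {v : ℕ → X N a} {w : X N a} (hv : WeaklyTendsto v w) :
    WeaklyTendsto (fun n => v n - w) 0 := fun l => by
  have := (hv l).sub_const (l w)
  simpa using this

theorem WeaklyTendsto.tendsto_inner {v : ℕ → X N a} {w : X N a} (hv : WeaklyTendsto v w)
    {H : Type*} [NormedAddCommGroup H] [InnerProductSpace ℝ H] (L : X N a →L[ℝ] H) (y : H) :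
    Tendsto (fun n => (inner ℝ (L (v n)) y : ℝ)) atTop (𝓝 (inner ℝ (L w) y)) := by
  simp only [real_inner_comm y]
  exact hv ((innerSL ℝ y).comp L)

theorem WeaklyTendsto.tendsto_norm_sq {v : ℕ → X N a} {w : X N a} (hv : WeaklyTendsto v w)
    {H : Type*} [NormedAddCommGroup H] [InnerProductSpace ℝ H] (L : X N a →L[ℝ] H) {t : ℝ}
    (ht : Tendsto (fun n => ‖L (v n)‖ ^ 2) atTop (𝓝 t)) :
    Tendsto (fun n => ‖L (v n - w)‖ ^ 2) atTop (𝓝 (t - ‖L w‖ ^ 2)) := by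
  have h1 := hv.tendsto_inner L (L w)
  rw [real_inner_self_eq_norm_sq] at h1
  have h2 := (ht.sub (h1.const_mul 2)).add_const (‖L w‖ ^ 2)
  rw [show t - 2 * ‖L w‖ ^ 2 + ‖L w‖ ^ 2 = t - ‖L w‖ ^ 2 by ring] at h2
  refine h2.congr fun n => ?_
  rw [map_sub, norm_sub_sq_real]

/-- A vanishing q-term kills the function, hence the critical term; the Pohozaev identity then kills
the gradient component. -/
theorem eq_zero_of_wPow_eq_zero (h : Admissible N a b) {D : EuclideanSpace ℝ (Fin N) → ℝ}
    {q β C : ℝ} (Sq : IsSubcritical (radEmb h) D (relWeight a b q) q C) {w : X N a}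
    (hP : pohozaev b q β w = 0) (hQ : wPow b q w.1.fn = 0) : w = 0 := by
  have hq := Sq.two_lt
  have hp := h.two_lt_critExp
  have h0 : w.1.fn =ᵐ[volume] 0 := by
    have := (integral_eq_zero_iff_of_nonneg (fun x => by positivity) (integrable_wPow h Sq w)).1 hQ
    filter_upwards [this, ae_ne_zero h.hN] with x h1 h2
    have hx : 0 < ‖x‖ := norm_pos_iff.2 h2
    simp only [Pi.zero_apply] at h1 ⊢
    have h3 := (mul_eq_zero.1 h1).resolve_left (Real.rpow_pos_of_pos hx _).ne'
    exact abs_eq_zero.1 ((Real.rpow_eq_zero (abs_nonneg _) (by linarith)).1 h3)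
  have hR : wPow b (critExp N a b) w.1.fn = 0 := by
    refine integral_eq_zero_of_ae ?_
    filter_upwards [h0] with x hx
    rw [hx]
    simp [Real.zero_rpow (show critExp N a b ≠ 0 by linarith)]
  have hT : ‖w.1.snd‖ ^ 2 = 0 := by
    rw [pohozaev, gradSq_eq_norm_sq, hQ, hR] at hP
    linarith
  have hA : ‖w.1.fst‖ ^ 2 = 0 := by
    rw [← integral_fn_sq_eq_norm_sq]
    refine integral_eq_zero_of_ae ?_
    filter_upwards [h0] with x hx
    rw [hx]; simp
  have e : ‖w‖ ^ 2 = ‖w.1.fst‖ ^ 2 + ‖w.1.snd‖ ^ 2 := norm_sq_eq w.1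
  rw [hT, hA, add_zero] at e
  exact norm_eq_zero.1 (pow_eq_zero_iff (two_ne_zero)|>.1 e)

/-- Palais–Smale sequences with bounded Pohozaev functional are bounded and, along a subsequence,
converge weakly, with convergent Dirichlet energies. -/
theorem exists_weak_limit (h : Admissible N a b) {q β ρ m C C' K : ℝ}
    {D : EuclideanSpace ℝ (Fin N) → ℝ} {ev : ℝ → X N a →L[ℝ] ℝ} (hK : 0 < K)
    (hev : ∀ w : X N a, ∀ᵐ x : EuclideanSpace ℝ (Fin N), w.1.fn x = ev ‖x‖ w)
    (hev' : ∀ r, 0 < r → ∀ w : X N a, |ev r w| ≤ K * r ^ (-decay N a) * ‖w.1.snd‖)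
    (hq' : q < critExp N a b) (hβ : 0 < β)
    (Sq : IsSubcritical (radEmb h) D (relWeight a b q) q C)
    (Sp : IsSubcritical (radEmb h) D (relWeight a b (critExp N a b)) (critExp N a b) C')
    {u : ℕ → X N a} (hPS : IsPalaisSmale b q β ρ m u)
    (hP : Tendsto (fun n => pohozaev b q β (u n)) atTop (𝓝 0)) :
    ∃ (k : ℕ → ℕ) (w : X N a) (B t : ℝ), StrictMono k ∧ (∀ n, ‖u (k n)‖ ≤ B) ∧
      WeaklyTendsto (u ∘ k) w ∧ Tendsto (fun n => ‖(u (k n)).1.snd‖ ^ 2) atTop (𝓝 t) := by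
  obtain ⟨E₀, hE⟩ := (Metric.isBounded_range_of_tendsto _ hPS.energy_tendsto).exists_norm_le
  obtain ⟨P₀, hP₀⟩ := (Metric.isBounded_range_of_tendsto _ hP).exists_norm_le
  obtain ⟨B, hB⟩ := exists_bound (ρ := ρ) (E₀ := E₀) (P₀ := P₀) h hK hev hev' hq' hβ Sq Sp
  have hB' : ∀ n, ‖u n‖ ≤ B := fun n =>
    hB _ (hPS.mem_sphere n) (hE _ ⟨n, rfl⟩) (hP₀ _ ⟨n, rfl⟩)
  have := completeSpace_X (N := N) (a := a) h.hN h.ha h.ha'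
  obtain ⟨k₁, w, hk₁, hw⟩ := exists_subseq_weak hB'
  -- A second extraction makes the Dirichlet energies converge; the limit t may exceed the Dirichlet
  -- energy of w.
  obtain ⟨t, -, k₂, hk₂, ht⟩ := (isCompact_Icc (a := (0 : ℝ)) (b := B ^ 2)).tendsto_subseq
    (x := fun n => ‖(u (k₁ n)).1.snd‖ ^ 2) fun n => ⟨by positivity, by
      have := (norm_snd_le (u (k₁ n)).1).trans (hB' (k₁ n))
      gcongr⟩
  exact ⟨k₁ ∘ k₂, w, B, t, hk₁.comp hk₂, fun n => hB' _,
    fun l => (hw l).comp hk₂.tendsto_atTop, ht⟩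

set_option maxHeartbeats 1000000 in
/-- The equation satisfied by the weak limit of a Palais–Smale sequence. -/
theorem limit_equation (h : Admissible N a b) {q β ρ B C C' : ℝ}
    {D : EuclideanSpace ℝ (Fin N) → ℝ} (hρ : 0 < ρ)
    (Sq : IsSubcritical (radEmb h) D (relWeight a b q) q C)
    (Sp : IsSubcritical (radEmb h) D (relWeight a b (critExp N a b)) (critExp N a b) C')
    {v : ℕ → X N a} {w : X N a} (hvS : ∀ n, v n ∈ sphere ρ) (hB : ∀ n, ‖v n‖ ≤ B)
    (hw : WeaklyTendsto v w)
    (hae : ∀ᵐ x ∂(hardyMeasure N a),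
      Tendsto (fun n => radEmb h (v n) x) atTop (𝓝 (radEmb h w x)))
    (hQ : Tendsto (fun n => wPow b q (v n).1.fn) atTop (𝓝 (wPow b q w.1.fn)))
    (hd : Tendsto (fun n => ‖(fderiv ℝ (energy b q β) (v n)).comp (tangentSpace (v n)).subtypeL‖)
      atTop (𝓝 0))
    (hP : Tendsto (fun n => pohozaev b q β (v n)) atTop (𝓝 0)) (ψ : X N a) :
    inner ℝ w.1.snd ψ.1.snd =
      -(β * (1 - deltaExp N a b q) * wPow b q w.1.fn) / ρ ^ 2 * inner ℝ w.1.fst ψ.1.fst +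
        β * Sq.nonlin w ψ + Sp.nonlin w ψ := by
  set G : ℕ → X N a →L[ℝ] ℝ := fun n =>
    (innerSL ℝ (v n).1.snd).comp (sndX N a) - β • Sq.nonlin (v n) - Sp.nonlin (v n) with hG
  have hGf : ∀ n, fderiv ℝ (energy b q β) (v n) = G n := fun n =>
    (hasFDerivAt_energy h β Sq Sp (v n)).fderiv
  have hGa : ∀ n ψ, G n ψ = inner ℝ (v n).1.snd ψ.1.snd - β * Sq.nonlin (v n) ψ -
      Sp.nonlin (v n) ψ := fun n ψ => rfl
  have lim0 : Tendsto (fun n => G n ψ - G n (v n) / ρ ^ 2 * inner ℝ (v n).1.fst ψ.1.fst) atTop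
      (𝓝 0) := by
    have h1 := hd.mul_const (‖ψ‖ + ‖ψ‖ / ρ * B)
    rw [zero_mul] at h1
    refine squeeze_zero_norm (fun n => ?_) h1
    have := abs_sub_multiplier_le hρ (hvS n) (hB n) (G n) ψ
    rwa [← hGf n] at this ⊢
  -- Since G_n(v_n) = P_β(v_n) - β(1-δ_q) times the q-term, the hypothesis on P_β determines the
  -- limit of the multipliers.
  have limG : Tendsto (fun n => G n (v n)) atTop
      (𝓝 (-(β * (1 - deltaExp N a b q) * wPow b q w.1.fn))) := by
    have h1 := hP.sub (hQ.const_mul (β * (1 - deltaExp N a b q)))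
    rw [zero_sub] at h1
    refine h1.congr fun n => ?_
    rw [hGa, Sq.nonlin_self, Sp.nonlin_self, powInt_radEmb, powInt_radEmb,
      real_inner_self_eq_norm_sq (v n).1.snd, pohozaev, gradSq_eq_norm_sq]
    ring
  have w1 : Tendsto (fun n => (inner ℝ (v n).1.snd ψ.1.snd : ℝ)) atTop
      (𝓝 (inner ℝ w.1.snd ψ.1.snd)) := by
    simpa only [sndX_apply] using hw.tendsto_inner (sndX N a) ψ.1.snd
  have w2 : Tendsto (fun n => (inner ℝ (v n).1.fst ψ.1.fst : ℝ)) atTop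
      (𝓝 (inner ℝ w.1.fst ψ.1.fst)) := by
    simpa only [fstX_apply] using hw.tendsto_inner (fstX N a) ψ.1.fst
  have n1 := Sq.tendsto_nonlin hB hae ψ
  have n2 := Sp.tendsto_nonlin hB hae ψ
  have lim1 := ((w1.sub (n1.const_mul β)).sub n2).sub ((limG.div_const (ρ ^ 2)).mul w2)
  linarith [tendsto_nhds_unique lim0 lim1]

end CKN

/-! ### Conclusion: the defect of gradient energy and the two alternatives. -/

set_option maxHeartbeats 1000000 in
theorem proposition3p1 (N : ℕ) (hN : 2 < N) (a b q β ρ m : ℝ)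
    (ha : 0 < a) (ha' : a < ((N : ℝ) - 2) / 2) (hab : a < b) (hba : b < a + 1)
    (hq : 2 < q) (hq' : q < CKN.critExp N a b) (hβ : 0 < β) (hρ : 0 < ρ)
    (u : ℕ → CKN.X N a)
    (hPS : CKN.IsPalaisSmale b q β ρ m u)
    (hm : m < CKN.dExp a b / N * CKN.bestConst N a b ^ ((N : ℝ) / (2 * CKN.dExp a b)))
    (hm0 : m ≠ 0)
    (hP : Tendsto (fun n => CKN.pohozaev b q β (u n)) atTop (𝓝 0)) :
    (∃ (k : ℕ → ℕ) (u₀ : CKN.X N a) (l : ℝ), StrictMono k ∧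
        CKN.WeaklyTendsto (u ∘ k) u₀ ∧ ¬ Tendsto (u ∘ k) atTop (𝓝 u₀) ∧
        u₀ ≠ 0 ∧ l < 0 ∧ CKN.IsSolution b q β ρ l u₀ ∧
        CKN.energy b q β u₀ ≤
          m - CKN.dExp a b / N * CKN.bestConst N a b ^ ((N : ℝ) / (2 * CKN.dExp a b))) ∨
    (∃ (k : ℕ → ℕ) (u₀ : CKN.X N a) (l : ℝ), StrictMono k ∧
        Tendsto (u ∘ k) atTop (𝓝 u₀) ∧
        l < 0 ∧ CKN.IsSolution b q β ρ l u₀ ∧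
        CKN.energy b q β u₀ = m) := by
  have h : CKN.Admissible N a b := ⟨hN, ha, ha', hab, hba⟩
  obtain ⟨K, ev, hK, hev, hev', hS⟩ := CKN.exists_isSubcritical h
  have Sq := hS q hq hq'.le
  have Sp := hS _ h.two_lt_critExp le_rfl
  have hcomp := CKN.compactness_condition h hK hq hq'
  obtain ⟨k, w, B, t, hk, hB, hw, ht⟩ :=
    CKN.exists_weak_limit h hK hev hev' hq' hβ Sq Sp hPS hP
  have hk' := hk.tendsto_atTop
  set v : ℕ → CKN.X N a := u ∘ k with hv
  set p := CKN.critExp N a b with hp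
  set δ := CKN.deltaExp N a b q with hδ
  set Q := CKN.wPow b q w.1.fn with hQdef
  set R := CKN.wPow b p w.1.fn with hRdef
  have hvS : ∀ n, v n ∈ CKN.sphere ρ := fun n => hPS.mem_sphere _
  have hBd : ∀ n, ‖v n - w‖ ≤ B + ‖w‖ := fun n => (norm_sub_le _ _).trans
    (add_le_add (hB n) le_rfl)
  have hae := CKN.ae_tendsto_radEmb h hev hw
  have hae0 : ∀ᵐ x ∂(CKN.hardyMeasure N a),
      Tendsto (fun n => CKN.radEmb h (v n - w) x) atTop (𝓝 0) := by
    have h1 := CKN.ae_tendsto_radEmb h hev hw.sub_const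
    rw [map_zero] at h1
    filter_upwards [h1, Lp.coeFn_zero ℝ 2 (CKN.hardyMeasure N a)] with x h2 h3
    rwa [h3] at h2
  -- limits of the nonlinear terms
  have hQ : Tendsto (fun n => CKN.wPow b q (v n).1.fn) atTop (𝓝 Q) := by
    have h1 := Sq.brezisLieb hB hae
    have h2 := Sq.tendsto_powInt_zero hcomp hBd hae0
    have h3 := (h1.add h2).add_const (CKN.powInt (CKN.radEmb h) (CKN.relWeight a b q) q w)
    simp only [CKN.powInt_radEmb] at h3
    rw [add_zero, zero_add] at h3
    refine h3.congr fun n => ?_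
    simp only [hv, Function.comp]
    ring
  -- P_β(u_n) → 0 expresses the critical terms through quantities already known to converge.
  have hR : Tendsto (fun n => CKN.wPow b p (v n).1.fn) atTop (𝓝 (t - β * δ * Q)) := by
    have h1 := (ht.sub (hQ.const_mul (β * δ))).sub (hP.comp hk')
    rw [sub_zero] at h1
    refine h1.congr fun n => ?_
    simp only [Function.comp, CKN.pohozaev, CKN.gradSq_eq_norm_sq, hv]
    ring
  have hR' : Tendsto (fun n => CKN.wPow b p (v n - w).1.fn) atTop (𝓝 (t - β * δ * Q - R)) := by
    have h1 := Sp.brezisLieb hB hae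
    simp only [CKN.powInt_radEmb] at h1
    have h2 := (hR.sub_const R).sub h1
    rw [sub_zero] at h2
    refine h2.congr fun n => ?_
    simp only [hv, Function.comp]
    ring
  have hT' : Tendsto (fun n => ‖(v n - w).1.snd‖ ^ 2) atTop (𝓝 (t - ‖w.1.snd‖ ^ 2)) :=
    hw.tendsto_norm_sq (CKN.sndX N a) ht
  have hE : m = 1 / 2 * t - β / q * Q - 1 / p * (t - β * δ * Q) := by
    refine tendsto_nhds_unique (hPS.energy_tendsto.comp hk') ?_
    refine (((ht.const_mul (1 / 2)).sub (hQ.const_mul (β / q))).sub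
      (hR.const_mul (1 / p))).congr fun n => ?_
    simp only [Function.comp, CKN.energy, CKN.gradSq_eq_norm_sq, hv, hp]
  -- the limit equation
  set l : ℝ := -(β * (1 - δ) * Q) / ρ ^ 2 with hl
  have hcrit := CKN.limit_equation h hρ Sq Sp hvS hB hw hae hQ (hPS.deriv_tendsto.comp hk')
    (hP.comp hk')
  obtain ⟨hPoh, hweak⟩ := CKN.critical_point h hK hev hev' hq' Sq Sp hcrit
  have hPoh' : ‖w.1.snd‖ ^ 2 = β * δ * Q + R := by
    have := hPoh
    rw [CKN.pohozaev, CKN.gradSq_eq_norm_sq] at this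
    linarith
  have hEw : CKN.energy b q β w = 1 / 2 * ‖w.1.snd‖ ^ 2 - β / q * Q - 1 / p * R := by
    rw [CKN.energy, CKN.gradSq_eq_norm_sq]
  have hdN : 1 / 2 - 1 / p = CKN.dExp a b / N := CKN.half_sub_inv_critExp h
  have hdpos : 0 < CKN.dExp a b / N := by
    have := h.two_lt_critExp
    rw [← hdN, sub_pos]
    exact one_div_lt_one_div_of_lt two_pos this
  -- The gradient energy lost in the limit. The Pohozaev identity for w makes it equal to the
  -- critical term lost as well.
  set s := t - ‖w.1.snd‖ ^ 2 with hs
  have hR'' : Tendsto (fun n => CKN.wPow b p (v n - w).1.fn) atTop (𝓝 s) := by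
    rw [hs, hPoh']
    convert hR' using 2
    ring
  have hEs : m = CKN.energy b q β w + CKN.dExp a b / N * s := by
    rw [hEw, hE, ← hdN, hs, hPoh']; ring
  have hs0 : 0 ≤ s := ge_of_tendsto' hT' fun n => sq_nonneg _
  have hp2 : 0 ≤ 2 / p := by
    have := h.two_lt_critExp
    positivity
  have hSob : CKN.bestConst N a b * s ^ (2 / p) ≤ s :=
    le_of_tendsto_of_tendsto' ((hR''.rpow_const (Or.inr hp2)).const_mul _) hT'
      fun n => CKN.bestConst_mul_le h (v n - w)
  have halt : s = 0 ∨ 0 < s ∧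
      CKN.bestConst N a b ^ ((N : ℝ) / (2 * CKN.dExp a b)) ≤ s := by
    rcases hs0.eq_or_lt with e | e
    · exact Or.inl e.symm
    · exact Or.inr ⟨e, CKN.rpow_bestConst_le h CKN.bestConst_nonneg e hSob⟩
  -- For w = 0 the level is m = (d/N)s: a vanishing s contradicts m ≠ 0, and s ≥ S^(N/(2d))
  -- contradicts the upper bound on m.
  have hw0 : w ≠ 0 := by
    intro hz
    have hE0 : CKN.energy b q β w = 0 := by
      have hQ0 : Q = 0 := by
        rw [hQdef, ← CKN.powInt_radEmb h, ← Sq.nonlin_self, hz, map_zero]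
      have hR0 : R = 0 := by
        rw [hRdef, ← CKN.powInt_radEmb h, ← Sp.nonlin_self, hz, map_zero]
      rw [hEw, hPoh', hQ0, hR0]; ring
    rw [hE0, zero_add] at hEs
    rcases halt with e | ⟨-, e⟩
    · exact hm0 (by rw [hEs, e, mul_zero])
    · exact absurd hm (not_lt.2 (hEs ▸ mul_le_mul_of_nonneg_left e hdpos.le))
  have hQpos : 0 < Q := (CKN.wPow_nonneg q _).lt_of_ne fun e =>
    hw0 (CKN.eq_zero_of_wPow_eq_zero h Sq hPoh e.symm)
  have hδ1 : δ < 1 := CKN.deltaExp_lt_one h hq hq'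
  have hl0 : l < 0 := by
    rw [hl]
    refine div_neg_of_neg_of_pos (neg_neg_of_pos ?_) (by positivity)
    exact mul_pos (mul_pos hβ (by linarith)) hQpos
  -- Testing the equation with w and subtracting P_β(w) = 0 gives λ‖w‖² = -β(1-δ_q)Q in the weighted
  -- L² norm. By the definition of λ the right side is λρ², and λ ≠ 0.
  have hmass : ‖w.1.fst‖ ^ 2 = ρ ^ 2 := by
    have h1 := hcrit w
    rw [Sq.nonlin_self, Sp.nonlin_self, CKN.powInt_radEmb, CKN.powInt_radEmb,
      real_inner_self_eq_norm_sq w.1.snd, real_inner_self_eq_norm_sq w.1.fst, hPoh'] at h1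
    have h2 : l * ρ ^ 2 = -(β * (1 - δ) * Q) := by rw [hl]; field_simp
    refine mul_left_cancel₀ hl0.ne ?_
    rw [h2]
    linarith
  have hsol : CKN.IsSolution b q β ρ l w := by
    refine ⟨?_, hweak⟩
    change ∫ x, ‖x‖ ^ (-2 * a) * w.1.fn x ^ 2 = ρ ^ 2
    rw [CKN.integral_fn_sq_eq_norm_sq, hmass]
  rcases halt with e | ⟨hspos, e⟩
  · refine Or.inr ⟨k, w, l, hk, ?_, hl0, hsol, by rw [hEs, e]; ring⟩
    -- Mass conservation turns weak into strong convergence of the functions, and s = 0 does the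
    -- same for the gradients.
    have hA' : Tendsto (fun n => ‖(v n - w).1.fst‖ ^ 2) atTop (𝓝 (ρ ^ 2 - ‖w.1.fst‖ ^ 2)) := by
      refine hw.tendsto_norm_sq (CKN.fstX N a) (tendsto_const_nhds.congr fun n => ?_)
      exact (CKN.norm_fst_of_mem_sphere (hvS n)).symm
    rw [hmass, sub_self] at hA'
    rw [e] at hT'
    have hsum := hA'.add hT'
    rw [add_zero] at hsum
    have hsq : Tendsto (fun n => ‖v n - w‖ ^ 2) atTop (𝓝 0) :=
      hsum.congr fun n => (CKN.norm_sq_eq (v n - w).1).symm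
    rw [tendsto_iff_norm_sub_tendsto_zero]
    have := hsq.sqrt
    rw [Real.sqrt_zero] at this
    exact this.congr fun n => Real.sqrt_sq (norm_nonneg _)
  · refine Or.inl ⟨k, w, l, hk, hw, fun hstrong => ?_, hw0, hl0, hsol, ?_⟩
    -- Strong convergence would force s = 0.
    · have h1 := ((CKN.sndX N a).continuous.tendsto 0).comp
        (tendsto_sub_nhds_zero_iff.2 hstrong)
      have h2 := (h1.norm.pow 2)
      rw [map_zero, norm_zero, zero_pow two_ne_zero] at h2
      exact hspos.ne' (tendsto_nhds_unique hT' h2)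
    · have := mul_le_mul_of_nonneg_left e hdpos.le
      linarith
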